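/- Let $H$ be the Hilbert transform on $L^2(\mathbb R)$, $\widehat{H[f]}(\xi)=-i\,\mathrm{sgn}(\xi)\hat f(\xi)$ (equivalently $H[f](x)=\frac1\pi\,\mathrm{p.v.}\int_{\mathbb R}\frac{f(y)}{x-y}\,dy$). For real $s\ge 0$ let $H^s=H^s(\mathbb R;\mathbb R)$ be the space of real-valued $f\in L^2(\mathbb R)$ with $\|f\|_{H^s}=\|(1+|\xi|^2)^{s/2}\hat f\|_{L^2}<\infty$. A solution with initial data $u_0\in H^k$ on a time interval $J\ni 0$ in $[0,\infty)$ is a function $u\in C(J;H^k)$ with $u(0)=u_0$ that satisfies $$\partial_t u+u\,\partial_x u=H[u]$$ in the sense that at every interior time $t$ of $J$ and for every Schwartz function $\varphi$, $\frac{d}{dt}\int\varphi\,u\,dx=\int\varphi\,H[u]\,dx-\int\varphi\,u\,\partial_xu\,dx$. **Theorem.** The initial value problem for the Burgers–Hilbert equation, $\partial_t u+u\,\partial_xu=H[u]$, $u(x,0)=u_0(x)$, is locally well-posed in $H^k$ for every real $k>3/2$. That is, there is a constant $C>0$ depending only on $k$ such that every $u_0\in H^k$ has a maximal time of existence $T_*=T_*(u_0)\in(0,\infty]$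 and a solution $u$ on $[0,T_*)$ with the following properties. 1. (Existence and regularity) $u\in C([0,T_*);H^k)\cap C^1([0,T_*);H^{k-1})$. 2. (Uniqueness and maximality) If $v\in C([0,T];H^k)$, $T\ge 0$, is a solution on $[0,T]$ with the same data $u_0$, then $T<T_*$ and $v=u$ on $[0,T]$. 3. (Time of existence) $T_*\ge \frac{1}{2C\|u_0\|_{H^k}}$ (with $T_*=\infty$ if $u_0=0$), and $\|u(t)\|_{H^k}\le 2\|u_0\|_{H^k}$ for all $t\in[0,T_*)$ with $2C\|u_0\|_{H^k}\,t\le 1$. 4. (Minimal blowup rate) $T_*-t\ge\frac{1}{2C\|u(t)\|_{H^k}}$ for all $t\in[0,T_*)$; in particular, if $T_*<\infty$, then $\|u(t)\|_{H^k}\ge\frac{1}{2C\,(T_*-t)}$. 5. (Continuous dependence) For every $T\in[0,T_*(u_0))$ and $\varepsilon>0$ there is $\delta>0$ such that for every $v_0\in H^k$ with $\|v_0-u_0\|_{H^k}<\delta$ one has $T<T_*(v_0)$, and the corresponding solution $v$ satisfies $\|v(t)-u(t)\|_{H^k}<\varepsilon$ for all $t\in[0,T]$. -/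

import Mathlib

open MeasureTheory FourierTransform Set
open scoped ENNReal SchwartzMap

noncomputable section

namespace BurgersHilbert

/-- Real-valued square integrable functions on the line (modulo a.e. equality). -/
abbrev L2R := Lp ℝ 2 (volume : Measure ℝ)

/-- Complex-valued square integrable functions on the line (modulo a.e. equality). -/
abbrev L2C := Lp ℂ 2 (volume : Measure ℝ)

/-- A real-valued `L²` function regarded as a complex-valued one. -/
def complexify : L2R →L[ℝ] L2C := Complex.ofRealCLM.compLpL 2 volume

theorem complexify_coeFn (f : L2R) :
    (complexify f : ℝ → ℂ) =ᵐ[volume] fun x => ((f x : ℝ) : ℂ) :=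
  ContinuousLinearMap.coeFn_compLp _ f

theorem complexify_injective : Function.Injective complexify := by
  intro f g h
  apply Lp.ext
  filter_upwards [complexify_coeFn f, complexify_coeFn g] with x hf hg
  rw [h, hg] at hf
  exact_mod_cast hf.symm

theorem toTemperedDistribution_injective :
    Function.Injective (fun f : L2C => (f : 𝓢'(ℝ, ℂ))) := by
  have h := LinearMap.ker_eq_bot.1
    (Lp.ker_toTemperedDistributionCLM_eq_bot (E := ℝ) (F := ℂ) (μ := volume) (p := 2))
  exact h

/-! ### The Hilbert transform -/

/-- The symbol `-i sgn ξ` of the Hilbert transform. -/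
def hilbertSymbol (ξ : ℝ) : ℂ := -Complex.I * (Real.sign ξ : ℝ)

theorem memLp_hilbertSymbol : MemLp hilbertSymbol ∞ (volume : Measure ℝ) := by
  have hm : Measurable hilbertSymbol := by
    unfold hilbertSymbol
    apply Measurable.const_mul
    apply Complex.measurable_ofReal.comp
    unfold Real.sign
    exact Measurable.ite measurableSet_Iio measurable_const
      (Measurable.ite measurableSet_Ioi measurable_const measurable_const)
  refine memLp_top_of_bound hm.aestronglyMeasurable 1 (Filter.Eventually.of_forall fun ξ => ?_)
  rcases Real.sign_apply_eq ξ with h | h | h <;> simp [hilbertSymbol, h]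

/-- The Hilbert transform on `L²`: the Fourier multiplier with symbol `-i sgn ξ`. -/
def hilbertTransform (f : L2C) : L2C :=
  𝓕⁻ ((memLp_hilbertSymbol.toLp hilbertSymbol • 𝓕 f : L2C))

/-! ### The Sobolev spaces `H^s(ℝ; ℝ)`, `s ≥ 0` -/

/-- The real-valued `L²` functions which belong to the Sobolev space of order `s`. -/
def sobolevSubmodule (s : ℝ) : Submodule ℝ L2R where
  carrier := {f | TemperedDistribution.MemSobolev s 2 (complexify f : 𝓢'(ℝ, ℂ))}
  add_mem' {f g} hf hg := by
    have h := TemperedDistribution.MemSobolev.add hf hg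
    simp only [mem_ofPred_eq, map_add]
    rw [← Lp.toTemperedDistributionCLM_apply] at h ⊢
    rw [← Lp.toTemperedDistributionCLM_apply, ← map_add] at h
    exact h
  zero_mem' := by
    simp only [mem_ofPred_eq, map_zero]
    rw [← Lp.toTemperedDistributionCLM_apply, map_zero]
    exact TemperedDistribution.memSobolev_fun_zero _ _ _ _
  smul_mem' c f hf := by
    have h := TemperedDistribution.MemSobolev.smul (c : ℂ) hf
    simp only [mem_ofPred_eq, map_smul]
    rw [← Lp.toTemperedDistributionCLM_apply] at h ⊢
    rw [← map_smul] at h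
    exact h

/-- The Sobolev space `H^s(ℝ; ℝ)` for `s ≥ 0`, with the norm of `(1 + ξ²)^{s/2} 𝓕 f` in `L²`. -/
def RealSobolev (s : ℝ) : Type := sobolevSubmodule s

instance (s : ℝ) : AddCommGroup (RealSobolev s) :=
  inferInstanceAs (AddCommGroup (sobolevSubmodule s))

instance (s : ℝ) : Module ℝ (RealSobolev s) :=
  inferInstanceAs (Module ℝ (sobolevSubmodule s))

/-- The inclusion of `H^s` in `L²`. -/
def RealSobolev.toL2 {s : ℝ} : RealSobolev s →ₗ[ℝ] L2R := (sobolevSubmodule s).subtype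

theorem RealSobolev.exists_bessel {s : ℝ} (f : RealSobolev s) :
    ∃ g : L2C, TemperedDistribution.besselPotential ℝ ℂ s
      (complexify f.toL2 : 𝓢'(ℝ, ℂ)) = (g : 𝓢'(ℝ, ℂ)) :=
  f.2

/-- The Bessel potential `𝓕⁻ (1 + ξ²)^{s/2} 𝓕 f ∈ L²` of an element `f` of `H^s`. -/
def RealSobolev.bessel {s : ℝ} : RealSobolev s →ₗ[ℝ] L2C where
  toFun f := f.exists_bessel.choose
  map_add' f g := by
    apply toTemperedDistribution_injective
    have h := (f + g).exists_bessel.choose_spec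
    have hf := f.exists_bessel.choose_spec
    have hg := g.exists_bessel.choose_spec
    simp only [← Lp.toTemperedDistributionCLM_apply, map_add] at h hf hg ⊢
    rw [← h, ← hf, ← hg]
  map_smul' c f := by
    apply toTemperedDistribution_injective
    have h := (c • f).exists_bessel.choose_spec
    have hf := f.exists_bessel.choose_spec
    have e : complexify ((c • f : RealSobolev s).toL2) = (c : ℂ) • complexify f.toL2 := by
      rw [map_smul, map_smul]; rfl
    have e' : ∀ w : L2C, (RingHom.id ℝ) c • w = (c : ℂ) • w := fun w => rfl
    have h' := h.symm.trans (congrArg (fun w : L2C =>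
      TemperedDistribution.besselPotential ℝ ℂ s (w : 𝓢'(ℝ, ℂ))) e)
    simp only [← Lp.toTemperedDistributionCLM_apply] at h' hf ⊢
    rw [e', h', map_smul, map_smul, map_smul]
    exact congrArg (fun w : 𝓢'(ℝ, ℂ) => (c : ℂ) • w) hf

theorem RealSobolev.bessel_spec {s : ℝ} (f : RealSobolev s) :
    TemperedDistribution.besselPotential ℝ ℂ s (complexify f.toL2 : 𝓢'(ℝ, ℂ)) =
      (f.bessel : 𝓢'(ℝ, ℂ)) :=
  f.exists_bessel.choose_spec

theorem RealSobolev.bessel_injective {s : ℝ} :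
    Function.Injective (RealSobolev.bessel : RealSobolev s →ₗ[ℝ] L2C) := by
  intro f g h
  have hf := f.bessel_spec
  rw [h, ← g.bessel_spec] at hf
  have hf' := congrArg (TemperedDistribution.besselPotential ℝ ℂ (-s)) hf
  simp only [TemperedDistribution.besselPotential_besselPotential_apply, add_neg_cancel,
    TemperedDistribution.besselPotential_zero, ContinuousLinearMap.id_apply] at hf'
  exact Subtype.ext (complexify_injective (toTemperedDistribution_injective hf'))

instance (s : ℝ) : NormedAddCommGroup (RealSobolev s) :=
  NormedAddCommGroup.induced (RealSobolev s) L2C RealSobolev.bessel RealSobolev.bessel_injective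

instance (s : ℝ) : NormedSpace ℝ (RealSobolev s) :=
  NormedSpace.induced ℝ (RealSobolev s) L2C RealSobolev.bessel

/-! ### Solutions of the Burgers-Hilbert equation -/

/-- `g` is the derivative of `f` in the sense of distributions. -/
def IsWeakDeriv (f g : L2R) : Prop :=
  TemperedDistribution.derivCLM ℂ (complexify f : 𝓢'(ℝ, ℂ)) = (complexify g : 𝓢'(ℝ, ℂ))

/-- `u ∈ C(J; H^k)` satisfies `∂ₜ u + u ∂ₓ u = H[u]` in the interior of the time interval `J`,
and `u(0) = u₀`. The equation holds in the sense of distributions in `x`: at every interior time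
`t` and for every test function `φ`,
`d/dt ∫ φ u = ∫ φ H[u] - ∫ φ u ∂ₓ u`. -/
structure IsSolutionOn {k : ℝ} (u₀ : RealSobolev k) (J : Set ℝ) (u : ℝ → RealSobolev k) :
    Prop where
  initial : u 0 = u₀
  continuousOn : ContinuousOn u J
  equation : ∀ t ∈ interior J, ∃ ux : L2R, IsWeakDeriv (u t).toL2 ux ∧
    ∀ φ : 𝓢(ℝ, ℂ),
      HasDerivAt (fun τ => ∫ x, φ x * ((u τ).toL2 x : ℂ))
        ((∫ x, φ x * hilbertTransform (complexify (u t).toL2) x) -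
          ∫ x, φ x * (((u t).toL2 x * ux x : ℝ) : ℂ)) t

/-- `u ∈ C¹(J; H^s)`, for a curve `u` in a Sobolev space of possibly different order. -/
def IsC1Into {k : ℝ} (s : ℝ) (J : Set ℝ) (u : ℝ → RealSobolev k) : Prop :=
  ∃ U : ℝ → RealSobolev s, (∀ t ∈ J, (U t).toL2 = (u t).toL2) ∧ ContDiffOn ℝ 1 U J

/-- The half-open time interval `[0, T)` with `T ∈ [0, ∞]`. -/
def timeInterval (T : ℝ≥0∞) : Set ℝ := {t | 0 ≤ t ∧ ENNReal.ofReal t < T}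

end BurgersHilbert

end

open MeasureTheory FourierTransform Set
open scoped ENNReal SchwartzMap

noncomputable section

namespace BurgersHilbert

/-! ### Cauchy-Schwarz and Young inequalities for nonnegative functions -/

/-! Write ⟨ξ⟩ = √(1 + ξ²) and A = ⟨ξ⟩^k û. Then H^k becomes the space of Hermitian functions in L²,
and the equation becomes A' = -i sgn(ξ) A - ⟨ξ⟩ N(A, A) with N(A, B) = ⟨ξ⟩^(k-1) F(u ∂ₓv). Since k >
3/2, Cauchy-Schwarz puts ⟨ξ⟩ û in L¹, and Young's inequality makes N a bounded bilinear operator on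
L² (`norm_transportCLM_le`). Only the factor ⟨ξ⟩, one lost derivative, prevents the equation from
being an ordinary differential equation in L².

The energy method recovers this derivative. The Hilbert transform has an imaginary symbol and drops
out of every energy identity. Transport by a real function is skew-symmetric up to ∂ₓu, and
commuting the weight past it costs a single derivative of u (`enorm_commutator_le`). The estimate
`abs_re_inner_tail_transport_le` is proved for all the weights V_R(⟨ξ⟩) ⟨ξ⟩^k with V_R(r) = r / (R +
r), with a constant independent of R. The case R = 0 is the H^k energy estimate: a Riccati
inequality then gives the existence time and the bound by twice the data. The case of large R shows
that the high-frequency part of a solution stays bounded by a multiple of that of its data.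

Differences of solutions are controlled only in L² (`lowOp_stability`). The interpolation ‖E‖ ≤ 2
‖V_R E‖ + R^k ‖⟨ξ⟩^(-k) E‖ of `norm_le_tail_add` turns this into control in H^k: R is chosen first,
from the tail of the data, and L² stability handles the rest. This one argument gives both the
convergence in H^k of the frequency-truncated (Galerkin) equations, which are ordinary differential
equations in L² (`exists_fourierSolution`), and continuous dependence (`local_dependence`).
Uniqueness is L² stability with equal data.

The local existence time depends only on the norm, so solutions can be restarted and glued; this
yields the maximal time, the blowup rate, and continuous dependence on any compact interval of
existence by finitely many short steps. Finally `sobFourier` identifies H^k isometrically with the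
Hermitian functions, and `equation_iff` together with `IsSolutionOn.isFourierSolution` identifies
weak solutions with solutions on the Fourier side. -/

/-- The `L²` norm of a nonnegative function. -/
def nrm2 (f : ℝ → ℝ≥0∞) : ℝ≥0∞ := (∫⁻ x, f x ^ 2) ^ (1 / 2 : ℝ)

theorem nrm2_sq (f : ℝ → ℝ≥0∞) : nrm2 f ^ 2 = ∫⁻ x, f x ^ 2 := by
  rw [nrm2, ← ENNReal.rpow_natCast, ← ENNReal.rpow_mul]; simp

theorem lintegral_mul_le_nrm2 {f g : ℝ → ℝ≥0∞} (hf : Measurable f) (hg : Measurable g) :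
    ∫⁻ x, f x * g x ≤ nrm2 f * nrm2 g := by
  have := ENNReal.lintegral_mul_le_Lp_mul_Lq volume (p := 2) (q := 2)
    Real.HolderConjugate.two_two hf.aemeasurable hg.aemeasurable
  simpa [nrm2] using this

/-- Cauchy-Schwarz for the factorization F G = F^(1/2) · (F^(1/2) G). -/
theorem lintegral_weighted_sq_le {F G : ℝ → ℝ≥0∞} (hF : Measurable F) (hG : Measurable G) :
    (∫⁻ x, F x * G x) ^ 2 ≤ (∫⁻ x, F x) * ∫⁻ x, F x * G x ^ 2 := by
  have key : ∀ c : ℝ≥0∞, c ^ (1 / 2 : ℝ) * c ^ (1 / 2 : ℝ) = c := fun c => by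
    rw [← ENNReal.rpow_add_of_nonneg] <;> norm_num
  have h := lintegral_mul_le_nrm2 (f := fun x => F x ^ (1 / 2 : ℝ))
    (g := fun x => F x ^ (1 / 2 : ℝ) * G x) (hF.pow_const _) ((hF.pow_const _).mul hG)
  calc (∫⁻ x, F x * G x) ^ 2
      = (∫⁻ x, F x ^ (1 / 2 : ℝ) * (F x ^ (1 / 2 : ℝ) * G x)) ^ 2 := by
        simp only [← mul_assoc, key]
    _ ≤ _ := pow_le_pow_left' h 2
    _ = _ := by
        rw [mul_pow, nrm2_sq, nrm2_sq]
        simp only [mul_pow]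
        simp only [sq, key]

theorem measurable_lintegral_conv {F G : ℝ → ℝ≥0∞} (hF : Measurable F) (hG : Measurable G) :
    Measurable fun x => ∫⁻ y, F (x - y) * G y := by
  apply Measurable.lintegral_prod_right' (f := fun p : ℝ × ℝ => F (p.1 - p.2) * G p.2)
  fun_prop

/-- Young's inequality for L¹ * L²: Cauchy-Schwarz with respect to the measure F(x - y) dy, then
Tonelli and translation invariance. -/
theorem lintegral_conv_sq_le {F G : ℝ → ℝ≥0∞} (hF : Measurable F) (hG : Measurable G) :
    ∫⁻ x, (∫⁻ y, F (x - y) * G y) ^ 2 ≤ (∫⁻ x, F x) ^ 2 * ∫⁻ x, G x ^ 2 := by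
  calc ∫⁻ x, (∫⁻ y, F (x - y) * G y) ^ 2
      ≤ ∫⁻ x, (∫⁻ y, F y) * ∫⁻ y, F (x - y) * G y ^ 2 := by
        apply lintegral_mono
        intro x
        have := lintegral_weighted_sq_le (F := fun y => F (x - y)) (by fun_prop) hG
        rwa [lintegral_sub_left_eq_self (μ := volume) F x] at this
    _ = (∫⁻ y, F y) * ∫⁻ y, ∫⁻ x, F (x - y) * G y ^ 2 := by
        rw [lintegral_const_mul]
        · rw [lintegral_lintegral_swap]
          fun_prop
        · exact measurable_lintegral_conv hF (hG.pow_const 2)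
    _ = _ := by
        have : ∀ y, ∫⁻ x, F (x - y) * G y ^ 2 = (∫⁻ x, F x) * G y ^ 2 := by
          intro y
          rw [lintegral_mul_const _ (by fun_prop), lintegral_sub_right_eq_self F y]
        simp only [this]
        rw [lintegral_const_mul _ (by fun_prop)]
        ring

theorem nrm2_conv_le {F G : ℝ → ℝ≥0∞} (hF : Measurable F) (hG : Measurable G) :
    nrm2 (fun x => ∫⁻ y, F (x - y) * G y) ≤ (∫⁻ x, F x) * nrm2 G := by
  have h := lintegral_conv_sq_le hF hG
  rw [← nrm2_sq, ← nrm2_sq, ← mul_pow] at h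
  exact (ENNReal.pow_le_pow_left_iff two_ne_zero).1 h

theorem lintegral_conv_comm (F G : ℝ → ℝ≥0∞) (x : ℝ) :
    ∫⁻ y, F (x - y) * G y = ∫⁻ y, G (x - y) * F y := by
  rw [← lintegral_sub_left_eq_self (μ := volume) _ x]
  simp [mul_comm]

theorem nrm2_conv_le' {F G : ℝ → ℝ≥0∞} (hF : Measurable F) (hG : Measurable G) :
    nrm2 (fun x => ∫⁻ y, F (x - y) * G y) ≤ nrm2 F * ∫⁻ x, G x := by
  simp only [lintegral_conv_comm F G]
  exact (nrm2_conv_le hG hF).trans_eq (mul_comm _ _)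

theorem lintegral_trilinear_le {H F G : ℝ → ℝ≥0∞} (hH : Measurable H) (hF : Measurable F)
    (hG : Measurable G) :
    ∫⁻ x, ∫⁻ y, H x * (F (x - y) * G y) ≤ nrm2 H * ((∫⁻ x, F x) * nrm2 G) := by
  have : ∀ x, ∫⁻ y, H x * (F (x - y) * G y) = H x * ∫⁻ y, F (x - y) * G y := fun x =>
    lintegral_const_mul _ (by fun_prop)
  simp only [this]
  exact (lintegral_mul_le_nrm2 hH (measurable_lintegral_conv hF hG)).trans
    (mul_le_mul_right (nrm2_conv_le hF hG) _)

theorem lintegral_trilinear_le' {H F G : ℝ → ℝ≥0∞} (hH : Measurable H) (hF : Measurable F)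
    (hG : Measurable G) :
    ∫⁻ x, ∫⁻ y, H x * (F (x - y) * G y) ≤ nrm2 H * (nrm2 F * ∫⁻ x, G x) := by
  have : ∀ x, ∫⁻ y, H x * (F (x - y) * G y) = H x * ∫⁻ y, F (x - y) * G y := fun x =>
    lintegral_const_mul _ (by fun_prop)
  simp only [this]
  exact (lintegral_mul_le_nrm2 hH (measurable_lintegral_conv hF hG)).trans
    (mul_le_mul_right (nrm2_conv_le' hF hG) _)

theorem nrm2_mono {f g : ℝ → ℝ≥0∞} (h : ∀ x, f x ≤ g x) : nrm2 f ≤ nrm2 g := by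
  unfold nrm2
  gcongr
  exact h _

theorem nrm2_const_mul (c : ℝ≥0∞) {f : ℝ → ℝ≥0∞} (hf : Measurable f) :
    nrm2 (fun x => c * f x) = c * nrm2 f := by
  have h : nrm2 (fun x => c * f x) ^ 2 = (c * nrm2 f) ^ 2 := by
    rw [nrm2_sq, mul_pow, nrm2_sq]
    simp only [mul_pow]
    exact lintegral_const_mul _ (hf.pow_const 2)
  exact le_antisymm ((ENNReal.pow_le_pow_left_iff two_ne_zero).1 h.le)
    ((ENNReal.pow_le_pow_left_iff two_ne_zero).1 h.ge)

theorem nrm2_add_le {f g : ℝ → ℝ≥0∞} (hf : Measurable f) (hg : Measurable g) :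
    nrm2 (fun x => f x + g x) ≤ nrm2 f + nrm2 g := by
  have := ENNReal.lintegral_Lp_add_le (μ := volume) (p := 2) hf.aemeasurable hg.aemeasurable
    (by norm_num)
  simpa [nrm2] using this

theorem eLpNorm_two_eq_nrm2 (f : ℝ → ℂ) : eLpNorm f 2 volume = nrm2 fun x => ‖f x‖ₑ := by
  rw [eLpNorm_eq_lintegral_rpow_enorm_toReal (by norm_num) (by norm_num)]
  simp [nrm2]

theorem nrm2_coe (f : L2C) : nrm2 (fun x => ‖f x‖ₑ) = ENNReal.ofReal ‖f‖ := by
  rw [← eLpNorm_two_eq_nrm2, Lp.norm_def, ENNReal.ofReal_toReal (Lp.eLpNorm_ne_top f)]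

/-! ### Multiplication operators on `L²` -/

theorem measurable_coe (f : L2C) : Measurable (f : ℝ → ℂ) :=
  (Lp.stronglyMeasurable f).measurable

open Classical in
/-- Multiplication by an essentially bounded function (and zero for other functions). -/
def mulOp (m : ℝ → ℂ) : L2C →L[ℂ] L2C :=
  if h : MemLp m ∞ (volume : Measure ℝ) then
    LinearMap.mkContinuous
      { toFun := fun f => (h.toLp m • f : L2C)
        map_add' := fun _ _ => Lp.add_smul _ _ _
        map_smul' := fun c _ => (Lp.smul_comm c (h.toLp m) _).symm } ‖h.toLp m‖
      fun _ => Lp.norm_smul_le _ _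
  else 0

theorem mulOp_apply {m : ℝ → ℂ} (h : MemLp m ∞ (volume : Measure ℝ)) (f : L2C) :
    mulOp m f = (h.toLp m • f : L2C) := by
  simp [mulOp, h]

theorem coeFn_mulOp {m : ℝ → ℂ} (h : MemLp m ∞ (volume : Measure ℝ)) (f : L2C) :
    (mulOp m f : ℝ → ℂ) =ᵐ[volume] fun x => m x * f x := by
  rw [mulOp_apply h]
  filter_upwards [Lp.coeFn_lpSMul (r := 2) (h.toLp m) f, h.coeFn_toLp] with x h1 h2
  rw [h1, Pi.smul_apply', h2, smul_eq_mul]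

theorem memLp_top_of_le {m : ℝ → ℂ} (hm : Measurable m) {C : ℝ} (hC : ∀ x, ‖m x‖ ≤ C) :
    MemLp m ∞ (volume : Measure ℝ) :=
  memLp_top_of_bound hm.aestronglyMeasurable C (Filter.Eventually.of_forall hC)

theorem norm_mulOp_le {m : ℝ → ℂ} (hm : Measurable m) {C : ℝ} (hC : ∀ x, ‖m x‖ ≤ C) (f : L2C) :
    ‖mulOp m f‖ ≤ C * ‖f‖ := by
  apply Lp.norm_le_mul_norm_of_ae_le_mul
  filter_upwards [coeFn_mulOp (memLp_top_of_le hm hC) f] with x hx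
  rw [hx, norm_mul]
  gcongr
  exact hC x

theorem mulOp_mulOp {m₁ m₂ m : ℝ → ℂ} (h₁ : MemLp m₁ ∞ (volume : Measure ℝ))
    (h₂ : MemLp m₂ ∞ (volume : Measure ℝ)) (h : ∀ x, m x = m₁ x * m₂ x) (f : L2C) :
    mulOp m₁ (mulOp m₂ f) = mulOp m f := by
  have h3 : MemLp m ∞ (volume : Measure ℝ) := by
    have : m = m₁ * m₂ := funext h
    rw [this]
    exact h₂.mul h₁
  apply Lp.ext
  filter_upwards [coeFn_mulOp h₁ (mulOp m₂ f), coeFn_mulOp h₂ f, coeFn_mulOp h3 f] with x a b c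
  rw [a, b, c, h, mul_assoc]

theorem eq_of_mulOp_eq {m : ℝ → ℂ} (h : MemLp m ∞ (volume : Measure ℝ)) (h0 : ∀ x, m x ≠ 0)
    {f g : L2C} (hfg : mulOp m f = mulOp m g) : f = g := by
  apply Lp.ext
  filter_upwards [coeFn_mulOp h f, coeFn_mulOp h g] with x a b
  rw [hfg, b] at a
  exact (mul_left_cancel₀ (h0 x) a).symm

theorem norm_le_of_ae_sum {f g₁ g₂ : L2C} (h : ∀ᵐ x, ‖f x‖ ≤ ‖g₁ x‖ + ‖g₂ x‖) :
    ‖f‖ ≤ ‖g₁‖ + ‖g₂‖ := by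
  have h1 : nrm2 (fun x => ‖f x‖ₑ) ≤ nrm2 (fun x => ‖g₁ x‖ₑ) + nrm2 (fun x => ‖g₂ x‖ₑ) := by
    refine le_trans ?_ (nrm2_add_le (measurable_coe g₁).enorm (measurable_coe g₂).enorm)
    unfold nrm2
    refine ENNReal.rpow_le_rpow (lintegral_mono_ae ?_) (by norm_num)
    filter_upwards [h] with x hx
    refine pow_le_pow_left' ?_ 2
    simp only [← ofReal_norm]
    rw [← ENNReal.ofReal_add (norm_nonneg _) (norm_nonneg _)]
    exact ENNReal.ofReal_le_ofReal hx
  simp only [nrm2_coe] at h1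
  rwa [← ENNReal.ofReal_add (norm_nonneg _) (norm_nonneg _),
    ENNReal.ofReal_le_ofReal_iff (by positivity)] at h1

/-! ### The Japanese bracket and admissible weights -/

/-- The Japanese bracket `√(1 + ξ²)`. -/
def jb (ξ : ℝ) : ℝ := Real.sqrt (1 + ξ ^ 2)

theorem one_le_jb (ξ : ℝ) : 1 ≤ jb ξ := by
  rw [jb, Real.one_le_sqrt]; nlinarith [sq_nonneg ξ]

theorem jb_pos (ξ : ℝ) : 0 < jb ξ := zero_lt_one.trans_le (one_le_jb ξ)

theorem jb_sq (ξ : ℝ) : jb ξ ^ 2 = 1 + ξ ^ 2 := Real.sq_sqrt (by positivity)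

theorem jb_neg (ξ : ℝ) : jb (-ξ) = jb ξ := by simp [jb]

theorem abs_le_jb (ξ : ℝ) : |ξ| ≤ jb ξ := by
  rw [← Real.sqrt_sq_eq_abs]
  exact Real.sqrt_le_sqrt (by linarith)

theorem jb_le_of_abs_le {ξ n : ℝ} (h : |ξ| ≤ n) : jb ξ ≤ 1 + n := by
  rw [jb, Real.sqrt_le_left (by linarith [abs_nonneg ξ])]
  nlinarith [sq_abs ξ, abs_nonneg ξ]

theorem continuous_jb : Continuous jb := by unfold jb; fun_prop

@[fun_prop]
theorem measurable_jb : Measurable jb := continuous_jb.measurable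

theorem abs_jb_sub_jb_le (x y : ℝ) : |jb x - jb y| ≤ |x - y| := by
  have h : |jb x - jb y| * (jb x + jb y) ≤ |x - y| * (jb x + jb y) := by
    calc |jb x - jb y| * (jb x + jb y) = |(jb x - jb y) * (jb x + jb y)| := by
          rw [abs_mul, abs_of_pos (add_pos (jb_pos x) (jb_pos y))]
      _ = |(x - y) * (x + y)| := by
          congr 1
          linear_combination jb_sq x - jb_sq y
      _ = |x - y| * |x + y| := abs_mul _ _
      _ ≤ _ := by
          gcongr
          exact (abs_add_le _ _).trans (add_le_add (abs_le_jb x) (abs_le_jb y))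
  exact le_of_mul_le_mul_right h (add_pos (jb_pos x) (jb_pos y))

theorem jb_le_add (x y : ℝ) : jb x ≤ jb (x - y) + jb y := by
  have := (abs_le.1 (abs_jb_sub_jb_le x y)).2
  linarith [abs_le_jb (x - y)]

/-- Weights `φ(jb ξ)` for which `φ(r) / r` is nondecreasing and `φ(r) / r^p` nonincreasing. -/
structure IsWeight (p : ℝ) (φ : ℝ → ℝ) : Prop where
  nonneg : ∀ r, 1 ≤ r → 0 ≤ φ r
  mono : ∀ r s, 1 ≤ r → r ≤ s → φ r / r ≤ φ s / s
  anti : ∀ r s, 1 ≤ r → r ≤ s → φ s / s ^ p ≤ φ r / r ^ p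

/-- `mono` replaces s by 2M, and `anti` between M and 2M is a doubling inequality with constant 2^p.
-/
theorem IsWeight.div_le_of_le_two_mul {p : ℝ} {φ : ℝ → ℝ} (h : IsWeight p φ) {s M : ℝ}
    (hs : 1 ≤ s) (hM : 1 ≤ M) (hsM : s ≤ 2 * M) : φ s / s ≤ 2 ^ p * (φ M / M) := by
  have h1 := h.mono s (2 * M) hs hsM
  have h2 := h.anti M (2 * M) hM (by linarith)
  have hM0 : 0 < M := by linarith
  have h3 : φ (2 * M) ≤ 2 ^ p * φ M := by
    rw [Real.mul_rpow (by norm_num) hM0.le, div_le_div_iff₀ (by positivity) (by positivity)] at h2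
    have hp : 0 < M ^ p := by positivity
    refine le_of_mul_le_mul_right ?_ hp
    linarith
  refine h1.trans ?_
  have h4 : 0 ≤ 2 ^ p * φ M := mul_nonneg (by positivity) (h.nonneg M hM)
  calc φ (2 * M) / (2 * M) ≤ 2 ^ p * φ M / (2 * M) := by gcongr
    _ ≤ 2 ^ p * φ M / M := by gcongr; linarith
    _ = _ := by ring

theorem IsWeight.le {p : ℝ} {φ : ℝ → ℝ} (h : IsWeight p φ) {r s : ℝ} (hr : 1 ≤ r) (hrs : r ≤ s) :
    φ r ≤ φ s := by
  have h1 := h.mono r s hr hrs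
  have hr0 : 0 < r := by linarith
  have hs0 : 0 < s := by linarith
  rw [div_le_div_iff₀ hr0 hs0] at h1
  have := h.nonneg s (hr.trans hrs)
  refine le_of_mul_le_mul_right (h1.trans ?_) hs0
  gcongr

/-- A substitute for the mean value theorem: `anti` gives φ(r) ≥ (r/s)^p φ(s), and Bernoulli's
inequality bounds (r/s)^p below by 1 - p (s - r)/s. -/
theorem IsWeight.sub_le {p : ℝ} (hp : 1 ≤ p) {φ : ℝ → ℝ} (h : IsWeight p φ) {r s : ℝ}
    (hr : 1 ≤ r) (hrs : r ≤ s) : φ s - φ r ≤ p * (s - r) * (φ s / s) := by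
  have h1 := h.anti r s hr hrs
  have hr0 : 0 < r := by linarith
  have hs0 : 0 < s := by linarith
  have hφ := h.nonneg s (hr.trans hrs)
  have hb : 1 + p * (r / s - 1) ≤ (r / s) ^ p := by
    have := one_add_mul_self_le_rpow_one_add (s := r / s - 1)
      (by linarith [div_nonneg hr0.le hs0.le]) hp
    simpa using this
  have h2 : φ s * (r / s) ^ p ≤ φ r := by
    rw [Real.div_rpow hr0.le hs0.le]
    have hp' : 0 < r ^ p := by positivity
    rw [div_le_div_iff₀ (by positivity) hp'] at h1
    rw [← mul_div_assoc, div_le_iff₀ (by positivity)]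
    exact h1
  have h3 : φ s * (1 + p * (r / s - 1)) ≤ φ r := (mul_le_mul_of_nonneg_left hb hφ).trans h2
  have h4 : p * (s - r) * (φ s / s) = φ s - φ s * (1 + p * (r / s - 1)) := by
    field_simp; ring
  linarith

/-- The larger of the two brackets is at most jb (x - y) + jb y, hence at most twice the larger
summand, and doubling applies. In the commutator estimate, x - y is the frequency of the
transporting factor and y that of the transported one. -/
theorem IsWeight.abs_sub_le {p : ℝ} (hp : 1 ≤ p) {φ : ℝ → ℝ} (h : IsWeight p φ) (x y : ℝ) :
    |φ (jb x) - φ (jb y)| ≤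
      p * 2 ^ p * |x - y| * (φ (jb (x - y)) / jb (x - y) + φ (jb y) / jb y) := by
  have nn : ∀ z, 0 ≤ φ (jb z) / jb z := fun z =>
    div_nonneg (h.nonneg _ (one_le_jb z)) (jb_pos z).le
  have aux : ∀ s, 1 ≤ s → s ≤ jb (x - y) + jb y →
      φ s / s ≤ 2 ^ p * (φ (jb (x - y)) / jb (x - y) + φ (jb y) / jb y) := by
    intro s hs hsle
    rcases le_total (jb (x - y)) (jb y) with hle | hle
    · refine (h.div_le_of_le_two_mul hs (one_le_jb y) (by linarith)).trans ?_
      gcongr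
      linarith [nn (x - y)]
    · refine (h.div_le_of_le_two_mul hs (one_le_jb (x - y)) (by linarith)).trans ?_
      gcongr
      linarith [nn y]
  have main : ∀ r s, 1 ≤ r → r ≤ s → s ≤ jb (x - y) + jb y → s - r ≤ |x - y| →
      |φ s - φ r| ≤
        p * 2 ^ p * |x - y| * (φ (jb (x - y)) / jb (x - y) + φ (jb y) / jb y) := by
    intro r s hr hrs hs hd
    rw [abs_of_nonneg (sub_nonneg.2 (h.le hr hrs))]
    refine (h.sub_le hp hr hrs).trans ?_
    calc p * (s - r) * (φ s / s)
        ≤ p * |x - y| * (2 ^ p * (φ (jb (x - y)) / jb (x - y) + φ (jb y) / jb y)) := by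
          have := div_nonneg (h.nonneg s (hr.trans hrs)) (by linarith : (0 : ℝ) ≤ s)
          gcongr
          exact aux s (hr.trans hrs) hs
      _ = _ := by ring
  have hd := abs_jb_sub_jb_le x y
  rcases le_total (jb y) (jb x) with hle | hle
  · exact main _ _ (one_le_jb y) hle (jb_le_add x y) ((le_abs_self _).trans hd)
  · rw [abs_sub_comm]
    rw [abs_sub_comm (jb x)] at hd
    exact main _ _ (one_le_jb x) hle (by linarith [jb_pos (x - y)]) ((le_abs_self _).trans hd)

/-- The cut-off factor that singles out high frequencies. -/
def tailFactor (R r : ℝ) : ℝ := r / (R + r)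

theorem tailFactor_nonneg {R r : ℝ} (hR : 0 ≤ R) (hr : 0 ≤ r) : 0 ≤ tailFactor R r :=
  div_nonneg hr (by linarith)

theorem tailFactor_le_one {R r : ℝ} (hR : 0 ≤ R) (hr : 0 < r) : tailFactor R r ≤ 1 := by
  rw [tailFactor, div_le_one (by linarith)]; linarith

/-- The quotients are r^(k-1) times an increasing factor, and 1 / (R + r). The exponent k + 1 is
independent of R, which makes the energy constant uniform in R; a sharp cut-off at R would violate
`anti`. -/
theorem isWeight_tailFactor_mul_rpow {k R : ℝ} (hk : 1 ≤ k) (hR : 0 ≤ R) :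
    IsWeight (k + 1) fun r => tailFactor R r * r ^ k where
  nonneg r hr := mul_nonneg (tailFactor_nonneg hR (by linarith)) (by positivity)
  mono r s hr hrs := by
    have hr0 : 0 < r := by linarith
    have hs0 : 0 < s := by linarith
    have e : ∀ r : ℝ, 0 < r → tailFactor R r * r ^ k / r = tailFactor R r * r ^ (k - 1) := by
      intro r hr
      rw [Real.rpow_sub_one hr.ne', mul_div_assoc]
    rw [e r hr0, e s hs0]
    have : tailFactor R r ≤ tailFactor R s := by
      unfold tailFactor
      rw [div_le_div_iff₀ (by linarith) (by linarith)]
      nlinarith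
    have h2 := tailFactor_nonneg hR hr0.le
    have : r ^ (k - 1) ≤ s ^ (k - 1) := Real.rpow_le_rpow hr0.le hrs (by linarith)
    have h3 := h2.trans ‹tailFactor R r ≤ _›
    gcongr
  anti r s hr hrs := by
    have hr0 : 0 < r := by linarith
    have hs0 : 0 < s := by linarith
    have e : ∀ r : ℝ, 0 < r → tailFactor R r * r ^ k / r ^ (k + 1) = 1 / (R + r) := by
      intro r hr
      have : 0 < r ^ k := by positivity
      have : 0 < R + r := by linarith
      rw [Real.rpow_add_one hr.ne', tailFactor]
      field_simp
    rw [e r hr0, e s hs0]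
    gcongr

theorem tailFactor_zero {r : ℝ} (hr : r ≠ 0) : tailFactor 0 r = 1 := by
  simp [tailFactor, hr]

/-- Above R the tail factor is at least 1/2; below R the power is at most R^k. -/
theorem rpow_le_tailFactor_add {k R r : ℝ} (hk : 0 ≤ k) (hR : 0 ≤ R) (hr : 1 ≤ r) :
    r ^ k ≤ 2 * (tailFactor R r * r ^ k) + R ^ k := by
  have hr0 : 0 < r := by linarith
  have hp : 0 < r ^ k := by positivity
  rcases le_total R r with h | h
  · have : 1 / 2 ≤ tailFactor R r := by
      rw [tailFactor, div_le_div_iff₀ (by norm_num) (by linarith)]; linarith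
    have : 0 ≤ R ^ k := by positivity
    nlinarith
  · have := Real.rpow_le_rpow hr0.le h hk
    have := mul_nonneg (tailFactor_nonneg hR hr0.le) hp.le
    linarith

open scoped ComplexConjugate



/-! ### Convolutions and trilinear forms -/

/-- The convolution of two functions on the line. -/
def cv (f g : ℝ → ℂ) (ξ : ℝ) : ℂ := ∫ η, f (ξ - η) * g η

theorem measurable_cv {f g : ℝ → ℂ} (hf : Measurable f) (hg : Measurable g) :
    Measurable (cv f g) := by
  have h : StronglyMeasurable fun p : ℝ × ℝ => f (p.1 - p.2) * g p.2 :=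
    Measurable.stronglyMeasurable (by fun_prop)
  exact h.integral_prod_right'.measurable

theorem cv_congr_ae {f f' g g' : ℝ → ℂ} (hf : f =ᵐ[volume] f') (hg : g =ᵐ[volume] g') (ξ : ℝ) :
    cv f g ξ = cv f' g' ξ := by
  apply integral_congr_ae
  filter_upwards [(quasiMeasurePreserving_sub_left volume ξ).ae hf, hg] with η h1 h2
  rw [h1, h2]

theorem enorm_cv_le (f g : ℝ → ℂ) (ξ : ℝ) :
    ‖cv f g ξ‖ₑ ≤ ∫⁻ η, ‖f (ξ - η)‖ₑ * ‖g η‖ₑ := by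
  refine (enorm_integral_le_lintegral_enorm _).trans_eq ?_
  simp only [enorm_mul]

theorem nrm2_comp_sub_left (F : ℝ → ℝ≥0∞) (ξ : ℝ) : nrm2 (fun η => F (ξ - η)) = nrm2 F := by
  unfold nrm2
  rw [lintegral_sub_left_eq_self (μ := volume) (fun x => F x ^ 2) ξ]

theorem integrable_cv {f g : ℝ → ℂ} (hf : Measurable f) (hg : Measurable g)
    (hf2 : nrm2 (fun x => ‖f x‖ₑ) < ∞) (hg2 : nrm2 (fun x => ‖g x‖ₑ) < ∞) (ξ : ℝ) :
    Integrable fun η => f (ξ - η) * g η := by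
  refine ⟨(Measurable.aestronglyMeasurable (by fun_prop)), ?_⟩
  have h := lintegral_mul_le_nrm2 (f := fun η => ‖f (ξ - η)‖ₑ) (g := fun η => ‖g η‖ₑ)
    (by fun_prop) (by fun_prop)
  rw [nrm2_comp_sub_left (fun x => ‖f x‖ₑ)] at h
  rw [hasFiniteIntegral_iff_enorm]
  simp only [enorm_mul]
  exact h.trans_lt (ENNReal.mul_lt_top hf2 hg2)

/-- The integrand of the trilinear form `⟨f, g * h⟩`. -/
def triIntegrand (f g h : ℝ → ℂ) (p : ℝ × ℝ) : ℂ := conj (f p.1) * (g (p.1 - p.2) * h p.2)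

theorem measurable_triIntegrand {f g h : ℝ → ℂ} (hf : Measurable f) (hg : Measurable g)
    (hh : Measurable h) : Measurable (triIntegrand f g h) := by
  unfold triIntegrand
  have : Measurable fun p : ℝ × ℝ => conj (f p.1) :=
    Complex.continuous_conj.measurable.comp (hf.comp measurable_fst)
  fun_prop

theorem lintegral_triIntegrand {f g h : ℝ → ℂ} (hf : Measurable f) (hg : Measurable g)
    (hh : Measurable h) :
    ∫⁻ p, ‖triIntegrand f g h p‖ₑ ∂(volume.prod volume) =
      ∫⁻ x, ∫⁻ y, ‖f x‖ₑ * (‖g (x - y)‖ₑ * ‖h y‖ₑ) := by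
  rw [lintegral_prod _ (measurable_triIntegrand hf hg hh).enorm.aemeasurable]
  simp only [triIntegrand, enorm_mul, RCLike.enorm_conj]

theorem lintegral_triIntegrand_le {f g h : ℝ → ℂ} (hf : Measurable f) (hg : Measurable g)
    (hh : Measurable h) :
    ∫⁻ p, ‖triIntegrand f g h p‖ₑ ∂(volume.prod volume) ≤
      nrm2 (fun x => ‖f x‖ₑ) * ((∫⁻ x, ‖g x‖ₑ) * nrm2 (fun x => ‖h x‖ₑ)) := by
  rw [lintegral_triIntegrand hf hg hh]
  exact lintegral_trilinear_le hf.enorm hg.enorm hh.enorm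

theorem integrable_triIntegrand {f g h : ℝ → ℂ} (hf : Measurable f) (hg : Measurable g)
    (hh : Measurable h) (hf2 : nrm2 (fun x => ‖f x‖ₑ) < ∞) (hg1 : ∫⁻ x, ‖g x‖ₑ < ∞)
    (hh2 : nrm2 (fun x => ‖h x‖ₑ) < ∞) :
    Integrable (triIntegrand f g h) (volume.prod volume) := by
  refine ⟨(measurable_triIntegrand hf hg hh).aestronglyMeasurable, ?_⟩
  rw [hasFiniteIntegral_iff_enorm]
  exact (lintegral_triIntegrand_le hf hg hh).trans_lt
    (ENNReal.mul_lt_top hf2 (ENNReal.mul_lt_top hg1 hh2))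

theorem integral_triIntegrand {f g h : ℝ → ℂ}
    (hi : Integrable (triIntegrand f g h) (volume.prod volume)) :
    ∫ p, triIntegrand f g h p ∂(volume.prod volume) = ∫ ξ, conj (f ξ) * cv g h ξ := by
  rw [integral_prod _ hi]
  simp only [triIntegrand, cv, integral_const_mul]

/-- A function with the symmetry of the Fourier transform of a real function. -/
def IsHermitian (g : ℝ → ℂ) : Prop := ∀ᵐ ξ, g (-ξ) = conj (g ξ)

/-- The symbol `2πiξ` of the derivative. -/
def derivSymbol (ξ : ℝ) : ℂ := 2 * Real.pi * Complex.I * ξ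

@[fun_prop]
theorem measurable_derivSymbol : Measurable derivSymbol := by
  unfold derivSymbol; fun_prop

theorem norm_derivSymbol (ξ : ℝ) : ‖derivSymbol ξ‖ = 2 * Real.pi * |ξ| := by
  simp [derivSymbol, abs_of_pos Real.pi_pos]

/-- Convolution with a Hermitian function is self-adjoint: on the physical side it is multiplication
by a real function. -/
theorem conj_integral_triIntegrand {f g h : ℝ → ℂ} (hf : Measurable f) (hg : Measurable g)
    (hh : Measurable h) (hf2 : nrm2 (fun x => ‖f x‖ₑ) < ∞) (hg1 : ∫⁻ x, ‖g x‖ₑ < ∞)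
    (hh2 : nrm2 (fun x => ‖h x‖ₑ) < ∞) (hher : IsHermitian g) :
    conj (∫ p, triIntegrand f g h p ∂(volume.prod volume)) =
      ∫ p, triIntegrand h g f p ∂(volume.prod volume) := by
  set g' : ℝ → ℂ := fun x => conj (g (-x)) with hg'
  have hg'm : Measurable g' := Complex.continuous_conj.measurable.comp (hg.comp measurable_neg)
  have hg'1 : ∫⁻ x, ‖g' x‖ₑ < ∞ := by
    simp only [hg', RCLike.enorm_conj]
    rwa [lintegral_neg_eq_self (μ := volume) (fun x => ‖g x‖ₑ)]
  have hae : g' =ᵐ[volume] g := by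
    filter_upwards [hher] with x hx
    rw [hg']
    simp only [hx, Complex.conj_conj]
  rw [integral_triIntegrand (integrable_triIntegrand hh hg hf hh2 hg1 hf2)]
  -- The Hermitian symmetry holds only almost everywhere. Replacing g by g' inside each convolution
  -- integral makes the symmetry exact, so that swapping the variables matches the integrands
  -- pointwise.
  have e : (fun ξ => conj (h ξ) * cv g f ξ) = fun ξ => conj (h ξ) * cv g' f ξ := by
    funext ξ
    rw [cv_congr_ae hae (Filter.EventuallyEq.refl _ f)]
  rw [e, ← integral_triIntegrand (integrable_triIntegrand hh hg'm hf hh2 hg'1 hf2),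
    ← integral_conj, ← integral_prod_swap (μ := volume) (ν := volume)]
  congr 1
  funext p
  simp only [triIntegrand, hg', Prod.fst_swap, Prod.snd_swap, map_mul, Complex.conj_conj, neg_sub]
  ring

/-- Skew-symmetry of the transport term, up to the derivative of the transporting field. -/
theorem abs_re_transport_le {c g : ℝ → ℂ} (hc : Measurable c) (hg : Measurable g)
    (hc2 : nrm2 (fun x => ‖c x‖ₑ) < ∞) (hdc2 : nrm2 (fun x => ‖derivSymbol x * c x‖ₑ) < ∞)
    (hg1 : ∫⁻ x, ‖g x‖ₑ < ∞) (hher : IsHermitian g) {K M : ℝ} (hK : 0 ≤ K) (hM : 0 ≤ M)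
    (hdg : ∫⁻ x, ‖derivSymbol x * g x‖ₑ ≤ ENNReal.ofReal (2 * K))
    (hcM : nrm2 (fun x => ‖c x‖ₑ) ≤ ENNReal.ofReal M) :
    |(∫ p, triIntegrand c g (fun y => derivSymbol y * c y) p ∂(volume.prod volume)).re| ≤
      K * M ^ 2 := by
  set d : ℝ → ℂ := fun y => derivSymbol y * c y with hd
  have hdm : Measurable d := by fun_prop
  set T := ∫ p, triIntegrand c g d p ∂(volume.prod volume) with hT
  have h1 : conj T = ∫ p, triIntegrand d g c p ∂(volume.prod volume) :=
    conj_integral_triIntegrand hc hg hdm hc2 hg1 hdc2 hher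
  have hi1 := integrable_triIntegrand hc hg hdm hc2 hg1 hdc2
  have hi2 := integrable_triIntegrand hdm hg hc hdc2 hg1 hc2
  -- The derivative symbol is imaginary and additive, so the two integrands combine with the factor
  -- D(y) - D(x) = -D(x - y), which falls on g.
  have hsum : T + conj T = - ∫ p, triIntegrand c (fun y => derivSymbol y * g y) c p
      ∂(volume.prod volume) := by
    rw [h1, hT, ← integral_add hi1 hi2, ← integral_neg]
    congr 1
    funext p
    simp only [triIntegrand, hd, derivSymbol, map_mul, Complex.conj_I, Complex.conj_ofReal,
      map_ofNat]
    push_cast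
    ring
  have hre : T + conj T = ((2 * T.re : ℝ) : ℂ) := by
    rw [Complex.add_conj]
  have hb : ‖T + conj T‖ₑ ≤ ENNReal.ofReal (M * (2 * K * M)) := by
    rw [hsum, enorm_neg]
    refine (enorm_integral_le_lintegral_enorm _).trans ?_
    refine (lintegral_triIntegrand_le hc (by fun_prop) hc).trans ?_
    rw [ENNReal.ofReal_mul hM, ENNReal.ofReal_mul' hM]
    gcongr
  rw [hre, ← ofReal_norm, Complex.norm_real, Real.norm_eq_abs, abs_mul, abs_two] at hb
  rw [ENNReal.ofReal_le_ofReal_iff (by positivity)] at hb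
  linarith

/-! ### The nonlinearity on the Fourier side -/

/-- The `L²` norm of `(1 + ξ²)^{(1-k)/2}`, as an extended real. -/
def sobConstENN (k : ℝ) : ℝ≥0∞ := nrm2 fun ξ => ENNReal.ofReal (jb ξ ^ (1 - k))

/-- The constant of the embedding of `H^k` in the space of `u` with `ξ û ∈ L¹`. -/
def sobConst (k : ℝ) : ℝ := (sobConstENN k).toReal

theorem sobConst_nonneg (k : ℝ) : 0 ≤ sobConst k := ENNReal.toReal_nonneg

/-- The square of the function is ⟨ξ⟩^(-2(k-1)), which is integrable because 2(k - 1) > 1. This is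
where the threshold 3/2 enters. -/
theorem sobConstENN_eq {k : ℝ} (hk : 3 / 2 < k) : sobConstENN k = ENNReal.ofReal (sobConst k) := by
  rw [sobConst, ENNReal.ofReal_toReal]
  have hi : Integrable (fun x : ℝ => (1 + ‖x‖ ^ 2) ^ (-(2 * (k - 1)) / 2)) volume :=
    integrable_rpow_neg_one_add_norm_sq (by simp; linarith)
  have h2 : sobConstENN k ^ 2 < ∞ := by
    rw [sobConstENN, nrm2_sq]
    have := hi.2
    rw [hasFiniteIntegral_iff_enorm] at this
    refine lt_of_le_of_lt (lintegral_mono fun x => ?_) this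
    rw [← ENNReal.ofReal_pow (by have := jb_pos x; positivity),
      Real.enorm_of_nonneg (by positivity)]
    apply ENNReal.ofReal_le_ofReal
    rw [← Real.rpow_natCast, ← Real.rpow_mul (jb_pos x).le, Real.norm_eq_abs, sq_abs, ← jb_sq,
      ← Real.rpow_natCast, ← Real.rpow_mul (jb_pos x).le]
    apply le_of_eq
    congr 1
    push_cast
    ring
  intro h
  rw [h] at h2
  simp at h2

/-- The function `(1 + ξ²)^{-k/2} A(ξ)`. -/
def unweight (k : ℝ) (A : L2C) (ξ : ℝ) : ℂ := ((jb ξ ^ (-k) : ℝ) : ℂ) * A ξ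

@[fun_prop]
theorem measurable_unweight (k : ℝ) (A : L2C) : Measurable (unweight k A) := by
  have := measurable_coe A
  unfold unweight
  fun_prop

theorem enorm_unweight (k : ℝ) (A : L2C) (ξ : ℝ) :
    ‖unweight k A ξ‖ₑ = ENNReal.ofReal (jb ξ ^ (-k)) * ‖A ξ‖ₑ := by
  have : 0 ≤ jb ξ ^ (-k) := by have := jb_pos ξ; positivity
  rw [unweight, enorm_mul]
  congr 1
  rw [← ofReal_norm, Complex.norm_real, Real.norm_of_nonneg this]

theorem enorm_unweight_le {k : ℝ} (hk : 0 ≤ k) (A : L2C) (ξ : ℝ) :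
    ‖unweight k A ξ‖ₑ ≤ ‖A ξ‖ₑ := by
  rw [enorm_unweight]
  refine mul_le_of_le_one_left' ?_
  rw [ENNReal.ofReal_le_one]
  exact Real.rpow_le_one_of_one_le_of_nonpos (one_le_jb ξ) (by linarith)

theorem enorm_derivSymbol (ξ : ℝ) :
    ‖derivSymbol ξ‖ₑ = ENNReal.ofReal (2 * Real.pi) * ENNReal.ofReal |ξ| := by
  rw [← ofReal_norm, norm_derivSymbol, ENNReal.ofReal_mul (by positivity)]

/-- The size of `A` with one derivative less than the full weight. -/
def sizeL1 (k : ℝ) (A : L2C) (ξ : ℝ) : ℝ≥0∞ := ENNReal.ofReal (jb ξ ^ (1 - k)) * ‖A ξ‖ₑ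

@[fun_prop]
theorem measurable_sizeL1 (k : ℝ) (A : L2C) : Measurable (sizeL1 k A) := by
  have := (measurable_coe A).enorm
  unfold sizeL1
  fun_prop

theorem lintegral_sizeL1_le {k : ℝ} (hk : 3 / 2 < k) (A : L2C) :
    ∫⁻ ξ, sizeL1 k A ξ ≤ ENNReal.ofReal (sobConst k * ‖A‖) := by
  refine (lintegral_mul_le_nrm2 (by fun_prop) (measurable_coe A).enorm).trans_eq ?_
  rw [nrm2_coe, ENNReal.ofReal_mul (sobConst_nonneg k), ← sobConstENN_eq hk, sobConstENN]

theorem jb_mul_rpow_neg (k ξ : ℝ) : jb ξ * jb ξ ^ (-k) = jb ξ ^ (1 - k) := by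
  rw [sub_eq_add_neg, Real.rpow_add (jb_pos ξ), Real.rpow_one]

theorem enorm_unweight_le_sizeL1 (k : ℝ) (A : L2C) (ξ : ℝ) : ‖unweight k A ξ‖ₑ ≤ sizeL1 k A ξ := by
  rw [enorm_unweight, sizeL1]
  gcongr
  · exact one_le_jb ξ
  · linarith

theorem abs_mul_enorm_unweight_le (k : ℝ) (A : L2C) (ξ : ℝ) :
    ENNReal.ofReal |ξ| * ‖unweight k A ξ‖ₑ ≤ sizeL1 k A ξ := by
  rw [enorm_unweight, sizeL1, ← mul_assoc, ← ENNReal.ofReal_mul (abs_nonneg _)]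
  gcongr
  rw [← jb_mul_rpow_neg]
  have := jb_pos ξ
  gcongr
  exact abs_le_jb ξ

theorem enorm_deriv_unweight_le (k : ℝ) (A : L2C) (ξ : ℝ) :
    ‖derivSymbol ξ * unweight k A ξ‖ₑ ≤ ENNReal.ofReal (2 * Real.pi) * sizeL1 k A ξ := by
  rw [enorm_mul, enorm_derivSymbol, mul_assoc]
  gcongr
  exact abs_mul_enorm_unweight_le k A ξ

theorem sizeL1_le {k : ℝ} (hk : 1 ≤ k) (A : L2C) (ξ : ℝ) : sizeL1 k A ξ ≤ ‖A ξ‖ₑ := by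
  refine mul_le_of_le_one_left' ?_
  rw [ENNReal.ofReal_le_one]
  exact Real.rpow_le_one_of_one_le_of_nonpos (one_le_jb ξ) (by linarith)

theorem lintegral_unweight_le {k : ℝ} (hk : 3 / 2 < k) (A : L2C) :
    ∫⁻ ξ, ‖unweight k A ξ‖ₑ ≤ ENNReal.ofReal (sobConst k * ‖A‖) :=
  (lintegral_mono (enorm_unweight_le_sizeL1 k A)).trans (lintegral_sizeL1_le hk A)

theorem lintegral_deriv_unweight_le {k : ℝ} (hk : 3 / 2 < k) (A : L2C) :
    ∫⁻ ξ, ‖derivSymbol ξ * unweight k A ξ‖ₑ ≤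
      ENNReal.ofReal (2 * Real.pi * sobConst k * ‖A‖) := by
  refine (lintegral_mono (enorm_deriv_unweight_le k A)).trans ?_
  rw [lintegral_const_mul _ (by fun_prop), mul_assoc (2 * Real.pi),
    ENNReal.ofReal_mul (p := 2 * Real.pi) (q := sobConst k * ‖A‖) (by positivity)]
  gcongr
  exact lintegral_sizeL1_le hk A

theorem nrm2_unweight_le {k : ℝ} (hk : 0 ≤ k) (A : L2C) :
    nrm2 (fun ξ => ‖unweight k A ξ‖ₑ) ≤ ENNReal.ofReal ‖A‖ :=
  (nrm2_mono (enorm_unweight_le hk A)).trans_eq (nrm2_coe A)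

theorem nrm2_sizeL1_le {k : ℝ} (hk : 1 ≤ k) (A : L2C) :
    nrm2 (sizeL1 k A) ≤ ENNReal.ofReal ‖A‖ :=
  (nrm2_mono (sizeL1_le hk A)).trans_eq (nrm2_coe A)

theorem nrm2_deriv_unweight_le {k : ℝ} (hk : 1 ≤ k) (A : L2C) :
    nrm2 (fun ξ => ‖derivSymbol ξ * unweight k A ξ‖ₑ) ≤ ENNReal.ofReal (2 * Real.pi * ‖A‖) := by
  refine (nrm2_mono (enorm_deriv_unweight_le k A)).trans ?_
  rw [nrm2_const_mul _ (by fun_prop), ENNReal.ofReal_mul (q := ‖A‖) (by positivity)]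
  gcongr
  exact nrm2_sizeL1_le hk A

/-- The Fourier transform of `u ∂ₓ v`, where `(1 + ξ²)^{k/2} û = A` and `(1 + ξ²)^{k/2} v̂ = B`. -/
def transport (k : ℝ) (A B : L2C) : ℝ → ℂ :=
  cv (unweight k A) fun η => derivSymbol η * unweight k B η

theorem measurable_transport (k : ℝ) (A B : L2C) : Measurable (transport k A B) :=
  measurable_cv (by fun_prop) (by fun_prop)

theorem rpow_jb_le {s : ℝ} (hs : 0 ≤ s) (x y : ℝ) :
    jb x ^ s ≤ 2 ^ s * (jb (x - y) ^ s + jb y ^ s) := by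
  have h := jb_le_add x y
  have hx := jb_pos x
  have hy := jb_pos y
  have hxy := jb_pos (x - y)
  rcases le_total (jb (x - y)) (jb y) with hle | hle
  · calc jb x ^ s ≤ (2 * jb y) ^ s := by gcongr; linarith
      _ = 2 ^ s * jb y ^ s := Real.mul_rpow (by norm_num) hy.le
      _ ≤ _ := by gcongr; linarith [Real.rpow_nonneg hxy.le s]
  · calc jb x ^ s ≤ (2 * jb (x - y)) ^ s := by gcongr; linarith
      _ = 2 ^ s * jb (x - y) ^ s := Real.mul_rpow (by norm_num) hxy.le
      _ ≤ _ := by gcongr; linarith [Real.rpow_nonneg hy.le s]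

theorem rpow_mul_enorm_unweight (k : ℝ) (A : L2C) (ξ : ℝ) :
    ENNReal.ofReal (jb ξ ^ (k - 1)) * ‖unweight k A ξ‖ₑ ≤ ‖A ξ‖ₑ := by
  rw [enorm_unweight, ← mul_assoc, ← ENNReal.ofReal_mul (Real.rpow_nonneg (jb_pos ξ).le _),
    ← Real.rpow_add (jb_pos ξ)]
  refine mul_le_of_le_one_left' ?_
  rw [ENNReal.ofReal_le_one]
  exact Real.rpow_le_one_of_one_le_of_nonpos (one_le_jb ξ) (by linarith)

theorem rpow_mul_abs_mul_enorm_unweight (k : ℝ) (A : L2C) (ξ : ℝ) :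
    ENNReal.ofReal (jb ξ ^ (k - 1)) * (ENNReal.ofReal |ξ| * ‖unweight k A ξ‖ₑ) ≤ ‖A ξ‖ₑ := by
  refine (mul_le_mul_right (abs_mul_enorm_unweight_le k A ξ) _).trans ?_
  rw [sizeL1, ← mul_assoc, ← ENNReal.ofReal_mul (Real.rpow_nonneg (jb_pos ξ).le _),
    ← Real.rpow_add (jb_pos ξ)]
  simp

/-- The weighted Fourier transform `(1 + ξ²)^{(k-1)/2} F(u ∂ₓ v)`. -/
def weightedTransport (k : ℝ) (A B : L2C) (ξ : ℝ) : ℂ :=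
  ((jb ξ ^ (k - 1) : ℝ) : ℂ) * transport k A B ξ

theorem measurable_weightedTransport (k : ℝ) (A B : L2C) :
    Measurable (weightedTransport k A B) := by
  have := measurable_transport k A B
  unfold weightedTransport
  fun_prop

/-- Since k - 1 ≥ 0, the weight at ξ is dominated by the sum of the weights at ξ - η and η. In each
resulting term one factor recovers the full L² density, and the other keeps ⟨·⟩^(1-k), which makes
it integrable; Young's inequality then applies. -/
theorem enorm_weightedTransport_le {k : ℝ} (hk : 1 ≤ k) (A B : L2C) (ξ : ℝ) :
    ‖weightedTransport k A B ξ‖ₑ ≤ ENNReal.ofReal (2 * Real.pi * 2 ^ (k - 1)) *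
      ((∫⁻ η, ‖A (ξ - η)‖ₑ * sizeL1 k B η) + ∫⁻ η, sizeL1 k A (ξ - η) * ‖B η‖ₑ) := by
  have hA := (measurable_coe A).enorm
  have hB := (measurable_coe B).enorm
  have hj : ∀ x, 0 ≤ jb x ^ (k - 1) := fun x => Real.rpow_nonneg (jb_pos x).le _
  have e1 : ‖((jb ξ ^ (k - 1) : ℝ) : ℂ)‖ₑ = ENNReal.ofReal (jb ξ ^ (k - 1)) := by
    rw [← ofReal_norm, Complex.norm_real, Real.norm_of_nonneg (hj ξ)]
  rw [weightedTransport, enorm_mul, e1, ← lintegral_add_left (by fun_prop),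
    ← lintegral_const_mul _ (by fun_prop)]
  refine (mul_le_mul_right (enorm_cv_le _ _ ξ) _).trans ?_
  rw [← lintegral_const_mul _ (by fun_prop)]
  refine lintegral_mono fun η => ?_
  set a := ‖unweight k A (ξ - η)‖ₑ with ha
  set b := ENNReal.ofReal |η| * ‖unweight k B η‖ₑ with hb
  calc ENNReal.ofReal (jb ξ ^ (k - 1)) * (a * ‖derivSymbol η * unweight k B η‖ₑ)
      ≤ ENNReal.ofReal (2 ^ (k - 1) * (jb (ξ - η) ^ (k - 1) + jb η ^ (k - 1))) *
          (a * (ENNReal.ofReal (2 * Real.pi) * b)) := by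
        rw [enorm_mul, enorm_derivSymbol, mul_assoc]
        gcongr
        exact rpow_jb_le (by linarith) ξ η
    _ = ENNReal.ofReal (2 * Real.pi * 2 ^ (k - 1)) *
          ((ENNReal.ofReal (jb (ξ - η) ^ (k - 1)) * a) * b +
            a * (ENNReal.ofReal (jb η ^ (k - 1)) * b)) := by
        rw [ENNReal.ofReal_mul (by positivity), ENNReal.ofReal_add (hj _) (hj _),
          ENNReal.ofReal_mul (p := 2 * Real.pi) (by positivity)]
        ring
    _ ≤ _ := by
        gcongr
        · exact rpow_mul_enorm_unweight k A _
        · exact abs_mul_enorm_unweight_le k B η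
        · exact enorm_unweight_le_sizeL1 k A _
        · exact rpow_mul_abs_mul_enorm_unweight k B η

/-- The norm of the bilinear operator `weightedTransport`. -/
def transportConst (k : ℝ) : ℝ := 2 * Real.pi * 2 ^ (k - 1) * (2 * sobConst k)

theorem transportConst_nonneg (k : ℝ) : 0 ≤ transportConst k := by
  have := sobConst_nonneg k
  unfold transportConst
  positivity

theorem nrm2_weightedTransport_le {k : ℝ} (hk : 3 / 2 < k) (A B : L2C) :
    nrm2 (fun ξ => ‖weightedTransport k A B ξ‖ₑ) ≤
      ENNReal.ofReal (transportConst k * ‖A‖ * ‖B‖) := by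
  have hA := (measurable_coe A).enorm
  have hB := (measurable_coe B).enorm
  have hs := sobConst_nonneg k
  have m1 := measurable_lintegral_conv hA (measurable_sizeL1 k B)
  have m2 := measurable_lintegral_conv (measurable_sizeL1 k A) hB
  refine (nrm2_mono (enorm_weightedTransport_le (by linarith) A B)).trans ?_
  rw [nrm2_const_mul _ (f := fun ξ => (∫⁻ η, ‖A (ξ - η)‖ₑ * sizeL1 k B η) +
    ∫⁻ η, sizeL1 k A (ξ - η) * ‖B η‖ₑ) (m1.add m2)]
  refine (mul_le_mul_right (nrm2_add_le m1 m2) _).trans ?_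
  refine (mul_le_mul_right (add_le_add (nrm2_conv_le' hA (measurable_sizeL1 k B))
    (nrm2_conv_le (measurable_sizeL1 k A) hB)) _).trans ?_
  rw [nrm2_coe, nrm2_coe]
  refine (mul_le_mul_right (add_le_add (mul_le_mul_right (lintegral_sizeL1_le hk B) _)
    (mul_le_mul_left (lintegral_sizeL1_le hk A) _)) _).trans_eq ?_
  rw [← ENNReal.ofReal_mul (norm_nonneg _), ← ENNReal.ofReal_mul (by positivity),
    ← ENNReal.ofReal_add (by positivity) (by positivity), ← ENNReal.ofReal_mul (by positivity)]
  congr 1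
  unfold transportConst
  ring

theorem memLp_weightedTransport {k : ℝ} (hk : 3 / 2 < k) (A B : L2C) :
    MemLp (weightedTransport k A B) 2 (volume : Measure ℝ) := by
  refine ⟨(measurable_weightedTransport k A B).aestronglyMeasurable, ?_⟩
  rw [eLpNorm_two_eq_nrm2]
  exact (nrm2_weightedTransport_le hk A B).trans_lt ENNReal.ofReal_lt_top

theorem unweight_add (k : ℝ) (A B : L2C) :
    unweight k (A + B) =ᵐ[volume] fun ξ => unweight k A ξ + unweight k B ξ := by
  filter_upwards [Lp.coeFn_add A B] with ξ h
  rw [unweight, h, Pi.add_apply, mul_add]; rfl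

theorem unweight_smul (k : ℝ) (c : ℂ) (A : L2C) :
    unweight k (c • A) =ᵐ[volume] fun ξ => c * unweight k A ξ := by
  filter_upwards [Lp.coeFn_smul c A] with ξ h
  rw [unweight, h, Pi.smul_apply, unweight, smul_eq_mul]; ring

theorem integrable_transport {k : ℝ} (hk : 1 ≤ k) (A B : L2C) (ξ : ℝ) :
    Integrable fun η => unweight k A (ξ - η) * (derivSymbol η * unweight k B η) :=
  integrable_cv (by fun_prop) (by fun_prop)
    ((nrm2_unweight_le (by linarith) A).trans_lt ENNReal.ofReal_lt_top)
    ((nrm2_deriv_unweight_le hk B).trans_lt ENNReal.ofReal_lt_top) ξ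

theorem transport_add_left {k : ℝ} (hk : 1 ≤ k) (A A' B : L2C) (ξ : ℝ) :
    transport k (A + A') B ξ = transport k A B ξ + transport k A' B ξ := by
  rw [transport, cv_congr_ae (unweight_add k A A') (Filter.EventuallyEq.refl _ _), transport,
    transport, cv, cv, cv,
    ← integral_add (integrable_transport hk A B ξ) (integrable_transport hk A' B ξ)]
  simp only [add_mul]

theorem transport_add_right {k : ℝ} (hk : 1 ≤ k) (A B B' : L2C) (ξ : ℝ) :
    transport k A (B + B') ξ = transport k A B ξ + transport k A B' ξ := by
  have h : (fun η => derivSymbol η * unweight k (B + B') η) =ᵐ[volume]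
      fun η => derivSymbol η * unweight k B η + derivSymbol η * unweight k B' η := by
    filter_upwards [unweight_add k B B'] with η h
    rw [h, mul_add]
  rw [transport, cv_congr_ae (Filter.EventuallyEq.refl _ _) h, transport, transport, cv, cv, cv,
    ← integral_add (integrable_transport hk A B ξ) (integrable_transport hk A B' ξ)]
  simp only [mul_add]

theorem transport_smul_left (k : ℝ) (c : ℂ) (A B : L2C) (ξ : ℝ) :
    transport k (c • A) B ξ = c * transport k A B ξ := by
  rw [transport, cv_congr_ae (unweight_smul k c A) (Filter.EventuallyEq.refl _ _), transport,
    cv, cv, ← integral_const_mul]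
  simp only [mul_assoc]

theorem transport_smul_right (k : ℝ) (c : ℂ) (A B : L2C) (ξ : ℝ) :
    transport k A (c • B) ξ = c * transport k A B ξ := by
  have h : (fun η => derivSymbol η * unweight k (c • B) η) =ᵐ[volume]
      fun η => c * (derivSymbol η * unweight k B η) := by
    filter_upwards [unweight_smul k c B] with η h
    rw [h]; ring
  rw [transport, cv_congr_ae (Filter.EventuallyEq.refl _ _) h, transport, cv, cv,
    ← integral_const_mul]
  congr 1
  funext η
  ring

/-- The bounded bilinear operator `(A, B) ↦ (1 + ξ²)^{(k-1)/2} F(u ∂ₓ v)` on `L²`. -/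
def transportCLM (k : ℝ) (hk : 3 / 2 < k) : L2C →L[ℂ] L2C →L[ℂ] L2C :=
  LinearMap.mkContinuous₂
    (LinearMap.mk₂ ℂ (fun A B => (memLp_weightedTransport hk A B).toLp _)
      (fun A A' B => by
        rw [← MemLp.toLp_add]
        refine MemLp.toLp_congr _ _ (Filter.Eventually.of_forall fun ξ => ?_)
        simp only [weightedTransport, Pi.add_apply]
        rw [transport_add_left (by linarith), mul_add])
      (fun c A B => by
        rw [← MemLp.toLp_const_smul]
        refine MemLp.toLp_congr _ _ (Filter.Eventually.of_forall fun ξ => ?_)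
        simp only [weightedTransport, Pi.smul_apply, smul_eq_mul]
        rw [transport_smul_left]; ring)
      (fun A B B' => by
        rw [← MemLp.toLp_add]
        refine MemLp.toLp_congr _ _ (Filter.Eventually.of_forall fun ξ => ?_)
        simp only [weightedTransport, Pi.add_apply]
        rw [transport_add_right (by linarith), mul_add])
      (fun c A B => by
        rw [← MemLp.toLp_const_smul]
        refine MemLp.toLp_congr _ _ (Filter.Eventually.of_forall fun ξ => ?_)
        simp only [weightedTransport, Pi.smul_apply, smul_eq_mul]
        rw [transport_smul_right]; ring))
    (transportConst k)
    (fun A B => by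
      have h := nrm2_weightedTransport_le hk A B
      have hC := transportConst_nonneg k
      rw [LinearMap.mk₂_apply, Lp.norm_toLp, eLpNorm_two_eq_nrm2]
      exact ENNReal.toReal_le_of_le_ofReal (by positivity) h)

theorem coeFn_transportCLM {k : ℝ} (hk : 3 / 2 < k) (A B : L2C) :
    (transportCLM k hk A B : ℝ → ℂ) =ᵐ[volume] weightedTransport k A B := by
  simp only [transportCLM, LinearMap.mkContinuous₂_apply, LinearMap.mk₂_apply]
  exact MemLp.coeFn_toLp _

theorem norm_transportCLM_le {k : ℝ} (hk : 3 / 2 < k) (A B : L2C) :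
    ‖transportCLM k hk A B‖ ≤ transportConst k * ‖A‖ * ‖B‖ := by
  have h := nrm2_weightedTransport_le hk A B
  have hC := transportConst_nonneg k
  rw [Lp.norm_def, eLpNorm_congr_ae (coeFn_transportCLM hk A B), eLpNorm_two_eq_nrm2]
  exact ENNReal.toReal_le_of_le_ofReal (by positivity) h

/-! ### Energy estimates for the transport term -/

/-- The power `(1 + ξ²)^{s/2}` as a complex symbol. -/
def wt (s ξ : ℝ) : ℂ := ((jb ξ ^ s : ℝ) : ℂ)

@[fun_prop]
theorem measurable_wt (s : ℝ) : Measurable (wt s) := by unfold wt; fun_prop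

theorem norm_wt (s ξ : ℝ) : ‖wt s ξ‖ = jb ξ ^ s := by
  rw [wt, Complex.norm_real, Real.norm_of_nonneg (Real.rpow_nonneg (jb_pos ξ).le _)]

theorem wt_ne_zero (s ξ : ℝ) : wt s ξ ≠ 0 := by
  rw [← norm_ne_zero_iff, norm_wt]
  exact (Real.rpow_pos_of_pos (jb_pos ξ) s).ne'

theorem wt_mul_wt (s t ξ : ℝ) : wt s ξ * wt t ξ = wt (s + t) ξ := by
  rw [wt, wt, wt, Real.rpow_add (jb_pos ξ)]; push_cast; rfl

theorem wt_zero (ξ : ℝ) : wt 0 ξ = 1 := by simp [wt]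

theorem norm_wt_neg_le {s : ℝ} (hs : 0 ≤ s) (ξ : ℝ) : ‖wt (-s) ξ‖ ≤ 1 := by
  rw [norm_wt]
  exact Real.rpow_le_one_of_one_le_of_nonpos (one_le_jb ξ) (by linarith)

theorem memLp_wt_neg {s : ℝ} (hs : 0 ≤ s) : MemLp (wt (-s)) ∞ (volume : Measure ℝ) :=
  memLp_top_of_le (by fun_prop) (norm_wt_neg_le hs)

/-- The indicator function of the frequencies at most `n`. -/
def cut (n ξ : ℝ) : ℝ := if |ξ| ≤ n then 1 else 0

@[fun_prop]
theorem measurable_cut (n : ℝ) : Measurable (cut n) := by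
  unfold cut
  exact Measurable.ite (measurableSet_le (by fun_prop) (by fun_prop)) measurable_const
    measurable_const

theorem cut_nonneg (n ξ : ℝ) : 0 ≤ cut n ξ := by unfold cut; split_ifs <;> norm_num

theorem cut_le_one (n ξ : ℝ) : cut n ξ ≤ 1 := by unfold cut; split_ifs <;> norm_num

theorem cut_mul_cut (n ξ : ℝ) : cut n ξ * cut n ξ = cut n ξ := by
  unfold cut; split_ifs <;> norm_num

theorem cut_mul_jb_rpow_le {s n : ℝ} (hs : 0 ≤ s) (hn : 0 ≤ n) (ξ : ℝ) :
    cut n ξ * jb ξ ^ s ≤ (1 + n) ^ s := by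
  have := jb_pos ξ
  unfold cut
  split_ifs with h
  · rw [one_mul]
    exact Real.rpow_le_rpow this.le (jb_le_of_abs_le h) hs
  · rw [zero_mul]; positivity

/-- The multiplier that selects frequencies above `R`. -/
def tailMul (R ξ : ℝ) : ℂ := (tailFactor R (jb ξ) : ℝ)

@[fun_prop]
theorem measurable_tailMul (R : ℝ) : Measurable (tailMul R) := by
  unfold tailMul tailFactor; fun_prop

theorem norm_tailMul {R : ℝ} (hR : 0 ≤ R) (ξ : ℝ) : ‖tailMul R ξ‖ = tailFactor R (jb ξ) := by
  rw [tailMul, Complex.norm_real, Real.norm_of_nonneg (tailFactor_nonneg hR (jb_pos ξ).le)]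

theorem norm_tailMul_le {R : ℝ} (hR : 0 ≤ R) (ξ : ℝ) : ‖tailMul R ξ‖ ≤ 1 := by
  rw [norm_tailMul hR]
  exact tailFactor_le_one hR (jb_pos ξ)

theorem memLp_tailMul {R : ℝ} (hR : 0 ≤ R) : MemLp (tailMul R) ∞ (volume : Measure ℝ) :=
  memLp_top_of_le (by fun_prop) (norm_tailMul_le hR)

/-- The multiplier that cuts off high frequencies and loses a derivative. -/
def cutDeriv (n ξ : ℝ) : ℂ := ((cut n ξ * jb ξ : ℝ) : ℂ)

@[fun_prop]
theorem measurable_cutDeriv (n : ℝ) : Measurable (cutDeriv n) := by unfold cutDeriv; fun_prop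

theorem norm_cutDeriv_le {n : ℝ} (hn : 0 ≤ n) (ξ : ℝ) : ‖cutDeriv n ξ‖ ≤ 1 + n := by
  rw [cutDeriv, Complex.norm_real,
    Real.norm_of_nonneg (mul_nonneg (cut_nonneg n ξ) (jb_pos ξ).le)]
  simpa using cut_mul_jb_rpow_le (s := 1) (by norm_num) hn ξ

theorem memLp_cutDeriv {n : ℝ} (hn : 0 ≤ n) : MemLp (cutDeriv n) ∞ (volume : Measure ℝ) :=
  memLp_top_of_le (by fun_prop) (norm_cutDeriv_le hn)

theorem IsHermitian.unweight {A : L2C} (hA : IsHermitian A) (k : ℝ) :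
    IsHermitian (unweight k A) := by
  filter_upwards [hA] with ξ h
  rw [BurgersHilbert.unweight, h, BurgersHilbert.unweight, map_mul, Complex.conj_ofReal, jb_neg]

theorem enorm_ofReal_of_nonneg {x : ℝ} (hx : 0 ≤ x) : ‖(x : ℂ)‖ₑ = ENNReal.ofReal x := by
  rw [← ofReal_norm, Complex.norm_real, Real.norm_of_nonneg hx]

/-- The weight difference yields |ξ - η| and the derivative yields |η|, so each factor carries
exactly one derivative. The remaining weight, of order k - 1 with the tail factor, falls on one of
them: that factor becomes tail · A in L² and the other lies in L¹. Keeping the tail factor here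
makes the energy estimate quadratic in the tail. -/
theorem enorm_commutator_le {k R : ℝ} (hk : 1 ≤ k) (hR : 0 ≤ R) (n : ℝ) (A : L2C) (ξ η : ℝ) :
    ‖(tailFactor R (jb ξ) * jb ξ ^ k - tailFactor R (jb η) * jb η ^ k : ℝ)‖ₑ *
      (‖unweight k A (ξ - η)‖ₑ * ‖derivSymbol η * (cut n η * unweight k A η)‖ₑ) ≤
    ENNReal.ofReal ((k + 1) * 2 ^ (k + 1) * (2 * Real.pi)) *
      ((‖tailMul R (ξ - η) * A (ξ - η)‖ₑ * sizeL1 k A η) +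
        (sizeL1 k A (ξ - η) * ‖tailMul R η * A η‖ₑ)) := by
  have hC : 0 ≤ (k + 1) * 2 ^ (k + 1) := by positivity
  have hw := (isWeight_tailFactor_mul_rpow hk hR)
  have habs := hw.abs_sub_le (by linarith) ξ η
  set V : ℝ → ℝ := fun x => tailFactor R (jb x) with hV
  have hV0 : ∀ x, 0 ≤ V x := fun x => tailFactor_nonneg hR (jb_pos x).le
  have hq : ∀ x, 0 ≤ V x * jb x ^ k / jb x := fun x =>
    div_nonneg (mul_nonneg (hV0 x) (Real.rpow_nonneg (jb_pos x).le _)) (jb_pos x).le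
  have e1 : ∀ x, ENNReal.ofReal (V x * jb x ^ k / jb x) * (ENNReal.ofReal |x| *
      ‖unweight k A x‖ₑ) ≤ ‖tailMul R x * A x‖ₑ := by
    intro x
    have hx := jb_pos x
    rw [enorm_unweight, enorm_mul, tailMul, enorm_ofReal_of_nonneg (hV0 x), ← mul_assoc,
      ← mul_assoc, ← ENNReal.ofReal_mul (hq x), ← ENNReal.ofReal_mul (mul_nonneg (hq x) (abs_nonneg _))]
    gcongr
    have : V x * jb x ^ k / jb x * |x| * jb x ^ (-k) = V x * (|x| / jb x) := by
      rw [Real.rpow_neg hx.le]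
      have : jb x ^ k ≠ 0 := by positivity
      field_simp
    rw [this]
    exact mul_le_of_le_one_right (hV0 x) ((div_le_one hx).2 (abs_le_jb x))
  have e2 : ‖derivSymbol η * (cut n η * unweight k A η)‖ₑ ≤
      ENNReal.ofReal (2 * Real.pi) * (ENNReal.ofReal |η| * ‖unweight k A η‖ₑ) := by
    rw [enorm_mul, enorm_derivSymbol, mul_assoc, enorm_mul, enorm_ofReal_of_nonneg (cut_nonneg n η)]
    gcongr
    refine mul_le_of_le_one_left' ?_
    rw [ENNReal.ofReal_le_one]
    exact cut_le_one n η
  have e3 : ‖(V ξ * jb ξ ^ k - V η * jb η ^ k : ℝ)‖ₑ ≤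
      ENNReal.ofReal ((k + 1) * 2 ^ (k + 1)) * (ENNReal.ofReal |ξ - η| *
        (ENNReal.ofReal (V (ξ - η) * jb (ξ - η) ^ k / jb (ξ - η)) +
          ENNReal.ofReal (V η * jb η ^ k / jb η))) := by
    rw [← ofReal_norm, Real.norm_eq_abs, ← ENNReal.ofReal_add (hq _) (hq _),
      ← ENNReal.ofReal_mul (abs_nonneg _), ← ENNReal.ofReal_mul hC]
    apply ENNReal.ofReal_le_ofReal
    rw [← mul_assoc]
    exact habs
  set a := ‖unweight k A (ξ - η)‖ₑ
  set b := ENNReal.ofReal |η| * ‖unweight k A η‖ₑ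
  calc _ ≤ _ := mul_le_mul' e3 (mul_le_mul_right e2 a)
    _ = ENNReal.ofReal ((k + 1) * 2 ^ (k + 1) * (2 * Real.pi)) *
      ((ENNReal.ofReal (V (ξ - η) * jb (ξ - η) ^ k / jb (ξ - η)) * (ENNReal.ofReal |ξ - η| * a)) * b
        + (ENNReal.ofReal |ξ - η| * a) * (ENNReal.ofReal (V η * jb η ^ k / jb η) * b)) := by
        rw [ENNReal.ofReal_mul hC]; ring
    _ ≤ _ := by
        gcongr
        · exact e1 _
        · exact abs_mul_enorm_unweight_le k A η
        · exact abs_mul_enorm_unweight_le k A _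
        · exact e1 _

/-- The constant of the energy estimate. -/
def energyConst (k : ℝ) : ℝ :=
  Real.pi * sobConst k + (k + 1) * 2 ^ (k + 1) * (2 * Real.pi) * (2 * sobConst k)

theorem energyConst_nonneg {k : ℝ} (hk : 0 ≤ k) : 0 ≤ energyConst k := by
  have := sobConst_nonneg k
  unfold energyConst
  positivity

theorem inner_eq_integral_conj_mul (f g : L2C) : inner ℂ f g = ∫ ξ, conj (f ξ) * g ξ := by
  rw [L2.inner_def]
  simp only [RCLike.inner_apply, mul_comm]

theorem nrm2_mulOp {m : ℝ → ℂ} (hm : MemLp m ∞ (volume : Measure ℝ)) (A : L2C) :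
    nrm2 (fun ξ => ‖m ξ * A ξ‖ₑ) = ENNReal.ofReal ‖mulOp m A‖ := by
  rw [← nrm2_coe, ← eLpNorm_two_eq_nrm2, ← eLpNorm_two_eq_nrm2]
  exact eLpNorm_congr_ae (coeFn_mulOp hm A).symm

/-- Writing w(ξ) = w(η) + (w(ξ) - w(η)) for the weight w = V ⟨·⟩^k, the first term is the transport
of c = V A itself, skew up to a derivative of the transporting field, and the second is the
commutator. The cut-off at n serves only to make the separate integrals converge; the constant
depends on neither n nor R. -/
theorem abs_re_inner_tail_transport_le {k R n : ℝ} (hk : 3 / 2 < k) (hR : 0 ≤ R) (hn : 0 ≤ n)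
    {A : L2C} (hA : IsHermitian A) (hsupp : ∀ᵐ ξ, (A : ℝ → ℂ) ξ = cut n ξ * A ξ) :
    |(inner ℂ (mulOp (tailMul R) A)
      (mulOp (tailMul R) (mulOp (cutDeriv n) (transportCLM k hk A A)))).re| ≤
      energyConst k * ‖A‖ * ‖mulOp (tailMul R) A‖ ^ 2 := by
  have hAm := measurable_coe A
  have hκ := sobConst_nonneg k
  have hV := memLp_tailMul hR
  set V : ℝ → ℝ := fun x => tailFactor R (jb x) with hVdef
  have hV0 : ∀ x, 0 ≤ V x := fun x => tailFactor_nonneg hR (jb_pos x).le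
  have hVm : Measurable V := by rw [hVdef]; unfold tailFactor; fun_prop
  set M := ‖mulOp (tailMul R) A‖ with hM
  set w : ℝ → ℝ := fun x => V x * jb x ^ k with hw
  have hwm : Measurable w := by fun_prop
  set c : ℝ → ℂ := fun x => cut n x * (tailMul R x * A x) with hc
  have hcm : Measurable c := by fun_prop
  set a := unweight k A with ha
  set d : ℝ → ℂ := fun x => derivSymbol x * (cut n x * a x) with hd
  have hdm : Measurable d := by fun_prop
  set f : ℝ → ℂ := fun x => w x * c x with hf
  have hfm : Measurable f := by fun_prop
  have hcle : ∀ x, ‖c x‖ₑ ≤ ‖tailMul R x * A x‖ₑ := by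
    intro x
    rw [hc]
    simp only
    rw [enorm_mul, enorm_ofReal_of_nonneg (cut_nonneg n x)]
    exact mul_le_of_le_one_left' (ENNReal.ofReal_le_one.2 (cut_le_one n x))
  have hcM : nrm2 (fun x => ‖c x‖ₑ) ≤ ENNReal.ofReal M :=
    (nrm2_mono hcle).trans_eq (nrm2_mulOp hV A)
  have hc2 : nrm2 (fun x => ‖c x‖ₑ) < ∞ := hcM.trans_lt ENNReal.ofReal_lt_top
  have hcc : ∀ x, c x = cut n x * c x := by
    intro x
    have : (cut n x : ℂ) * cut n x = cut n x := by exact_mod_cast cut_mul_cut n x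
    simp only [hc]
    linear_combination (-(tailMul R x * A x)) * this
  -- The bound grows with n; only finiteness is used.
  have hf2 : nrm2 (fun x => ‖f x‖ₑ) < ∞ := by
    have : ∀ x, ‖f x‖ₑ ≤ ENNReal.ofReal ((1 + n) ^ k) * ‖c x‖ₑ := by
      intro x
      have h1 : f x = ((cut n x * jb x ^ k * V x : ℝ) : ℂ) * c x := by
        rw [hf]
        simp only
        nth_rw 1 [hcc x]
        rw [hw]
        push_cast
        ring
      rw [h1, enorm_mul, enorm_ofReal_of_nonneg (mul_nonneg (mul_nonneg (cut_nonneg n x)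
        (Real.rpow_nonneg (jb_pos x).le _)) (hV0 x))]
      gcongr
      refine (mul_le_of_le_one_right ?_ (tailFactor_le_one hR (jb_pos x))).trans
        (cut_mul_jb_rpow_le (by linarith) hn x)
      exact mul_nonneg (cut_nonneg n x) (Real.rpow_nonneg (jb_pos x).le _)
    refine (nrm2_mono this).trans_lt ?_
    rw [nrm2_const_mul _ hcm.enorm]
    exact ENNReal.mul_lt_top ENNReal.ofReal_lt_top hc2
  have hd2 : nrm2 (fun x => ‖d x‖ₑ) < ∞ := by
    have : ∀ x, ‖d x‖ₑ ≤ ‖derivSymbol x * unweight k A x‖ₑ := by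
      intro x
      rw [hd]
      simp only
      rw [enorm_mul, enorm_mul, enorm_mul, enorm_ofReal_of_nonneg (cut_nonneg n x)]
      gcongr
      exact mul_le_of_le_one_left' (ENNReal.ofReal_le_one.2 (cut_le_one n x))
    exact (nrm2_mono this).trans_lt
      ((nrm2_deriv_unweight_le (by linarith) A).trans_lt ENNReal.ofReal_lt_top)
  have ha1 : ∫⁻ x, ‖a x‖ₑ < ∞ := (lintegral_unweight_le hk A).trans_lt ENNReal.ofReal_lt_top
  have ham : Measurable a := by fun_prop
  -- Moving the weight onto the transported factor turns it into the derivative of c, because w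
  -- times the unweighted A is V A.
  have hDc : (fun y => derivSymbol y * c y) = fun y => w y * d y := by
    funext y
    have : (w y : ℂ) * a y = tailMul R y * A y := by
      rw [ha, unweight, ← mul_assoc]
      congr 1
      rw [hw, tailMul, ← Complex.ofReal_mul]
      congr 1
      simp only
      rw [mul_assoc, ← Real.rpow_add (jb_pos y)]
      simp [hVdef]
    simp only [hc, hd]
    rw [← this]
    ring
  have hDc2 : nrm2 (fun x => ‖derivSymbol x * c x‖ₑ) < ∞ := by
    have : ∀ x, ‖derivSymbol x * c x‖ₑ ≤ ENNReal.ofReal (2 * Real.pi * n) * ‖c x‖ₑ := by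
      intro x
      rw [enorm_mul, enorm_derivSymbol, ← ENNReal.ofReal_mul (by positivity)]
      by_cases hx : |x| ≤ n
      · gcongr
      · have : c x = 0 := by rw [hcc x, cut, if_neg hx]; simp
        simp [this]
    refine (nrm2_mono this).trans_lt ?_
    rw [nrm2_const_mul _ hcm.enorm]
    exact ENNReal.mul_lt_top ENNReal.ofReal_lt_top hc2
  -- the inner product as a trilinear integral
  have hI : inner ℂ (mulOp (tailMul R) A)
      (mulOp (tailMul R) (mulOp (cutDeriv n) (transportCLM k hk A A))) =
      ∫ p, triIntegrand f a d p ∂(volume.prod volume) := by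
    rw [integral_triIntegrand (integrable_triIntegrand hfm ham hdm hf2 ha1 hd2),
      inner_eq_integral_conj_mul]
    have hdae : (fun η => derivSymbol η * unweight k A η) =ᵐ[volume] d := by
      filter_upwards [hsupp] with x hx
      simp only [hd, ha, unweight]
      rw [hx]
      have : (cut n x : ℂ) * cut n x = cut n x := by exact_mod_cast cut_mul_cut n x
      linear_combination (-derivSymbol x * (jb x ^ (-k) : ℝ) * A x) * this
    apply integral_congr_ae
    filter_upwards [coeFn_mulOp hV A, coeFn_mulOp hV (mulOp (cutDeriv n) (transportCLM k hk A A)),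
      coeFn_mulOp (memLp_cutDeriv hn) (transportCLM k hk A A), coeFn_transportCLM hk A A]
      with x h1 h2 h3 h4
    rw [h1, h2, h3, h4, weightedTransport, transport,
      cv_congr_ae (Filter.EventuallyEq.refl _ _) hdae]
    simp only [hf, hc, hw, map_mul, Complex.conj_ofReal, cutDeriv, tailMul]
    have : jb x ^ k = jb x * jb x ^ (k - 1) := by
      rw [← Real.rpow_one_add' (jb_pos x).le (by linarith)]; congr 1; ring
    rw [this]
    push_cast
    ring
  set r : ℝ × ℝ → ℂ := fun p =>
    conj (c p.1) * (((w p.1 - w p.2 : ℝ) : ℂ) * (a (p.1 - p.2) * d p.2)) with hr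
  have hi0 := integrable_triIntegrand hfm ham hdm hf2 ha1 hd2
  have hi1 := integrable_triIntegrand hcm ham (by fun_prop) hc2 ha1 hDc2
  have hsplit : ∀ p, triIntegrand f a d p =
      triIntegrand c a (fun y => derivSymbol y * c y) p + r p := by
    intro p
    rw [hDc]
    simp only [triIntegrand, hf, hr, map_mul, Complex.conj_ofReal]
    push_cast
    ring
  have hir : Integrable r (volume.prod volume) := by
    have : r = fun p => triIntegrand f a d p - triIntegrand c a (fun y => derivSymbol y * c y) p :=
      funext fun p => by rw [hsplit]; ring
    rw [this]
    exact hi0.sub hi1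
  -- The derivative of the transporting field has L¹ Fourier norm at most 2π · `sobConst k` · ‖A‖,
  -- and K is half of this.
  have hb1 := abs_re_transport_le hcm ham hc2 hDc2 ha1 (hA.unweight k)
    (K := Real.pi * sobConst k * ‖A‖) (M := M) (by positivity) (norm_nonneg _)
    ((lintegral_deriv_unweight_le hk A).trans_eq (by congr 1; ring)) hcM
  have hb2 : ‖∫ p, r p ∂(volume.prod volume)‖ ≤
      (k + 1) * 2 ^ (k + 1) * (2 * Real.pi) * (2 * sobConst k) * ‖A‖ * M ^ 2 := by
    have hk0 : 0 < k + 1 := by linarith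
    rw [← ENNReal.ofReal_le_ofReal_iff (by positivity), ofReal_norm]
    refine (enorm_integral_le_lintegral_enorm _).trans ?_
    have hle : ∀ p : ℝ × ℝ, ‖r p‖ₑ ≤ ENNReal.ofReal ((k + 1) * 2 ^ (k + 1) * (2 * Real.pi)) *
        (‖c p.1‖ₑ * (‖tailMul R (p.1 - p.2) * A (p.1 - p.2)‖ₑ * sizeL1 k A p.2) +
         ‖c p.1‖ₑ * (sizeL1 k A (p.1 - p.2) * ‖tailMul R p.2 * A p.2‖ₑ)) := by
      intro p
      have := enorm_commutator_le (by linarith) hR n A p.1 p.2 (k := k)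
      have e : ∀ x y z t : ℂ, ‖conj x * (y * (z * t))‖ₑ = ‖x‖ₑ * (‖y‖ₑ * (‖z‖ₑ * ‖t‖ₑ)) := by
        intro x y z t
        rw [enorm_mul, RCLike.enorm_conj, enorm_mul, enorm_mul]
      rw [hr, e, ← mul_add, mul_left_comm _ ‖c p.1‖ₑ]
      refine mul_le_mul_right (le_trans (le_of_eq ?_) this) _
      congr 1
      rw [← ofReal_norm, Complex.norm_real, ofReal_norm]
    refine (lintegral_mono hle).trans ?_
    have m1 : Measurable fun x => ‖tailMul R x * A x‖ₑ := by fun_prop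
    have m2 := measurable_sizeL1 k A
    have m3 := hcm.enorm
    rw [lintegral_const_mul _ (by fun_prop), lintegral_add_left (by fun_prop),
      lintegral_prod _ (by fun_prop), lintegral_prod _ (by fun_prop)]
    refine (mul_le_mul_right (add_le_add (lintegral_trilinear_le' m3 m1 m2)
      (lintegral_trilinear_le m3 m2 m1)) _).trans ?_
    rw [nrm2_mulOp hV A, ← hM]
    calc _ ≤ ENNReal.ofReal ((k + 1) * 2 ^ (k + 1) * (2 * Real.pi)) *
          (ENNReal.ofReal M * (ENNReal.ofReal M * ENNReal.ofReal (sobConst k * ‖A‖)) +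
           ENNReal.ofReal M * (ENNReal.ofReal (sobConst k * ‖A‖) * ENNReal.ofReal M)) := by
          gcongr <;> exact lintegral_sizeL1_le hk A
      _ = _ := by
          have hM0 : 0 ≤ M := norm_nonneg _
          rw [← ENNReal.ofReal_mul (p := M) (q := sobConst k * ‖A‖) hM0,
            ← ENNReal.ofReal_mul (p := sobConst k * ‖A‖) (q := M) (by positivity),
            ← ENNReal.ofReal_mul hM0, ← ENNReal.ofReal_mul hM0,
            ← ENNReal.ofReal_add (by positivity) (by positivity),
            ← ENNReal.ofReal_mul (by positivity)]
          congr 1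
          ring
  rw [hI, integral_congr_ae (Filter.Eventually.of_forall hsplit), integral_add hi1 hir,
    Complex.add_re]
  refine (abs_add_le _ _).trans ((add_le_add hb1 ((Complex.abs_re_le_norm _).trans hb2)).trans_eq ?_)
  unfold energyConst
  ring

/-! ### Estimates for the transport term in `L²` -/

/-- The two weights cancel, leaving F(u ∂ₓv) itself; Young's inequality with û in L² and the
transform of ∂ₓv in L¹ does the rest. For differences of solutions, this treats the term where the
difference is the transporting field. -/
theorem norm_lowOp_transport_le {k : ℝ} (hk : 3 / 2 < k) (A B : L2C) :
    ‖mulOp (wt (-(k - 1))) (transportCLM k hk A B)‖ ≤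
      2 * Real.pi * sobConst k * ‖B‖ * ‖mulOp (wt (-k)) A‖ := by
  have hκ := sobConst_nonneg k
  have hw := memLp_wt_neg (s := k - 1) (by linarith)
  have h : (mulOp (wt (-(k - 1))) (transportCLM k hk A B) : ℝ → ℂ) =ᵐ[volume] transport k A B := by
    filter_upwards [coeFn_mulOp hw (transportCLM k hk A B), coeFn_transportCLM hk A B] with x h1 h2
    rw [h1, h2, weightedTransport]
    change wt (-(k - 1)) x * (wt (k - 1) x * _) = _
    rw [← mul_assoc, wt_mul_wt, neg_add_cancel, wt_zero, one_mul]
  rw [Lp.norm_def, eLpNorm_congr_ae h, eLpNorm_two_eq_nrm2]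
  refine ENNReal.toReal_le_of_le_ofReal (by positivity) ?_
  refine (nrm2_mono (enorm_cv_le _ _)).trans ?_
  refine (nrm2_conv_le' (measurable_unweight k A).enorm (by fun_prop)).trans ?_
  refine (mul_le_mul_right (lintegral_deriv_unweight_le hk B) _).trans_eq ?_
  rw [show (fun x => ‖unweight k A x‖ₑ) = fun x => ‖wt (-k) x * A x‖ₑ from rfl,
    nrm2_mulOp (memLp_wt_neg (by linarith)), mul_comm, ← ENNReal.ofReal_mul (by positivity)]

/-- Skew-symmetry of transport by a real field: no derivative falls on the difference E, so its L²
norm suffices. -/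
theorem abs_re_inner_lowOp_transport_le {k : ℝ} (hk : 3 / 2 < k) {A : L2C} (hA : IsHermitian A)
    (E : L2C) :
    |(inner ℂ (mulOp (wt (-k)) E) (mulOp (wt (-(k - 1))) (transportCLM k hk A E))).re| ≤
      Real.pi * sobConst k * ‖A‖ * ‖mulOp (wt (-k)) E‖ ^ 2 := by
  have hκ := sobConst_nonneg k
  have hw := memLp_wt_neg (s := k - 1) (by linarith)
  have hE2 : nrm2 (fun x => ‖unweight k E x‖ₑ) ≤ ENNReal.ofReal ‖mulOp (wt (-k)) E‖ :=
    (nrm2_mulOp (memLp_wt_neg (s := k) (by linarith)) E).le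
  have hdE2 := (nrm2_deriv_unweight_le (k := k) (by linarith) E).trans_lt ENNReal.ofReal_lt_top
  have hA1 := (lintegral_unweight_le hk A).trans_lt ENNReal.ofReal_lt_top
  have hb := abs_re_transport_le (measurable_unweight k E) (measurable_unweight k A)
    (hE2.trans_lt ENNReal.ofReal_lt_top) hdE2 hA1 (hA.unweight k)
    (K := Real.pi * sobConst k * ‖A‖) (M := ‖mulOp (wt (-k)) E‖) (by positivity) (norm_nonneg _)
    ((lintegral_deriv_unweight_le hk A).trans_eq (by congr 1; ring)) hE2
  convert hb using 3
  rw [integral_triIntegrand (integrable_triIntegrand (measurable_unweight k E)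
    (measurable_unweight k A) (by fun_prop) (hE2.trans_lt ENNReal.ofReal_lt_top) hA1 hdE2),
    inner_eq_integral_conj_mul]
  apply integral_congr_ae
  filter_upwards [coeFn_mulOp hw (transportCLM k hk A E), coeFn_transportCLM hk A E,
    coeFn_mulOp (memLp_wt_neg (s := k) (by linarith)) E] with x h1 h2 h3
  rw [h1, h2, h3, weightedTransport]
  change _ * (wt (-(k - 1)) x * (wt (k - 1) x * _)) = _
  rw [← mul_assoc (wt _ x) (wt _ x), wt_mul_wt, neg_add_cancel, wt_zero, one_mul]
  rfl

/-! ### The Hermitian symmetry -/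

theorem measurePreserving_neg_real :
    MeasurePreserving (Neg.neg : ℝ → ℝ) volume volume := Measure.measurePreserving_neg volume

/-- The reflection `A ↦ conj A(-ξ)` on `L²`. -/
def reflect : L2C →L[ℝ] L2C :=
  ((Complex.conjCLE : ℂ →L[ℝ] ℂ).compLpL 2 volume).comp
    (Lp.compMeasurePreservingₗᵢ ℝ Neg.neg measurePreserving_neg_real).toContinuousLinearMap

theorem coeFn_reflect (A : L2C) : (reflect A : ℝ → ℂ) =ᵐ[volume] fun ξ => conj (A (-ξ)) := by
  have h1 := ContinuousLinearMap.coeFn_compLp (Complex.conjCLE : ℂ →L[ℝ] ℂ)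
    (Lp.compMeasurePreservingₗᵢ ℝ Neg.neg measurePreserving_neg_real A)
  have h2 := Lp.coeFn_compMeasurePreserving A measurePreserving_neg_real
  filter_upwards [h1, h2] with ξ h1 h2
  refine h1.trans ?_
  exact congrArg conj h2

theorem reflect_eq_self_iff {A : L2C} : reflect A = A ↔ IsHermitian A := by
  constructor
  · intro h
    have h1 := coeFn_reflect A
    rw [h] at h1
    filter_upwards [h1] with ξ hξ
    rw [hξ, Complex.conj_conj]
  · intro h
    apply Lp.ext
    filter_upwards [coeFn_reflect A, h] with ξ h1 h2
    rw [h1, h2, Complex.conj_conj]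

theorem norm_reflect (A : L2C) : ‖reflect A‖ = ‖A‖ := by
  rw [← (Lp.compMeasurePreservingₗᵢ ℝ Neg.neg measurePreserving_neg_real).norm_map A,
    Lp.norm_def, Lp.norm_def]
  congr 1
  have h1 := ContinuousLinearMap.coeFn_compLp (Complex.conjCLE : ℂ →L[ℝ] ℂ)
    (Lp.compMeasurePreservingₗᵢ ℝ Neg.neg measurePreserving_neg_real A)
  apply eLpNorm_congr_norm_ae
  filter_upwards [h1] with ξ h1
  have : ‖Complex.conjCLE (Lp.compMeasurePreservingₗᵢ ℝ Neg.neg measurePreserving_neg_real A ξ)‖ =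
    ‖Lp.compMeasurePreservingₗᵢ ℝ Neg.neg measurePreserving_neg_real A ξ‖ := RCLike.norm_conj _
  rw [← this]
  exact congrArg norm h1

theorem reflect_mulOp {m : ℝ → ℂ} (hm : MemLp m ∞ (volume : Measure ℝ))
    (hs : ∀ ξ, m (-ξ) = conj (m ξ)) (A : L2C) : reflect (mulOp m A) = mulOp m (reflect A) := by
  apply Lp.ext
  filter_upwards [coeFn_reflect (mulOp m A), coeFn_reflect A, coeFn_mulOp hm (reflect A),
    (quasiMeasurePreserving_neg volume).ae (coeFn_mulOp hm A)] with ξ h1 h2 h3 h4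
  rw [h1, h3, h2, h4, map_mul, hs, Complex.conj_conj]

/-- The Fourier form of the fact that u ∂ₓv commutes with complex conjugation. It makes the
approximating flow preserve real-valuedness. -/
theorem reflect_transportCLM {k : ℝ} (hk : 3 / 2 < k) (A B : L2C) :
    reflect (transportCLM k hk A B) = transportCLM k hk (reflect A) (reflect B) := by
  have hu : ∀ A : L2C, unweight k (reflect A) =ᵐ[volume] fun ξ => conj (unweight k A (-ξ)) := by
    intro A
    filter_upwards [coeFn_reflect A] with ξ h
    rw [unweight, h, unweight, map_mul, Complex.conj_ofReal, jb_neg]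
  have hd : (fun η => derivSymbol η * unweight k (reflect B) η) =ᵐ[volume]
      fun η => conj (derivSymbol (-η) * unweight k B (-η)) := by
    filter_upwards [hu B] with ξ h
    rw [h, map_mul]
    simp [derivSymbol, Complex.conj_ofNat]
  apply Lp.ext
  filter_upwards [coeFn_reflect (transportCLM k hk A B),
    coeFn_transportCLM hk (reflect A) (reflect B),
    (quasiMeasurePreserving_neg volume).ae (coeFn_transportCLM hk A B)] with ξ h1 h2 h3
  rw [h1, h2, h3, weightedTransport, weightedTransport, map_mul, Complex.conj_ofReal, jb_neg]
  congr 1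
  rw [transport, transport, cv_congr_ae (hu A) hd, cv, cv, ← integral_conj,
    ← integral_neg_eq_self]
  congr 1
  funext η
  rw [map_mul]
  congr 3
  ring

/-! ### Differential inequalities -/

theorem le_initial_of_deriv_nonpos {f f' : ℝ → ℝ} {T : ℝ}
    (hf : ∀ t ∈ Icc 0 T, HasDerivWithinAt f (f' t) (Icc 0 T) t)
    (hf' : ∀ t ∈ Icc 0 T, f' t ≤ 0) {t : ℝ} (ht : t ∈ Icc 0 T) : f t ≤ f 0 := by
  have h : AntitoneOn f (Icc 0 T) := by
    refine antitoneOn_of_hasDerivWithinAt_nonpos (f' := f') (convex_Icc 0 T)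
      (fun t ht => (hf t ht).continuousWithinAt) ?_ ?_
    · intro x hx
      exact (hf x (interior_subset hx)).mono interior_subset
    · intro x hx
      exact hf' x (interior_subset hx)
  exact h ⟨le_rfl, ht.1.trans ht.2⟩ ht ht.1

/-- The function y e^(-Kt) - δ t is nonincreasing, because e^(-Kt) ≤ 1 for t ≥ 0. -/
theorem gronwall_linear {y y' : ℝ → ℝ} {T K δ : ℝ} (hK : 0 ≤ K) (hδ : 0 ≤ δ)
    (hy : ∀ t ∈ Icc 0 T, HasDerivWithinAt y (y' t) (Icc 0 T) t)
    (hy' : ∀ t ∈ Icc 0 T, y' t ≤ K * y t + δ) {t : ℝ} (ht : t ∈ Icc 0 T) :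
    y t ≤ (y 0 + δ * t) * Real.exp (K * t) := by
  have h := le_initial_of_deriv_nonpos (T := T) (t := t)
    (f := fun t => y t * Real.exp (-(K * t)) - δ * t)
    (f' := fun t => (y' t * Real.exp (-(K * t)) + y t * (Real.exp (-(K * t)) * (-K))) - δ)
    (fun t ht => by
      have h1 : HasDerivWithinAt (fun t => Real.exp (-(K * t)))
          (Real.exp (-(K * t)) * (-K)) (Icc 0 T) t := by
        have := (((hasDerivAt_id t).const_mul K).neg.exp).hasDerivWithinAt (s := Icc 0 T)
        simpa using this
      have h2 : HasDerivWithinAt (fun t => δ * t) δ (Icc 0 T) t := by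
        simpa using ((hasDerivAt_id t).const_mul δ).hasDerivWithinAt (s := Icc 0 T)
      exact ((hy t ht).mul h1).sub h2)
    (fun t ht => by
      have h1 := hy' t ht
      have he : 0 < Real.exp (-(K * t)) := Real.exp_pos _
      have he1 : Real.exp (-(K * t)) ≤ 1 := by
        rw [Real.exp_le_one_iff]; have := mul_nonneg hK ht.1; linarith
      nlinarith) ht
  simp only [mul_zero, neg_zero, Real.exp_zero, mul_one, sub_zero] at h
  have h3 : y t * Real.exp (-(K * t)) ≤ y 0 + δ * t := by linarith
  rw [Real.exp_neg, ← div_eq_mul_inv, div_le_iff₀ (Real.exp_pos _)] at h3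
  exact h3

/-- For z = √y the hypothesis reads z' ≤ C z², so -1/z - C t is nonincreasing and z(t) (1 - C t
z(0)) ≤ z(0). The smallness condition makes the bracket at least 1/2. -/
theorem riccati_bound {y y' : ℝ → ℝ} {T C : ℝ} (hC : 0 ≤ C)
    (hy0 : ∀ t ∈ Icc 0 T, 0 ≤ y t)
    (hy : ∀ t ∈ Icc 0 T, HasDerivWithinAt y (y' t) (Icc 0 T) t)
    (hy' : ∀ t ∈ Icc 0 T, y' t ≤ 2 * C * Real.sqrt (y t) ^ 3) {t : ℝ} (ht : t ∈ Icc 0 T)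
    (hT : 2 * C * Real.sqrt (y 0) * t ≤ 1) : Real.sqrt (y t) ≤ 2 * Real.sqrt (y 0) := by
  -- Adding ε keeps the square root differentiable and invertible where y vanishes; ε tends to 0
  -- afterwards.
  have key : ∀ ε > 0, Real.sqrt (y t + ε) * (1 - C * t * Real.sqrt (y 0 + ε)) ≤
      Real.sqrt (y 0 + ε) := by
    intro ε hε
    have hpos : ∀ t ∈ Icc 0 T, 0 < Real.sqrt (y t + ε) := fun t ht =>
      Real.sqrt_pos.2 (by linarith [hy0 t ht])
    have h := le_initial_of_deriv_nonpos (T := T) (t := t)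
      (f := fun t => -(Real.sqrt (y t + ε))⁻¹ - C * t)
      (f' := fun t => -(-(y' t / (2 * Real.sqrt (y t + ε))) / Real.sqrt (y t + ε) ^ 2) - C)
      (fun t ht => by
        have hp := hpos t ht
        have h1 := (((hy t ht).add_const ε).sqrt (by linarith [hy0 t ht])).inv hp.ne'
        have h2 : HasDerivWithinAt (fun t => C * t) C (Icc 0 T) t := by
          simpa using ((hasDerivAt_id t).const_mul C).hasDerivWithinAt (s := Icc 0 T)
        exact h1.neg.sub h2)
      (fun t ht => by
        have hp := hpos t ht
        have h1 := hy' t ht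
        have h2 : Real.sqrt (y t) ^ 3 ≤ Real.sqrt (y t + ε) ^ 3 := by
          gcongr; linarith
        have h3 : y' t ≤ 2 * C * Real.sqrt (y t + ε) ^ 3 :=
          h1.trans (mul_le_mul_of_nonneg_left h2 (by positivity))
        have h4 : -(-(y' t / (2 * Real.sqrt (y t + ε))) / Real.sqrt (y t + ε) ^ 2) =
            y' t / (2 * Real.sqrt (y t + ε) ^ 3) := by
          field_simp
        rw [h4, sub_nonpos, div_le_iff₀ (by positivity)]
        linarith) ht
    have hp := hpos t ht
    have hp0 := hpos 0 ⟨le_rfl, ht.1.trans ht.2⟩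
    set a := Real.sqrt (y t + ε)
    set b := Real.sqrt (y 0 + ε)
    simp only [mul_zero, sub_zero] at h
    have h5 : b⁻¹ - C * t ≤ a⁻¹ := by linarith
    have h6 := mul_le_mul_of_nonneg_left h5 (mul_pos hp hp0).le
    have h7 : a * b * (b⁻¹ - C * t) = a * (1 - C * t * b) := by field_simp
    have h8 : a * b * a⁻¹ = b := by field_simp
    linarith
  have hlim : Real.sqrt (y t + 0) * (1 - C * t * Real.sqrt (y 0 + 0)) ≤ Real.sqrt (y 0 + 0) := by
    have c1 : Continuous fun ε => Real.sqrt (y t + ε) * (1 - C * t * Real.sqrt (y 0 + ε)) := by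
      fun_prop
    have c2 : Continuous fun ε => Real.sqrt (y 0 + ε) := by fun_prop
    exact le_of_tendsto_of_tendsto ((c1.tendsto 0).mono_left nhdsWithin_le_nhds)
      ((c2.tendsto 0).mono_left nhdsWithin_le_nhds)
      (by filter_upwards [self_mem_nhdsWithin (s := Ioi (0 : ℝ))] with ε hε using key ε hε)
  simp only [add_zero] at hlim
  have := Real.sqrt_nonneg (y t)
  nlinarith

/-! ### Ordinary differential equations with a quadratic vector field -/

section ODE

variable {E : Type*} [NormedAddCommGroup E] [NormedSpace ℝ E]

/-- A Lipschitz cut-off function: one on `[0, ρ]`, zero beyond `ρ + 1`. -/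
def ramp (ρ r : ℝ) : ℝ := max 0 (min 1 (ρ + 1 - r))

theorem ramp_nonneg (ρ r : ℝ) : 0 ≤ ramp ρ r := le_max_left _ _

theorem ramp_le_one (ρ r : ℝ) : ramp ρ r ≤ 1 := max_le zero_le_one (min_le_left _ _)

theorem ramp_eq_one {ρ r : ℝ} (h : r ≤ ρ) : ramp ρ r = 1 := by
  rw [ramp, min_eq_left (by linarith), max_eq_right zero_le_one]

theorem ramp_eq_zero {ρ r : ℝ} (h : ρ + 1 ≤ r) : ramp ρ r = 0 := by
  rw [ramp, max_eq_left]
  exact (min_le_right _ _).trans (by linarith)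

theorem abs_ramp_sub_le (ρ r s : ℝ) : |ramp ρ r - ramp ρ s| ≤ |r - s| := by
  unfold ramp
  rw [abs_sub_comm r s]
  refine (abs_max_sub_max_le_max _ _ _ _).trans (max_le (by simp) ?_)
  refine (abs_min_sub_min_le_max _ _ _ _).trans (max_le (by simp) (le_of_eq ?_))
  congr 1; ring

/-- Truncation makes a locally Lipschitz field globally Lipschitz and bounded, so that
Picard-Lindelöf applies on the whole of [0, T] at once. An a priori bound by ρ later removes the
truncation. -/
theorem lipschitz_ramp_smul {G : E → E} {ℓ β ρ : ℝ} (hℓ : 0 ≤ ℓ) (hβ : 0 ≤ β) (hρ : 0 ≤ ρ)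
    (h0 : G 0 = 0) (hG : ∀ x y, ‖G x - G y‖ ≤ (ℓ + β * (‖x‖ + ‖y‖)) * ‖x - y‖) :
    ∃ K : NNReal, LipschitzWith K (fun x => ramp ρ ‖x‖ • G x) ∧
      ∀ x, ‖ramp ρ ‖x‖ • G x‖ ≤ K := by
  set P := ρ + 1 with hP
  set L := (ℓ + β * P) * P with hL
  set K := L + (ℓ + β * (P + P)) with hK
  have hP0 : 0 ≤ P := by positivity
  have hL0 : 0 ≤ L := by positivity
  have hK0 : 0 ≤ K := by positivity
  have hGb : ∀ x, ‖x‖ ≤ P → ‖G x‖ ≤ L := by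
    intro x hx
    have := hG x 0
    rw [h0, sub_zero, sub_zero, norm_zero, add_zero] at this
    refine this.trans ?_
    rw [hL]
    gcongr
  -- Only x needs to lie in the ball of radius P: the size of the field is used at x alone, and the
  -- term with the difference of G vanishes when y is outside.
  have main : ∀ x y, ‖x‖ ≤ P → ‖ramp ρ ‖x‖ • G x - ramp ρ ‖y‖ • G y‖ ≤ K * ‖x - y‖ := by
    intro x y hx
    have e : ramp ρ ‖x‖ • G x - ramp ρ ‖y‖ • G y =
        (ramp ρ ‖x‖ - ramp ρ ‖y‖) • G x + ramp ρ ‖y‖ • (G x - G y) := by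
      module
    rw [e, hK, add_mul]
    refine (norm_add_le _ _).trans (add_le_add ?_ ?_)
    · rw [norm_smul, mul_comm]
      refine mul_le_mul (hGb x hx) ?_ (norm_nonneg _) hL0
      exact (abs_ramp_sub_le _ _ _).trans (abs_norm_sub_norm_le x y)
    · rcases le_total P ‖y‖ with hy | hy
      · rw [ramp_eq_zero hy, zero_smul, norm_zero]; positivity
      · rw [norm_smul, Real.norm_of_nonneg (ramp_nonneg _ _)]
        refine (mul_le_of_le_one_left (norm_nonneg _) (ramp_le_one _ _)).trans ((hG x y).trans ?_)
        gcongr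
  refine ⟨⟨K, hK0⟩, ?_, ?_⟩
  · apply LipschitzWith.of_dist_le_mul
    intro x y
    rw [dist_eq_norm, dist_eq_norm]
    rcases le_total ‖x‖ P with hx | hx
    · exact main x y hx
    · rcases le_total ‖y‖ P with hy | hy
      · rw [norm_sub_rev, norm_sub_rev x]
        exact main y x hy
      · rw [ramp_eq_zero hx, ramp_eq_zero hy, zero_smul, zero_smul, sub_zero, norm_zero]
        positivity
  · intro x
    rcases le_total ‖x‖ P with hx | hx
    · rw [norm_smul, Real.norm_of_nonneg (ramp_nonneg _ _)]
      refine (mul_le_of_le_one_left (norm_nonneg _) (ramp_le_one _ _)).trans ((hGb x hx).trans ?_)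
      change L ≤ K
      rw [hK]
      have : 0 ≤ ℓ + β * (P + P) := by positivity
      linarith
    · rw [ramp_eq_zero hx, zero_smul, norm_zero]
      exact hK0

theorem exists_solution_of_lipschitz_of_bounded [CompleteSpace E] {F : E → E} {K : NNReal}
    (hF : LipschitzWith K F) (hb : ∀ x, ‖F x‖ ≤ K) (x₀ : E) {T : ℝ} (hT : 0 ≤ T) :
    ∃ α : ℝ → E, α 0 = x₀ ∧ ∀ t ∈ Icc 0 T, HasDerivWithinAt α (F (α t)) (Icc 0 T) t := by
  -- A field bounded by K cannot leave the ball of radius K T within time T, so there is no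
  -- restriction on T.
  have hpl : IsPicardLindelof (fun _ => F) (tmin := 0) (tmax := T) ⟨0, le_rfl, hT⟩ x₀
      (K * ⟨T, hT⟩) 0 K K :=
    { lipschitzOnWith := fun _ _ => hF.lipschitzOnWith
      continuousOn := fun _ _ => continuousOn_const
      norm_le := fun _ _ x _ => hb x
      mul_max_le := by
        simp only [sub_zero, sub_self, max_eq_left hT, NNReal.coe_zero]
        exact le_rfl }
  exact hpl.exists_eq_forall_mem_Icc_hasDerivWithinAt₀

theorem eqOn_of_lipschitz {F : E → E} {K : NNReal} (hF : LipschitzWith K F) {α β : ℝ → E} {T : ℝ}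
    (hα : ∀ t ∈ Icc 0 T, HasDerivWithinAt α (F (α t)) (Icc 0 T) t)
    (hβ : ∀ t ∈ Icc 0 T, HasDerivWithinAt β (F (β t)) (Icc 0 T) t) (h0 : α 0 = β 0) :
    EqOn α β (Icc 0 T) := by
  have aux : ∀ γ : ℝ → E, (∀ t ∈ Icc 0 T, HasDerivWithinAt γ (F (γ t)) (Icc 0 T) t) →
      ∀ t ∈ Ico 0 T, HasDerivWithinAt γ (F (γ t)) (Ici t) t := by
    intro γ hγ t ht
    refine (hγ t ⟨ht.1, ht.2.le⟩).mono_of_mem_nhdsWithin ?_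
    exact Filter.mem_of_superset (Icc_mem_nhdsGE ht.2) (Icc_subset_Icc_left ht.1)
  exact ODE_solution_unique_of_mem_Icc_right (v := fun _ => F) (s := fun _ => univ) (K := K)
    (fun _ _ => hF.lipschitzOnWith) (fun t ht => (hα t ht).continuousWithinAt) (aux α hα)
    (fun _ _ => mem_univ _) (fun t ht => (hβ t ht).continuousWithinAt) (aux β hβ)
    (fun _ _ => mem_univ _) h0

end ODE

theorem hasDerivWithinAt_norm_sq {f : ℝ → L2C} {f' : L2C} {s : Set ℝ} {t : ℝ}
    (hf : HasDerivWithinAt f f' s t) :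
    HasDerivWithinAt (fun t => ‖f t‖ ^ 2) (2 * (inner ℂ (f t) f').re) s t := by
  have h := hf.inner ℂ hf
  have h2 := Complex.reCLM.hasFDerivAt.comp_hasDerivWithinAt t h
  have e : ∀ x : L2C, Complex.reCLM (inner ℂ x x) = ‖x‖ ^ 2 := by
    intro x
    rw [inner_self_eq_norm_sq_to_K]
    norm_cast
  have e2 : Complex.reCLM (inner ℂ (f t) f' + inner ℂ f' (f t)) = 2 * (inner ℂ (f t) f').re := by
    rw [map_add, ← inner_conj_symm f' (f t)]
    simp only [Complex.reCLM_apply, Complex.conj_re]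
    ring
  rw [e2] at h2
  refine h2.congr_of_eventuallyEq ?_ (e _).symm
  exact Filter.Eventually.of_forall fun t => (e _).symm

/-! ### Galerkin approximations -/

theorem mulOp_comm {m₁ m₂ : ℝ → ℂ} (h₁ : MemLp m₁ ∞ (volume : Measure ℝ))
    (h₂ : MemLp m₂ ∞ (volume : Measure ℝ)) (f : L2C) :
    mulOp m₁ (mulOp m₂ f) = mulOp m₂ (mulOp m₁ f) := by
  rw [mulOp_mulOp h₁ h₂ (fun _ => rfl), mulOp_mulOp h₂ h₁ (fun x => mul_comm _ _)]

/-- Multiplication by an imaginary symbol is skew-adjoint; thus the Hilbert transform contributes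
nothing to energies. -/
theorem re_inner_mulOp_eq_zero {m : ℝ → ℂ} (hm : MemLp m ∞ (volume : Measure ℝ))
    (h : ∀ ξ, (m ξ).re = 0) (f : L2C) : (inner ℂ f (mulOp m f)).re = 0 := by
  have h1 : conj (inner ℂ f (mulOp m f)) = - inner ℂ f (mulOp m f) := by
    rw [inner_eq_integral_conj_mul, ← integral_conj, ← integral_neg]
    apply integral_congr_ae
    filter_upwards [coeFn_mulOp hm f] with ξ hξ
    have : conj (m ξ) = - m ξ := by
      apply Complex.ext <;> simp [h]
    rw [hξ]
    simp only [map_mul, Complex.conj_conj, this]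
    ring
  have := congrArg Complex.re h1
  simp only [Complex.conj_re, Complex.neg_re] at this
  linarith

theorem measurable_hilbertSymbol : Measurable hilbertSymbol := by
  unfold hilbertSymbol
  apply Measurable.const_mul
  apply Complex.measurable_ofReal.comp
  unfold Real.sign
  exact Measurable.ite measurableSet_Iio measurable_const
    (Measurable.ite measurableSet_Ioi measurable_const measurable_const)

theorem norm_hilbertSymbol_le (ξ : ℝ) : ‖hilbertSymbol ξ‖ ≤ 1 := by
  rcases Real.sign_apply_eq ξ with h | h | h <;> simp [hilbertSymbol, h]

theorem re_hilbertSymbol (ξ : ℝ) : (hilbertSymbol ξ).re = 0 := by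
  simp [hilbertSymbol]

theorem hilbertSymbol_neg (ξ : ℝ) : hilbertSymbol (-ξ) = conj (hilbertSymbol ξ) := by
  simp [hilbertSymbol, Real.sign_neg]

/-- The symbol of the Hilbert transform, restricted to the frequencies at most `n`. -/
def cutHilbert (n ξ : ℝ) : ℂ := (cut n ξ : ℂ) * hilbertSymbol ξ

theorem measurable_cutHilbert (n : ℝ) : Measurable (cutHilbert n) := by
  have := measurable_hilbertSymbol
  unfold cutHilbert
  fun_prop

theorem norm_cut_le (n ξ : ℝ) : ‖(cut n ξ : ℂ)‖ ≤ 1 := by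
  rw [Complex.norm_real, Real.norm_of_nonneg (cut_nonneg n ξ)]
  exact cut_le_one n ξ

theorem norm_cutHilbert_le (n ξ : ℝ) : ‖cutHilbert n ξ‖ ≤ 1 := by
  rw [cutHilbert, norm_mul]
  exact mul_le_one₀ (norm_cut_le n ξ) (norm_nonneg _) (norm_hilbertSymbol_le ξ)

theorem memLp_cutHilbert (n : ℝ) : MemLp (cutHilbert n) ∞ (volume : Measure ℝ) :=
  memLp_top_of_le (measurable_cutHilbert n) (norm_cutHilbert_le n)

theorem memLp_cut (n : ℝ) : MemLp (fun ξ => (cut n ξ : ℂ)) ∞ (volume : Measure ℝ) :=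
  memLp_top_of_le (by fun_prop) (norm_cut_le n)

theorem cut_neg (n ξ : ℝ) : cut n (-ξ) = cut n ξ := by simp [cut]

/-- The vector field of the Galerkin approximation. -/
def galerkin (k : ℝ) (hk : 3 / 2 < k) (n : ℝ) (A : L2C) : L2C :=
  mulOp (cutHilbert n) A - mulOp (cutDeriv n) (transportCLM k hk A A)

theorem galerkin_zero {k : ℝ} (hk : 3 / 2 < k) (n : ℝ) : galerkin k hk n 0 = 0 := by
  simp [galerkin]

theorem norm_galerkin_sub_le {k : ℝ} (hk : 3 / 2 < k) {n : ℝ} (hn : 0 ≤ n) (A B : L2C) :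
    ‖galerkin k hk n A - galerkin k hk n B‖ ≤
      (1 + (1 + n) * transportConst k * (‖A‖ + ‖B‖)) * ‖A - B‖ := by
  have hC := transportConst_nonneg k
  have e : galerkin k hk n A - galerkin k hk n B = mulOp (cutHilbert n) (A - B) -
      mulOp (cutDeriv n) (transportCLM k hk (A - B) A + transportCLM k hk B (A - B)) := by
    simp only [galerkin, map_sub, map_add, sub_apply]
    abel
  rw [e]
  refine (norm_sub_le _ _).trans ?_
  have h1 := norm_mulOp_le (measurable_cutHilbert n) (norm_cutHilbert_le n) (A - B)
  have h2 := norm_mulOp_le (measurable_cutDeriv n) (norm_cutDeriv_le hn)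
    (transportCLM k hk (A - B) A + transportCLM k hk B (A - B))
  have h3 := norm_transportCLM_le hk (A - B) A
  have h4 := norm_transportCLM_le hk B (A - B)
  have h5 := norm_add_le (transportCLM k hk (A - B) A) (transportCLM k hk B (A - B))
  calc _ ≤ 1 * ‖A - B‖ + (1 + n) * (transportConst k * ‖A - B‖ * ‖A‖ +
        transportConst k * ‖B‖ * ‖A - B‖) := by
        refine add_le_add h1 (h2.trans ?_)
        gcongr
        linarith
    _ = _ := by ring

theorem reflect_galerkin {k : ℝ} (hk : 3 / 2 < k) {n : ℝ} (hn : 0 ≤ n) (A : L2C) :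
    reflect (galerkin k hk n A) = galerkin k hk n (reflect A) := by
  rw [galerkin, map_sub, reflect_mulOp (memLp_cutHilbert n), reflect_mulOp (memLp_cutDeriv hn),
    reflect_transportCLM, galerkin]
  · intro ξ
    rw [cutDeriv, cutDeriv, Complex.conj_ofReal, cut_neg, jb_neg]
  · intro ξ
    rw [cutHilbert, cutHilbert, map_mul, Complex.conj_ofReal, cut_neg, hilbertSymbol_neg]

theorem cut_galerkin {k : ℝ} (hk : 3 / 2 < k) {n : ℝ} (hn : 0 ≤ n) (A : L2C) :
    mulOp (fun ξ => (cut n ξ : ℂ)) (galerkin k hk n A) = galerkin k hk n A := by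
  have h : ∀ ξ, (cut n ξ : ℂ) * cut n ξ = cut n ξ := fun ξ => by exact_mod_cast cut_mul_cut n ξ
  rw [galerkin, map_sub, mulOp_mulOp (m := cutHilbert n) (memLp_cut n) (memLp_cutHilbert n),
    mulOp_mulOp (m := cutDeriv n) (memLp_cut n) (memLp_cutDeriv hn)]
  · intro ξ
    simp only [cutDeriv, Complex.ofReal_mul]
    rw [← mul_assoc, h]
  · intro ξ
    rw [cutHilbert, ← mul_assoc, h]

theorem re_inner_tail_galerkin_le {k R n : ℝ} (hk : 3 / 2 < k) (hR : 0 ≤ R) (hn : 0 ≤ n)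
    {A : L2C} (hA : reflect A = A) (hc : mulOp (fun ξ => (cut n ξ : ℂ)) A = A) :
    (inner ℂ (mulOp (tailMul R) A) (mulOp (tailMul R) (galerkin k hk n A))).re ≤
      energyConst k * ‖A‖ * ‖mulOp (tailMul R) A‖ ^ 2 := by
  have hs : ∀ᵐ ξ, (A : ℝ → ℂ) ξ = cut n ξ * A ξ := by
    have := coeFn_mulOp (memLp_cut n) A
    rwa [hc] at this
  have h1 := (abs_le.1 (abs_re_inner_tail_transport_le hk hR hn (reflect_eq_self_iff.1 hA) hs)).1
  have h2 := re_inner_mulOp_eq_zero (memLp_cutHilbert n)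
    (fun ξ => by simp [cutHilbert, re_hilbertSymbol]) (mulOp (tailMul R) A)
  rw [galerkin, map_sub, inner_sub_right, mulOp_comm (memLp_tailMul hR) (memLp_cutHilbert n),
    Complex.sub_re, h2]
  linarith

theorem mulOp_tailMul_zero (A : L2C) : mulOp (tailMul 0) A = A := by
  apply Lp.ext
  filter_upwards [coeFn_mulOp (memLp_tailMul le_rfl) A] with ξ h
  rw [h, tailMul, tailFactor_zero (jb_pos ξ).ne']
  simp

/-- Existence of Galerkin approximations, with uniform bounds. -/
theorem exists_galerkin {k n T : ℝ} (hk : 3 / 2 < k) (hn : 0 ≤ n) (hT : 0 ≤ T) {A₀ : L2C}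
    (hA₀ : reflect A₀ = A₀) (hc₀ : mulOp (fun ξ => (cut n ξ : ℂ)) A₀ = A₀)
    (hsmall : 2 * energyConst k * ‖A₀‖ * T ≤ 1) :
    ∃ A : ℝ → L2C, A 0 = A₀ ∧ ∀ t ∈ Icc 0 T,
      HasDerivWithinAt A (galerkin k hk n (A t)) (Icc 0 T) t ∧ reflect (A t) = A t ∧
      mulOp (fun ξ => (cut n ξ : ℂ)) (A t) = A t ∧ ‖A t‖ ≤ 2 * ‖A₀‖ ∧
      ∀ R, 0 ≤ R → ‖mulOp (tailMul R) (A t)‖ ≤ Real.exp 1 * ‖mulOp (tailMul R) A₀‖ := by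
  have hC := transportConst_nonneg k
  have hEC := energyConst_nonneg (k := k) (by linarith)
  set ρ := 2 * ‖A₀‖ with hρ
  obtain ⟨K, hLip, hb⟩ := lipschitz_ramp_smul (G := galerkin k hk n) (ℓ := 1)
    (β := (1 + n) * transportConst k) (ρ := ρ) zero_le_one (by positivity) (by positivity)
    (galerkin_zero hk n) (norm_galerkin_sub_le hk hn)
  obtain ⟨A, h0, hA⟩ := exists_solution_of_lipschitz_of_bounded hLip hb A₀ hT
  have hzero : (0 : ℝ) ∈ Icc 0 T := ⟨le_rfl, hT⟩
  -- The reflection is isometric and commutes with the Galerkin field, hence with the truncated one,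
  -- so the reflected curve solves the same equation with the same data.
  have hrefl : ∀ t ∈ Icc 0 T, reflect (A t) = A t := by
    apply eqOn_of_lipschitz hLip (α := fun t => reflect (A t)) (β := A) _ hA
    · simp only [h0, hA₀]
    · intro t ht
      have := reflect.hasFDerivAt.comp_hasDerivWithinAt t (hA t ht)
      rw [map_smul, reflect_galerkin hk hn] at this
      rw [norm_reflect]
      exact this
  have hcut : ∀ t ∈ Icc 0 T, mulOp (fun ξ => (cut n ξ : ℂ)) (A t) = A t := by
    intro t ht
    set P : L2C →L[ℝ] L2C := (mulOp fun ξ => (cut n ξ : ℂ)).restrictScalars ℝ with hP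
    -- The field takes values in the range of the projection P, so the component of A outside that
    -- range is constant in time.
    have hd : ∀ t ∈ Icc 0 T, HasDerivWithinAt (fun t => ‖P (A t) - A t‖ ^ 2) 0 (Icc 0 T) t := by
      intro t ht
      have h1 := (P.hasFDerivAt.comp_hasDerivWithinAt t (hA t ht)).sub (hA t ht)
      have h2 : P (ramp ρ ‖A t‖ • galerkin k hk n (A t)) = ramp ρ ‖A t‖ • galerkin k hk n (A t) := by
        rw [map_smul]
        congr 1
        exact cut_galerkin hk hn _
      rw [h2, sub_self] at h1
      have h3 := hasDerivWithinAt_norm_sq h1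
      rw [inner_zero_right, Complex.zero_re, mul_zero] at h3
      exact h3
    have h4 := le_initial_of_deriv_nonpos hd (fun _ _ => le_rfl) ht
    have h5 : P (A 0) - A 0 = 0 := by
      rw [h0, sub_eq_zero]; exact hc₀
    simp only [h5, norm_zero] at h4
    have h6 : ‖P (A t) - A t‖ = 0 := by
      have := norm_nonneg (P (A t) - A t)
      nlinarith
    exact sub_eq_zero.1 (norm_eq_zero.1 h6)
  -- The ramp factor lies in [0, 1] and the upper bound is nonnegative, so the energy estimate
  -- survives the truncation.
  have hder : ∀ R, 0 ≤ R → ∀ t ∈ Icc 0 T, ∃ y' : ℝ,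
      HasDerivWithinAt (fun t => ‖mulOp (tailMul R) (A t)‖ ^ 2) y' (Icc 0 T) t ∧
      y' ≤ 2 * (energyConst k * ‖A t‖ * ‖mulOp (tailMul R) (A t)‖ ^ 2) := by
    intro R hR t ht
    have h1 := ((mulOp (tailMul R)).restrictScalars ℝ).hasFDerivAt.comp_hasDerivWithinAt t (hA t ht)
    refine ⟨_, hasDerivWithinAt_norm_sq h1, ?_⟩
    have h2 := re_inner_tail_galerkin_le hk hR hn (hrefl t ht) (hcut t ht)
    have h3 : (inner ℂ (mulOp (tailMul R) (A t))
        (mulOp (tailMul R) (ramp ρ ‖A t‖ • galerkin k hk n (A t)))).re =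
        ramp ρ ‖A t‖ * (inner ℂ (mulOp (tailMul R) (A t))
          (mulOp (tailMul R) (galerkin k hk n (A t)))).re := by
      have e : ∀ (r : ℝ) (w : L2C), r • w = (r : ℂ) • w := fun _ _ => rfl
      rw [e, map_smul, inner_smul_right, Complex.re_ofReal_mul]
    change 2 * (inner ℂ (mulOp (tailMul R) (A t))
        (mulOp (tailMul R) (ramp ρ ‖A t‖ • galerkin k hk n (A t)))).re ≤ _
    rw [h3]
    refine mul_le_mul_of_nonneg_left ?_ zero_le_two
    have h4 : 0 ≤ energyConst k * ‖A t‖ * ‖mulOp (tailMul R) (A t)‖ ^ 2 := by positivity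
    exact (mul_le_mul_of_nonneg_left h2 (ramp_nonneg _ _)).trans
      (mul_le_of_le_one_left h4 (ramp_le_one _ _))
  -- The tail factor with R = 0 is identically 1, so the estimate closes in ‖A‖ and the Riccati
  -- bound keeps A in the region where the ramp equals 1.
  have hbound : ∀ t ∈ Icc 0 T, ‖A t‖ ≤ ρ := by
    intro t ht
    choose! y' hy' hle using hder 0 le_rfl
    simp only [mulOp_tailMul_zero] at hy' hle
    have := riccati_bound (y := fun t => ‖A t‖ ^ 2) (y' := y') (T := T) hEC
      (fun t _ => by positivity) hy' (fun t ht => by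
        rw [Real.sqrt_sq (norm_nonneg _)]
        refine (hle t ht).trans_eq ?_
        ring) ht
        (by
          rw [Real.sqrt_sq (norm_nonneg _), h0]
          refine le_trans ?_ hsmall
          gcongr
          exact ht.2)
    rwa [Real.sqrt_sq (norm_nonneg _), Real.sqrt_sq (norm_nonneg _), h0] at this
  refine ⟨A, h0, fun t ht => ⟨?_, hrefl t ht, hcut t ht, hbound t ht, ?_⟩⟩
  · have := hA t ht
    rwa [ramp_eq_one (hbound t ht), one_smul] at this
  · intro R hR
    choose! y' hy' hle using hder R hR
    have h1 := gronwall_linear (y := fun t => ‖mulOp (tailMul R) (A t)‖ ^ 2) (y' := y') (T := T)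
      (K := 2 * energyConst k * ρ) (δ := 0) (by positivity) le_rfl hy' (fun t ht => by
        refine (hle t ht).trans ?_
        have := hbound t ht
        calc _ ≤ 2 * (energyConst k * ρ * ‖mulOp (tailMul R) (A t)‖ ^ 2) := by gcongr
          _ = _ := by ring) ht
    rw [h0] at h1
    -- With ρ = 2‖A₀‖ the smallness condition bounds the exponent by 2; after the square root the
    -- factor is e.
    have h2 : 2 * energyConst k * ρ * t ≤ 2 := by
      have : 2 * energyConst k * ‖A₀‖ * t ≤ 1 := le_trans (by gcongr; exact ht.2) hsmall
      rw [hρ]; linarith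
    have h3 : Real.exp (2 * energyConst k * ρ * t) ≤ Real.exp 1 ^ 2 := by
      rw [← Real.exp_nat_mul]
      apply Real.exp_le_exp.2
      simpa using h2
    have h4 : ‖mulOp (tailMul R) (A t)‖ ^ 2 ≤ (Real.exp 1 * ‖mulOp (tailMul R) A₀‖) ^ 2 := by
      rw [mul_pow]
      refine h1.trans ?_
      rw [zero_mul, add_zero, mul_comm]
      gcongr
    exact (sq_le_sq₀ (norm_nonneg _) (by positivity)).1 h4

/-! ### The equation on the Fourier side, and stability in `L²` -/

/-- The Fourier transform of `H[u] - u ∂ₓ u`, where `(1 + ξ²)^{k/2} û = A`. -/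
def rhs (k : ℝ) (hk : 3 / 2 < k) (A : L2C) : L2C :=
  mulOp hilbertSymbol (mulOp (wt (-k)) A) - mulOp (wt (-(k - 1))) (transportCLM k hk A A)

theorem norm_lowOp_le {s : ℝ} (hs : 0 ≤ s) (A : L2C) : ‖mulOp (wt (-s)) A‖ ≤ ‖A‖ := by
  simpa using norm_mulOp_le (measurable_wt (-s)) (norm_wt_neg_le hs) A

theorem norm_mulOp_hilbertSymbol_le (A : L2C) : ‖mulOp hilbertSymbol A‖ ≤ ‖A‖ := by
  simpa using norm_mulOp_le measurable_hilbertSymbol norm_hilbertSymbol_le A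

/-- With E = A - B the bilinear term splits as N(E, A) + N(B, E). In the first E is not
differentiated; in the second the derivative on E sits in the skew-symmetric position. -/
theorem rhs_sub_rhs {k : ℝ} (hk : 3 / 2 < k) (A B : L2C) :
    rhs k hk A - rhs k hk B = mulOp hilbertSymbol (mulOp (wt (-k)) (A - B)) -
      (mulOp (wt (-(k - 1))) (transportCLM k hk (A - B) A) +
        mulOp (wt (-(k - 1))) (transportCLM k hk B (A - B))) := by
  simp only [rhs, map_sub, sub_apply]
  abel

theorem norm_rhs_sub_le {k : ℝ} (hk : 3 / 2 < k) (A B : L2C) :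
    ‖rhs k hk A - rhs k hk B‖ ≤ (1 + transportConst k * (‖A‖ + ‖B‖)) * ‖A - B‖ := by
  rw [rhs_sub_rhs]
  have h1 := (norm_mulOp_hilbertSymbol_le _).trans (norm_lowOp_le (s := k) (by linarith) (A - B))
  have h2 := (norm_lowOp_le (s := k - 1) (by linarith) _).trans (norm_transportCLM_le hk (A - B) A)
  have h3 := (norm_lowOp_le (s := k - 1) (by linarith) _).trans (norm_transportCLM_le hk B (A - B))
  refine (norm_sub_le _ _).trans ?_
  have h4 := norm_add_le (mulOp (wt (-(k - 1))) (transportCLM k hk (A - B) A))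
    (mulOp (wt (-(k - 1))) (transportCLM k hk B (A - B)))
  calc _ ≤ ‖A - B‖ + (transportConst k * ‖A - B‖ * ‖A‖ + transportConst k * ‖B‖ * ‖A - B‖) := by
        gcongr; linarith
    _ = _ := by ring

theorem continuous_rhs {k : ℝ} (hk : 3 / 2 < k) : Continuous (rhs k hk) := by
  unfold rhs
  fun_prop

/-- The growth rate in the stability estimate for solutions of size at most `M`. -/
def stabConst (k M : ℝ) : ℝ := 6 * Real.pi * sobConst k * M + 1

theorem stabConst_nonneg (k : ℝ) {M : ℝ} (hM : 0 ≤ M) : 0 ≤ stabConst k M := by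
  have := sobConst_nonneg k
  unfold stabConst
  positivity

/-- Stability in `L²` of approximate solutions. -/
theorem lowOp_stability {k : ℝ} (hk : 3 / 2 < k) {T M δ : ℝ} (hM : 0 ≤ M)
    {A B e₁ e₂ : ℝ → L2C} (hB : ∀ t ∈ Icc 0 T, reflect (B t) = B t)
    (hAM : ∀ t ∈ Icc 0 T, ‖A t‖ ≤ M) (hBM : ∀ t ∈ Icc 0 T, ‖B t‖ ≤ M)
    (hA' : ∀ t ∈ Icc 0 T, HasDerivWithinAt (fun t => mulOp (wt (-k)) (A t))
      (rhs k hk (A t) + e₁ t) (Icc 0 T) t)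
    (hB' : ∀ t ∈ Icc 0 T, HasDerivWithinAt (fun t => mulOp (wt (-k)) (B t))
      (rhs k hk (B t) + e₂ t) (Icc 0 T) t)
    (he : ∀ t ∈ Icc 0 T, ‖e₁ t - e₂ t‖ ≤ δ) {t : ℝ} (ht : t ∈ Icc 0 T) :
    ‖mulOp (wt (-k)) (A t - B t)‖ ^ 2 ≤
      (‖mulOp (wt (-k)) (A 0 - B 0)‖ ^ 2 + δ ^ 2 * t) * Real.exp (stabConst k M * t) := by
  have hκ := sobConst_nonneg k
  refine gronwall_linear (y := fun t => ‖mulOp (wt (-k)) (A t - B t)‖ ^ 2)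
    (y' := fun t => 2 * (inner ℂ (mulOp (wt (-k)) (A t - B t))
      (rhs k hk (A t) - rhs k hk (B t) + (e₁ t - e₂ t))).re) (T := T)
    (stabConst_nonneg k hM) (by positivity) ?_ ?_ ht
  · intro t ht
    have h := (hA' t ht).sub (hB' t ht)
    have h2 : HasDerivWithinAt (fun t => mulOp (wt (-k)) (A t - B t))
        (rhs k hk (A t) - rhs k hk (B t) + (e₁ t - e₂ t)) (Icc 0 T) t := by
      have e1 : (fun t => mulOp (wt (-k)) (A t - B t)) =
          (fun t => mulOp (wt (-k)) (A t)) - fun t => mulOp (wt (-k)) (B t) :=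
        funext fun t => map_sub _ _ _
      have e2 : rhs k hk (A t) - rhs k hk (B t) + (e₁ t - e₂ t) =
          rhs k hk (A t) + e₁ t - (rhs k hk (B t) + e₂ t) := by abel
      rw [e1, e2]
      exact h
    exact hasDerivWithinAt_norm_sq h2
  · intro t ht
    -- After the factor 2 from differentiating the square, the two transport terms contribute 4π and
    -- 2π times `sobConst k` · M. The error term contributes the 1 in `stabConst` through 2‖w‖δ ≤
    -- ‖w‖² + δ².
    set E := A t - B t with hE
    set w := mulOp (wt (-k)) E with hw
    have h1 := re_inner_mulOp_eq_zero memLp_hilbertSymbol re_hilbertSymbol w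
    have h2 : |(inner ℂ w (mulOp (wt (-(k - 1))) (transportCLM k hk E (A t)))).re| ≤
        2 * Real.pi * sobConst k * M * ‖w‖ ^ 2 := by
      refine (Complex.abs_re_le_norm _).trans ((norm_inner_le_norm _ _).trans ?_)
      have h := norm_lowOp_transport_le hk E (A t)
      calc _ ≤ ‖w‖ * (2 * Real.pi * sobConst k * ‖A t‖ * ‖w‖) := by gcongr
        _ ≤ ‖w‖ * (2 * Real.pi * sobConst k * M * ‖w‖) := by gcongr; exact hAM t ht
        _ = _ := by ring
    have h3 : |(inner ℂ w (mulOp (wt (-(k - 1))) (transportCLM k hk (B t) E))).re| ≤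
        Real.pi * sobConst k * M * ‖w‖ ^ 2 := by
      refine (abs_re_inner_lowOp_transport_le hk (reflect_eq_self_iff.1 (hB t ht)) E).trans ?_
      gcongr
      exact hBM t ht
    have h4 : (inner ℂ w (e₁ t - e₂ t)).re ≤ ‖w‖ * δ :=
      (Complex.re_le_norm _).trans ((norm_inner_le_norm _ _).trans (by gcongr; exact he t ht))
    have h5 : 2 * (‖w‖ * δ) ≤ ‖w‖ ^ 2 + δ ^ 2 := by nlinarith [sq_nonneg (‖w‖ - δ)]
    rw [rhs_sub_rhs]
    simp only [inner_add_right, inner_sub_right, Complex.add_re, Complex.sub_re]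
    simp only [inner_sub_right, Complex.sub_re] at h4
    rw [h1]
    have h6 := (abs_le.1 h2).1
    have h7 := (abs_le.1 h3).1
    unfold stabConst
    nlinarith

/-- A curve `A` of Hermitian `L²` functions for which `(1 + ξ²)^{-k/2} A` solves the Fourier
transform of the Burgers-Hilbert equation on `[0, T]`. -/
structure IsFourierSolution (k : ℝ) (hk : 3 / 2 < k) (T : ℝ) (A : ℝ → L2C) : Prop where
  hermitian : ∀ t ∈ Icc 0 T, reflect (A t) = A t
  continuousOn : ContinuousOn A (Icc 0 T)
  hasDeriv : ∀ t ∈ Icc 0 T, HasDerivWithinAt (fun t => mulOp (wt (-k)) (A t))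
    (rhs k hk (A t)) (Icc 0 T) t

theorem IsFourierSolution.mono {k : ℝ} {hk : 3 / 2 < k} {T T' : ℝ} {A : ℝ → L2C}
    (h : IsFourierSolution k hk T A) (hT : T' ≤ T) : IsFourierSolution k hk T' A where
  hermitian t ht := h.hermitian t (Icc_subset_Icc_right hT ht)
  continuousOn := h.continuousOn.mono (Icc_subset_Icc_right hT)
  hasDeriv t ht := (h.hasDeriv t (Icc_subset_Icc_right hT ht)).mono (Icc_subset_Icc_right hT)

theorem IsFourierSolution.stability {k : ℝ} {hk : 3 / 2 < k} {T M : ℝ} (hM : 0 ≤ M)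
    {A B : ℝ → L2C} (hA : IsFourierSolution k hk T A) (hB : IsFourierSolution k hk T B)
    (hAM : ∀ t ∈ Icc 0 T, ‖A t‖ ≤ M) (hBM : ∀ t ∈ Icc 0 T, ‖B t‖ ≤ M) {t : ℝ}
    (ht : t ∈ Icc 0 T) :
    ‖mulOp (wt (-k)) (A t - B t)‖ ^ 2 ≤
      ‖mulOp (wt (-k)) (A 0 - B 0)‖ ^ 2 * Real.exp (stabConst k M * t) := by
  have := lowOp_stability hk (δ := 0) (e₁ := 0) (e₂ := 0) hM hB.hermitian hAM hBM
    (fun t ht => by simpa using hA.hasDeriv t ht) (fun t ht => by simpa using hB.hasDeriv t ht)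
    (fun t _ => by simp) ht
  simpa using this

theorem eq_of_lowOp_sub_eq_zero {k : ℝ} (hk : 0 ≤ k) {A B : L2C}
    (h : ‖mulOp (wt (-k)) (A - B)‖ = 0) : A = B := by
  rw [norm_eq_zero, map_sub, sub_eq_zero] at h
  exact eq_of_mulOp_eq (memLp_wt_neg hk) (wt_ne_zero _) h

theorem IsFourierSolution.eqOn {k : ℝ} {hk : 3 / 2 < k} {T : ℝ} {A B : ℝ → L2C}
    (hA : IsFourierSolution k hk T A) (hB : IsFourierSolution k hk T B) (h0 : A 0 = B 0) :
    EqOn A B (Icc 0 T) := by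
  intro t ht
  obtain ⟨M₁, h1⟩ := isCompact_Icc.exists_bound_of_continuousOn hA.continuousOn
  obtain ⟨M₂, h2⟩ := isCompact_Icc.exists_bound_of_continuousOn hB.continuousOn
  have hM1 := (norm_nonneg _).trans (h1 t ht)
  have h := hA.stability (M := max M₁ M₂) (hM1.trans (le_max_left _ _)) hB
    (fun t ht => (h1 t ht).trans (le_max_left _ _))
    (fun t ht => (h2 t ht).trans (le_max_right _ _)) ht
  rw [h0, sub_self, map_zero, norm_zero] at h
  apply eq_of_lowOp_sub_eq_zero (k := k) (by linarith)
  have := norm_nonneg (mulOp (wt (-k)) (A t - B t))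
  nlinarith

/-! ### Low and high frequencies -/

/-- Interpolation between the tail and the L² norm of the underlying function, from the pointwise
bound 1 ≤ 2 V_R + R^k ⟨ξ⟩^(-k). It upgrades L² stability to H^k once the tails are uniformly small.
-/
theorem norm_le_tail_add {k R : ℝ} (hk : 0 ≤ k) (hR : 0 ≤ R) (E : L2C) :
    ‖E‖ ≤ 2 * ‖mulOp (tailMul R) E‖ + R ^ k * ‖mulOp (wt (-k)) E‖ := by
  have hRk : 0 ≤ R ^ k := by positivity
  have h := norm_le_of_ae_sum (f := E) (g₁ := (2 : ℂ) • mulOp (tailMul R) E)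
    (g₂ := ((R ^ k : ℝ) : ℂ) • mulOp (wt (-k)) E) ?_
  · rwa [norm_smul, norm_smul, Complex.norm_real, Real.norm_of_nonneg hRk,
      Complex.norm_ofNat] at h
  · filter_upwards [Lp.coeFn_smul (2 : ℂ) (mulOp (tailMul R) E),
      Lp.coeFn_smul ((R ^ k : ℝ) : ℂ) (mulOp (wt (-k)) E), coeFn_mulOp (memLp_tailMul hR) E,
      coeFn_mulOp (memLp_wt_neg hk) E] with ξ h1 h2 h3 h4
    rw [h1, h2, Pi.smul_apply, Pi.smul_apply, h3, h4, norm_smul, norm_smul, norm_mul, norm_mul,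
      norm_tailMul hR, norm_wt, Complex.norm_real, Real.norm_of_nonneg hRk, Complex.norm_ofNat]
    have h5 := rpow_le_tailFactor_add hk hR (one_le_jb ξ)
    have hp : 0 < jb ξ ^ k := Real.rpow_pos_of_pos (jb_pos ξ) k
    have h6 : 1 ≤ 2 * tailFactor R (jb ξ) + R ^ k * jb ξ ^ (-k) := by
      rw [Real.rpow_neg (jb_pos ξ).le]
      refine le_of_mul_le_mul_right ?_ hp
      rw [add_mul, mul_assoc (R ^ k), inv_mul_cancel₀ hp.ne']
      linarith
    calc ‖E ξ‖ = 1 * ‖E ξ‖ := (one_mul _).symm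
      _ ≤ (2 * tailFactor R (jb ξ) + R ^ k * jb ξ ^ (-k)) * ‖E ξ‖ := by gcongr
      _ = _ := by ring

theorem tendsto_mulOp_zero {m : ℝ → ℝ → ℂ} (hm : ∀ r, Measurable (m r)) (A : L2C)
    (hb : ∀ᶠ r in Filter.atTop, ∀ ξ, ‖m r ξ‖ ≤ 1)
    (hlim : ∀ ξ, Filter.Tendsto (fun r => m r ξ) Filter.atTop (nhds 0)) :
    Filter.Tendsto (fun r => ‖mulOp (m r) A‖) Filter.atTop (nhds 0) := by
  have hAm := measurable_coe A
  have h1 : Filter.Tendsto (fun r => ∫⁻ ξ, ‖m r ξ * A ξ‖ₑ ^ 2) Filter.atTop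
      (nhds (∫⁻ _ : ℝ, 0)) := by
    apply tendsto_lintegral_filter_of_dominated_convergence (fun ξ => ‖A ξ‖ₑ ^ 2)
    · exact Filter.Eventually.of_forall fun r => by have := hm r; fun_prop
    · filter_upwards [hb] with r hr
      refine Filter.Eventually.of_forall fun ξ => ?_
      rw [enorm_mul]
      gcongr
      refine mul_le_of_le_one_left' ?_
      rw [← ofReal_norm]
      exact ENNReal.ofReal_le_one.2 (hr ξ)
    · rw [← nrm2_sq, nrm2_coe]
      exact ENNReal.pow_ne_top ENNReal.ofReal_ne_top
    · refine Filter.Eventually.of_forall fun ξ => ?_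
      have h := ENNReal.Tendsto.pow (n := 2) ((hlim ξ).mul_const (A ξ)).enorm
      simpa using h
  rw [lintegral_zero] at h1
  have h2 : Filter.Tendsto (fun r => ‖mulOp (m r) A‖ ^ 2) Filter.atTop (nhds 0) := by
    have h3 := (ENNReal.tendsto_toReal ENNReal.zero_ne_top).comp h1
    rw [ENNReal.toReal_zero] at h3
    refine h3.congr' ?_
    filter_upwards [hb] with r hr
    rw [Function.comp_apply, ← nrm2_sq, nrm2_mulOp (memLp_top_of_le (hm r) hr) A,
      ← ENNReal.ofReal_pow (norm_nonneg _), ENNReal.toReal_ofReal (by positivity)]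
  have h4 := h2.sqrt
  simpa [Real.sqrt_sq (norm_nonneg _)] using h4

theorem tendsto_tail_zero (A : L2C) :
    Filter.Tendsto (fun R => ‖mulOp (tailMul R) A‖) Filter.atTop (nhds 0) := by
  apply tendsto_mulOp_zero measurable_tailMul A
  · filter_upwards [Filter.eventually_ge_atTop 0] with R hR using norm_tailMul_le hR
  · intro ξ
    unfold tailMul tailFactor
    rw [← Complex.ofReal_zero]
    refine (Complex.continuous_ofReal.tendsto 0).comp ?_
    exact tendsto_const_nhds.div_atTop (Filter.tendsto_atTop_add_const_right _ _ Filter.tendsto_id)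

theorem tendsto_cut_sub (A : L2C) : Filter.Tendsto
    (fun n => ‖mulOp (fun ξ => (cut n ξ : ℂ)) A - A‖) Filter.atTop (nhds 0) := by
  have hb : ∀ n ξ, ‖((1 - cut n ξ : ℝ) : ℂ)‖ ≤ 1 := by
    intro n ξ
    rw [Complex.norm_real, Real.norm_of_nonneg (by linarith [cut_le_one n ξ])]
    linarith [cut_nonneg n ξ]
  have h := tendsto_mulOp_zero (m := fun n ξ => ((1 - cut n ξ : ℝ) : ℂ))
    (fun n => by fun_prop) A (Filter.Eventually.of_forall hb) ?_
  · refine h.congr fun n => ?_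
    rw [norm_sub_rev]
    congr 1
    apply Lp.ext
    filter_upwards [coeFn_mulOp (memLp_top_of_le (by fun_prop) (hb n)) A,
      Lp.coeFn_sub A (mulOp (fun ξ => (cut n ξ : ℂ)) A), coeFn_mulOp (memLp_cut n) A]
      with ξ h1 h2 h3
    rw [h1, h2, Pi.sub_apply, h3]
    push_cast
    ring
  · intro ξ
    apply tendsto_const_nhds.congr'
    filter_upwards [Filter.eventually_ge_atTop |ξ|] with n hn
    simp [cut, hn]

/-! ### Local existence -/

section Calculus

variable {E : Type*} [NormedAddCommGroup E] [NormedSpace ℝ E]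

theorem norm_sub_initial_le {f f' : ℝ → E} {T ε : ℝ}
    (hf : ∀ t ∈ Icc 0 T, HasDerivWithinAt f (f' t) (Icc 0 T) t)
    (hε : ∀ t ∈ Icc 0 T, ‖f' t‖ ≤ ε) {t : ℝ} (ht : t ∈ Icc 0 T) : ‖f t - f 0‖ ≤ ε * t := by
  have := (convex_Icc 0 T).norm_image_sub_le_of_norm_hasDerivWithin_le hf hε
    ⟨le_rfl, ht.1.trans ht.2⟩ ht
  simpa [abs_of_nonneg ht.1] using this

theorem hasDerivWithinAt_integral [CompleteSpace E] {g : ℝ → E} {T : ℝ}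
    (hg : ContinuousOn g (Icc 0 T)) (x₀ : E) {t : ℝ} (ht : t ∈ Icc 0 T) :
    HasDerivWithinAt (fun t => x₀ + ∫ s in (0 : ℝ)..t, g s) (g t) (Icc 0 T) t :=
  -- The Picard map of the field f(t, x) = x, applied to the curve g, is x₀ + ∫ g.
  ODE.hasDerivWithinAt_picard_Icc (f := fun _ x => x) (u := univ) ⟨le_rfl, ht.1.trans ht.2⟩
    continuous_snd.continuousOn hg (fun _ _ => mem_univ _) x₀ ht

/-- The derivative of a uniform limit on a closed interval. -/
theorem hasDerivWithinAt_of_uniform_limit [CompleteSpace E] {f f' : ℕ → ℝ → E} {F F' : ℝ → E}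
    {T : ℝ} (hf : ∀ n, ∀ t ∈ Icc 0 T, HasDerivWithinAt (f n) (f' n t) (Icc 0 T) t)
    (hlim : ∀ t ∈ Icc 0 T, Filter.Tendsto (fun n => f n t) Filter.atTop (nhds (F t)))
    (hlim' : ∀ ε > 0, ∃ N, ∀ n ≥ N, ∀ t ∈ Icc 0 T, ‖f' n t - F' t‖ ≤ ε)
    (hF' : ContinuousOn F' (Icc 0 T)) {t : ℝ} (ht : t ∈ Icc 0 T) :
    HasDerivWithinAt F (F' t) (Icc 0 T) t := by
  have h0 : (0 : ℝ) ∈ Icc 0 T := ⟨le_rfl, ht.1.trans ht.2⟩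
  -- The limit is identified with the primitive of F': the differences from G have derivatives
  -- tending uniformly to zero, hence so do their increments.
  set G : ℝ → E := fun t => F 0 + ∫ s in (0 : ℝ)..t, F' s with hG
  have hGd : ∀ t ∈ Icc 0 T, HasDerivWithinAt G (F' t) (Icc 0 T) t := fun t ht =>
    hasDerivWithinAt_integral hF' (F 0) ht
  have hG0 : G 0 = F 0 := by simp [hG]
  have heq : ∀ t ∈ Icc 0 T, F t = G t := by
    intro t ht
    rw [← sub_eq_zero, ← norm_le_zero_iff]
    refine le_of_forall_pos_le_add fun ε hε => ?_
    rw [zero_add]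
    have hT : 0 ≤ T := h0.2
    obtain ⟨N, hN⟩ := hlim' (ε / (T + 1)) (by positivity)
    have h1 : Filter.Tendsto (fun n => ‖(f n t - G t) - (f n 0 - G 0)‖) Filter.atTop
        (nhds ‖(F t - G t) - (F 0 - G 0)‖) :=
      (((hlim t ht).sub_const _).sub ((hlim 0 h0).sub_const _)).norm
    rw [hG0, sub_self, sub_zero] at h1
    refine le_of_tendsto h1 ?_
    filter_upwards [Filter.eventually_ge_atTop N] with n hn
    have h2 := norm_sub_initial_le (f := fun t => f n t - G t) (f' := fun t => f' n t - F' t)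
      (fun t ht => (hf n t ht).sub (hGd t ht)) (hN n hn) ht
    rw [← hG0]
    refine h2.trans ?_
    rw [div_mul_eq_mul_div, div_le_iff₀ (by positivity)]
    gcongr
    linarith [ht.2]
  exact (hGd t ht).congr heq (heq t ht)

end Calculus

/-- Since A is supported in |ξ| ≤ n, the Hilbert term is exact. The error is the part of the
transport term above n, where ⟨ξ⟩^(-(k-1)) ≤ n^(-(k-1)). -/
theorem norm_lowOp_galerkin_sub_rhs_le {k n : ℝ} (hk : 3 / 2 < k) (hn : 0 < n) {A : L2C}
    (hc : mulOp (fun ξ => (cut n ξ : ℂ)) A = A) :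
    ‖mulOp (wt (-k)) (galerkin k hk n A) - rhs k hk A‖ ≤
      n ^ (-(k - 1)) * (transportConst k * ‖A‖ * ‖A‖) := by
  have hwk := memLp_wt_neg (s := k) (by linarith)
  have hw1 := memLp_wt_neg (s := k - 1) (by linarith)
  set m : ℝ → ℂ := fun ξ => ((1 - cut n ξ : ℝ) : ℂ) * wt (-(k - 1)) ξ with hm
  have hmm : Measurable m := by fun_prop
  have hmb : ∀ ξ, ‖m ξ‖ ≤ n ^ (-(k - 1)) := by
    intro ξ
    rw [hm]
    simp only
    rw [norm_mul, norm_wt, Complex.norm_real, cut]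
    split_ifs with h
    · simp only [sub_self, norm_zero, zero_mul]; positivity
    · simp only [sub_zero, norm_one, one_mul]
      have : n ≤ jb ξ := by linarith [abs_le_jb ξ]
      rw [Real.rpow_neg (jb_pos ξ).le, Real.rpow_neg hn.le]
      have h2 : 0 < n ^ (k - 1) := by positivity
      gcongr
      linarith
  have e1 : mulOp (wt (-k)) (mulOp (cutHilbert n) A) = mulOp hilbertSymbol (mulOp (wt (-k)) A) := by
    rw [← mulOp_mulOp (m := cutHilbert n) memLp_hilbertSymbol (memLp_cut n)
      (fun ξ => mul_comm _ _), hc, mulOp_comm hwk memLp_hilbertSymbol]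
  have e2 : mulOp (wt (-k)) (galerkin k hk n A) - rhs k hk A = mulOp m (transportCLM k hk A A) := by
    rw [galerkin, map_sub, e1, rhs]
    apply Lp.ext
    set X := mulOp hilbertSymbol (mulOp (wt (-k)) A)
    set N := transportCLM k hk A A
    have e3 : X - mulOp (wt (-k)) (mulOp (cutDeriv n) N) - (X - mulOp (wt (-(k - 1))) N) =
      mulOp (wt (-(k - 1))) N - mulOp (wt (-k)) (mulOp (cutDeriv n) N) := by abel
    rw [e3]
    filter_upwards [Lp.coeFn_sub (mulOp (wt (-(k - 1))) N) (mulOp (wt (-k)) (mulOp (cutDeriv n) N)),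
      coeFn_mulOp hw1 N, coeFn_mulOp hwk (mulOp (cutDeriv n) N), coeFn_mulOp (memLp_cutDeriv hn.le) N,
      coeFn_mulOp (memLp_top_of_le hmm hmb) N] with ξ h1 h2 h3 h4 h5
    rw [h1, Pi.sub_apply, h2, h3, h4, h5, hm]
    have h6 : wt (-(k - 1)) ξ = wt (-k) ξ * jb ξ := by
      rw [show -(k - 1) = -k + 1 by ring, ← wt_mul_wt]
      simp [wt]
    simp only [h6, cutDeriv]
    push_cast
    ring
  rw [e2]
  refine (norm_mulOp_le hmm hmb _).trans ?_
  gcongr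
  exact norm_transportCLM_le hk A A

/-- Local existence on the Fourier side, with uniform control of high frequencies. -/
theorem exists_fourierSolution {k T : ℝ} (hk : 3 / 2 < k) (hT : 0 ≤ T) {A₀ : L2C}
    (hA₀ : reflect A₀ = A₀) (hsmall : 2 * energyConst k * ‖A₀‖ * T ≤ 1) :
    ∃ A : ℝ → L2C, IsFourierSolution k hk T A ∧ A 0 = A₀ ∧ ∀ t ∈ Icc 0 T,
      ‖A t‖ ≤ 2 * ‖A₀‖ ∧
      ∀ R, 0 ≤ R → ‖mulOp (tailMul R) (A t)‖ ≤ Real.exp 1 * ‖mulOp (tailMul R) A₀‖ := by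
  have hk0 : 0 ≤ k := by linarith
  have hC := transportConst_nonneg k
  have hEC := energyConst_nonneg hk0
  have hn : ∀ n : ℕ, (0 : ℝ) < n + 1 := fun n => by positivity
  set P : ℕ → L2C := fun n => mulOp (fun ξ => (cut (n + 1) ξ : ℂ)) A₀ with hP
  have hPn : ∀ n, ‖P n‖ ≤ ‖A₀‖ := fun n => by
    simpa using norm_mulOp_le (m := fun ξ => (cut (n + 1) ξ : ℂ)) (by fun_prop)
      (norm_cut_le (n + 1)) A₀
  have hPr : ∀ n, reflect (P n) = P n := by
    intro n
    rw [hP]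
    simp only
    rw [reflect_mulOp (memLp_cut _) (fun ξ => by rw [cut_neg, Complex.conj_ofReal]), hA₀]
  have hPc : ∀ n : ℕ, mulOp (fun ξ => (cut (n + 1) ξ : ℂ)) (P n) = P n := fun n =>
    mulOp_mulOp (memLp_cut _) (memLp_cut _) (fun ξ => by exact_mod_cast (cut_mul_cut _ ξ).symm) _
  have hPt : ∀ n R, 0 ≤ R → ‖mulOp (tailMul R) (P n)‖ ≤ ‖mulOp (tailMul R) A₀‖ := by
    intro n R hR
    rw [hP]
    simp only
    rw [mulOp_comm (memLp_tailMul hR) (memLp_cut _)]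
    simpa using norm_mulOp_le (m := fun ξ => (cut (n + 1) ξ : ℂ)) (by fun_prop)
      (norm_cut_le (n + 1)) (mulOp (tailMul R) A₀)
  choose A hA0 hA using fun n : ℕ => exists_galerkin (n := n + 1) hk (hn n).le hT (hPr n) (hPc n)
    (le_trans (by gcongr; exact hPn n) hsmall)
  set M := 2 * ‖A₀‖ with hM
  have hM0 : 0 ≤ M := by positivity
  have hAM : ∀ n, ∀ t ∈ Icc 0 T, ‖A n t‖ ≤ M := fun n t ht =>
    (hA n t ht).2.2.2.1.trans (by have := hPn n; linarith)
  have hAtail : ∀ n, ∀ t ∈ Icc 0 T, ∀ R, 0 ≤ R →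
      ‖mulOp (tailMul R) (A n t)‖ ≤ Real.exp 1 * ‖mulOp (tailMul R) A₀‖ := fun n t ht R hR =>
    ((hA n t ht).2.2.2.2 R hR).trans (by gcongr; exact hPt n R hR)
  set e : ℕ → ℝ → L2C := fun n t => mulOp (wt (-k)) (galerkin k hk (n + 1) (A n t)) -
    rhs k hk (A n t) with he
  have hlow : ∀ n, ∀ t ∈ Icc 0 T, HasDerivWithinAt (fun t => mulOp (wt (-k)) (A n t))
      (rhs k hk (A n t) + e n t) (Icc 0 T) t := by
    intro n t ht
    have := ((mulOp (wt (-k))).restrictScalars ℝ).hasFDerivAt.comp_hasDerivWithinAt t (hA n t ht).1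
    rw [he]
    simp only [add_sub_cancel]
    exact this
  set δ : ℕ → ℝ := fun n => ((n : ℝ) + 1) ^ (-(k - 1)) * (transportConst k * M * M) with hδ
  have hδ0 : ∀ n, 0 ≤ δ n := fun n => by have := hn n; positivity
  have heδ : ∀ n, ∀ t ∈ Icc 0 T, ‖e n t‖ ≤ δ n := by
    intro n t ht
    refine (norm_lowOp_galerkin_sub_rhs_le hk (hn n) (hA n t ht).2.2.1).trans ?_
    simp only [hδ]
    have := hAM n t ht
    have := hn n
    gcongr
  have hδlim : Filter.Tendsto δ Filter.atTop (nhds 0) := by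
    have h1 : Filter.Tendsto (fun n : ℕ => ((n : ℝ) + 1) ^ (-(k - 1))) Filter.atTop (nhds 0) :=
      (tendsto_rpow_neg_atTop (by linarith)).comp
        (Filter.tendsto_atTop_add_const_right _ _ tendsto_natCast_atTop_atTop)
    have h2 := h1.mul_const (transportConst k * M * M)
    rwa [zero_mul] at h2
  set γ : ℕ → ℝ := fun n => ‖P n - A₀‖ with hγ
  have hγlim : Filter.Tendsto γ Filter.atTop (nhds 0) :=
    (tendsto_cut_sub A₀).comp
      (Filter.tendsto_atTop_add_const_right _ _ tendsto_natCast_atTop_atTop)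
  have hstab : ∀ n m, ∀ t ∈ Icc 0 T, ‖mulOp (wt (-k)) (A n t - A m t)‖ ^ 2 ≤
      ((γ n + γ m) ^ 2 + (δ n + δ m) ^ 2 * T) * Real.exp (stabConst k M * T) := by
    intro n m t ht
    have h1 := lowOp_stability hk hM0
      (fun t ht => (hA m t ht).2.1) (hAM n) (hAM m) (hlow n) (hlow m)
      (fun t ht => (norm_sub_le _ _).trans (add_le_add (heδ n t ht) (heδ m t ht))) ht
    have h2 : ‖mulOp (wt (-k)) (A n 0 - A m 0)‖ ≤ γ n + γ m := by
      refine (norm_lowOp_le hk0 _).trans ?_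
      rw [hA0, hA0]
      calc ‖P n - P m‖ = ‖(P n - A₀) - (P m - A₀)‖ := by congr 1; abel
        _ ≤ _ := norm_sub_le _ _
    have hs := stabConst_nonneg k hM0
    refine h1.trans ?_
    have := ht.2
    gcongr
  -- the approximations form a uniform Cauchy sequence
  have hcauchy : ∀ ε > 0, ∃ N, ∀ n ≥ N, ∀ m ≥ N, ∀ t ∈ Icc 0 T, ‖A n t - A m t‖ < ε := by
    -- R is fixed first, from A₀ alone. The factor 4e collects the 2 of `norm_le_tail_add`, two
    -- approximations, and the factor e of the tail bound. For this R the low-frequency term is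
    -- small once n and m are large.
    intro ε hε
    have htail := (tendsto_tail_zero A₀).const_mul (4 * Real.exp 1)
    rw [mul_zero] at htail
    obtain ⟨R, hR, hR0⟩ := ((htail.eventually (gt_mem_nhds (half_pos hε))).and
      (Filter.eventually_ge_atTop 0)).exists
    set c := (ε / 2) / (R ^ k + 1) with hc
    have hc0 : 0 < c := by positivity
    have hsum : ∀ {x : ℕ → ℝ}, Filter.Tendsto x Filter.atTop (nhds 0) →
        Filter.Tendsto (fun p : ℕ × ℕ => x p.1 + x p.2) Filter.atTop (nhds 0) := by
      intro x hx
      rw [← Filter.prod_atTop_atTop_eq]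
      simpa using (hx.comp Filter.tendsto_fst).add (hx.comp Filter.tendsto_snd)
    have hq : Filter.Tendsto (fun p : ℕ × ℕ => ((γ p.1 + γ p.2) ^ 2 + (δ p.1 + δ p.2) ^ 2 * T) *
        Real.exp (stabConst k M * T)) Filter.atTop (nhds 0) := by
      have := ((((hsum hγlim).pow 2).add (((hsum hδlim).pow 2).mul_const T)).mul_const
        (Real.exp (stabConst k M * T)))
      simpa using this
    obtain ⟨⟨N₁, N₂⟩, hN⟩ := Filter.eventually_atTop.1
      (hq.eventually (gt_mem_nhds (by positivity : 0 < c ^ 2)))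
    refine ⟨max N₁ N₂, fun n hn m hm t ht => ?_⟩
    have h1 := (hstab n m t ht).trans_lt
      (hN (n, m) ⟨(le_max_left _ _).trans hn, (le_max_right _ _).trans hm⟩)
    have h2 : ‖mulOp (wt (-k)) (A n t - A m t)‖ < c := lt_of_pow_lt_pow_left₀ 2 hc0.le h1
    have h3 := norm_le_tail_add hk0 hR0 (A n t - A m t)
    have h4 : ‖mulOp (tailMul R) (A n t - A m t)‖ ≤
        2 * (Real.exp 1 * ‖mulOp (tailMul R) A₀‖) := by
      rw [map_sub]
      have := hAtail n t ht R hR0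
      have := hAtail m t ht R hR0
      linarith [norm_sub_le (mulOp (tailMul R) (A n t)) (mulOp (tailMul R) (A m t))]
    have h5 : R ^ k * ‖mulOp (wt (-k)) (A n t - A m t)‖ ≤ ε / 2 := by
      have hRk : 0 ≤ R ^ k := by positivity
      calc _ ≤ (R ^ k + 1) * c := by gcongr; linarith
        _ = ε / 2 := by rw [hc]; field_simp
    linarith
  have hcs : ∀ t ∈ Icc 0 T, CauchySeq fun n => A n t := by
    intro t ht
    rw [Metric.cauchySeq_iff]
    intro ε hε
    obtain ⟨N, hN⟩ := hcauchy ε hε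
    exact ⟨N, fun n hn m hm => by rw [dist_eq_norm]; exact hN n hn m hm t ht⟩
  choose! Al hAl using fun t ht => cauchySeq_tendsto_of_complete (hcs t ht)
  have hunif : ∀ ε > 0, ∃ N, ∀ n ≥ N, ∀ t ∈ Icc 0 T, ‖A n t - Al t‖ ≤ ε := by
    intro ε hε
    obtain ⟨N, hN⟩ := hcauchy ε hε
    refine ⟨N, fun n hn t ht => ?_⟩
    refine le_of_tendsto ((hAl t ht).const_sub (A n t)).norm ?_
    filter_upwards [Filter.eventually_ge_atTop N] with m hm
    exact (hN n hn m hm t ht).le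
  have hAlM : ∀ t ∈ Icc 0 T, ‖Al t‖ ≤ M := fun t ht =>
    le_of_tendsto (hAl t ht).norm (Filter.Eventually.of_forall fun n => hAM n t ht)
  have hAlc : ContinuousOn Al (Icc 0 T) := by
    have hu : TendstoUniformlyOn A Al Filter.atTop (Icc 0 T) := by
      rw [Metric.tendstoUniformlyOn_iff]
      intro ε hε
      obtain ⟨N, hN⟩ := hunif (ε / 2) (half_pos hε)
      filter_upwards [Filter.eventually_ge_atTop N] with n hn t ht
      rw [dist_comm, dist_eq_norm]
      exact (hN n hn t ht).trans_lt (half_lt_self hε)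
    refine hu.continuousOn (Filter.Eventually.of_forall fun n => ?_).frequently
    exact fun t ht => (hA n t ht).1.continuousWithinAt
  refine ⟨Al, ⟨?_, hAlc, ?_⟩, ?_, fun t ht => ⟨hAlM t ht, fun R hR => ?_⟩⟩
  · intro t ht
    refine tendsto_nhds_unique ((reflect.continuous.tendsto _).comp (hAl t ht)) ?_
    refine (hAl t ht).congr fun n => ?_
    exact ((hA n t ht).2.1).symm
  · intro t ht
    refine hasDerivWithinAt_of_uniform_limit hlow (F' := fun t => rhs k hk (Al t))
      (fun t ht => ((mulOp (wt (-k))).continuous.tendsto _).comp (hAl t ht)) ?_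
      ((continuous_rhs hk).comp_continuousOn hAlc) ht
    intro ε hε
    set c := 1 + transportConst k * (M + M) with hc
    have hc0 : 0 < c := by positivity
    obtain ⟨N₁, h1⟩ := hunif (ε / 2 / c) (by positivity)
    obtain ⟨N₂, h2⟩ := Filter.eventually_atTop.1
      (hδlim.eventually (gt_mem_nhds (half_pos hε)))
    refine ⟨max N₁ N₂, fun n hn t ht => ?_⟩
    have h3 := h1 n ((le_max_left _ _).trans hn) t ht
    have h4 := h2 n ((le_max_right _ _).trans hn)
    have h5 := norm_rhs_sub_le hk (A n t) (Al t)
    calc ‖rhs k hk (A n t) + e n t - rhs k hk (Al t)‖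
        = ‖(rhs k hk (A n t) - rhs k hk (Al t)) + e n t‖ := by congr 1; abel
      _ ≤ ‖rhs k hk (A n t) - rhs k hk (Al t)‖ + ‖e n t‖ := norm_add_le _ _
      _ ≤ c * (ε / 2 / c) + ε / 2 := by
          refine add_le_add (h5.trans ?_) ((heδ n t ht).trans h4.le)
          rw [hc]
          have := hAM n t ht
          have := hAlM t ht
          gcongr
      _ = ε := by field_simp; ring
  · have h0 : (0 : ℝ) ∈ Icc 0 T := ⟨le_rfl, hT⟩
    refine tendsto_nhds_unique (hAl 0 h0) ?_
    simp only [hA0]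
    exact tendsto_iff_norm_sub_tendsto_zero.2 hγlim
  · exact le_of_tendsto (((mulOp (tailMul R)).continuous.tendsto _).comp (hAl t ht)).norm
      (Filter.Eventually.of_forall fun n => hAtail n t ht R hR)

/-- Continuous dependence on the initial data, for a short time. -/
theorem local_dependence {k T : ℝ} (hk : 3 / 2 < k) (hT : 0 ≤ T) {A₀ : L2C}
    (hA₀ : reflect A₀ = A₀) (hsmall : 2 * energyConst k * (‖A₀‖ + 1) * T ≤ 1) {ε : ℝ}
    (hε : 0 < ε) :
    ∃ δ > 0, ∀ B₀ : L2C, reflect B₀ = B₀ → ‖B₀ - A₀‖ < δ →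
      ∃ B, IsFourierSolution k hk T B ∧ B 0 = B₀ ∧
        ∀ A, IsFourierSolution k hk T A → A 0 = A₀ → ∀ t ∈ Icc 0 T, ‖B t - A t‖ < ε := by
  have hk0 : 0 ≤ k := by linarith
  have hEC := energyConst_nonneg hk0
  obtain ⟨A, hA, hA0, hAb⟩ := exists_fourierSolution hk hT hA₀
    (le_trans (by gcongr; linarith) hsmall)
  set M := 2 * (‖A₀‖ + 1) with hM
  have hM0 : 0 ≤ M := by positivity
  have hs := stabConst_nonneg k hM0
  have htail := (tendsto_tail_zero A₀).const_mul (4 * Real.exp 1)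
  rw [mul_zero] at htail
  -- With d = ‖B₀ - A₀‖, the final bound is 4e · tail(A₀) + D d. The choice of R makes the first
  -- term less than ε/2, and δ does the same for the second; D depends on R, so R comes first.
  obtain ⟨R, hR, hR0⟩ := ((htail.eventually (gt_mem_nhds (half_pos hε))).and
    (Filter.eventually_ge_atTop 0)).exists
  set D := 2 * Real.exp 1 + R ^ k * Real.exp (stabConst k M * T) with hD
  have hD0 : 0 < D := by positivity
  refine ⟨min 1 (ε / 2 / D), by positivity, fun B₀ hB₀ hd => ?_⟩
  have hd1 : ‖B₀ - A₀‖ < 1 := hd.trans_le (min_le_left _ _)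
  have hd2 : ‖B₀ - A₀‖ < ε / 2 / D := hd.trans_le (min_le_right _ _)
  have hBn : ‖B₀‖ ≤ ‖A₀‖ + 1 := by
    have := norm_add_le (B₀ - A₀) A₀
    rw [sub_add_cancel] at this
    linarith
  obtain ⟨B, hB, hB0, hBb⟩ := exists_fourierSolution hk hT hB₀ (le_trans (by gcongr) hsmall)
  refine ⟨B, hB, hB0, fun A' hA' hA'0 t ht => ?_⟩
  rw [hA'.eqOn hA (hA'0.trans hA0.symm) ht]
  have h1 := hB.stability hM0 hA
    (fun t ht => (hBb t ht).1.trans (by linarith)) (fun t ht => (hAb t ht).1.trans (by linarith)) ht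
  rw [hB0, hA0] at h1
  have h2 : ‖mulOp (wt (-k)) (B t - A t)‖ ≤ ‖B₀ - A₀‖ * Real.exp (stabConst k M * T) := by
    have h3 : 0 ≤ stabConst k M * T := by positivity
    refine (sq_le_sq₀ (norm_nonneg _) (by positivity)).1 (h1.trans ?_)
    rw [mul_pow]
    have h4 : Real.exp (stabConst k M * t) ≤ Real.exp (stabConst k M * T) ^ 2 := by
      rw [← Real.exp_nat_mul]
      apply Real.exp_le_exp.2
      have : stabConst k M * t ≤ stabConst k M * T := by gcongr; exact ht.2
      push_cast
      linarith
    gcongr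
    exact norm_lowOp_le hk0 _
  have h3 : ‖mulOp (tailMul R) (B t - A t)‖ ≤
      Real.exp 1 * (2 * ‖mulOp (tailMul R) A₀‖ + ‖B₀ - A₀‖) := by
    have h4 := (hBb t ht).2 R hR0
    have h5 := (hAb t ht).2 R hR0
    -- The tail of B₀ is controlled by that of A₀ and the distance, so R need not depend on B₀.
    have h6 : ‖mulOp (tailMul R) B₀‖ ≤ ‖B₀ - A₀‖ + ‖mulOp (tailMul R) A₀‖ := by
      have h7 := norm_add_le (mulOp (tailMul R) (B₀ - A₀)) (mulOp (tailMul R) A₀)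
      rw [← map_add, sub_add_cancel] at h7
      have h8 := norm_mulOp_le (measurable_tailMul R) (norm_tailMul_le hR0) (B₀ - A₀)
      linarith
    rw [map_sub]
    have h9 := norm_sub_le (mulOp (tailMul R) (B t)) (mulOp (tailMul R) (A t))
    have := Real.exp_pos 1
    nlinarith
  have h4 := norm_le_tail_add hk0 hR0 (B t - A t)
  have h5 : R ^ k * ‖mulOp (wt (-k)) (B t - A t)‖ ≤
      R ^ k * (‖B₀ - A₀‖ * Real.exp (stabConst k M * T)) := by gcongr
  have h6 : D * ‖B₀ - A₀‖ < ε / 2 := by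
    rwa [lt_div_iff₀ hD0, mul_comm] at hd2
  rw [hD] at h6
  nlinarith

/-! ### Continuation of solutions -/

/-- Vacuous off the closed interval; it lets the derivative of a glued curve be checked piece by
piece on a union of intervals. -/
theorem hasDerivWithinAt_of_notMem {E : Type*} [NormedAddCommGroup E] [NormedSpace ℝ E]
    {f : ℝ → E} {f' : E} {a b t : ℝ} (h : t ∉ Icc a b) : HasDerivWithinAt f f' (Icc a b) t :=
  HasFDerivWithinAt.of_notMem_closure (by rwa [isClosed_Icc.closure_eq])

theorem IsFourierSolution.shift {k : ℝ} {hk : 3 / 2 < k} {T s : ℝ} {A : ℝ → L2C}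
    (h : IsFourierSolution k hk T A) (hs : 0 ≤ s) :
    IsFourierSolution k hk (T - s) fun t => A (s + t) := by
  have hmaps : MapsTo (fun t => s + t) (Icc 0 (T - s)) (Icc 0 T) := fun t ht =>
    ⟨by linarith [ht.1], by linarith [ht.2]⟩
  refine ⟨fun t ht => h.hermitian _ (hmaps ht), h.continuousOn.comp (by fun_prop) hmaps,
    fun t ht => ?_⟩
  have h1 : HasDerivWithinAt (fun t => s + t) 1 (Icc 0 (T - s)) t :=
    ((hasDerivAt_id t).const_add s).hasDerivWithinAt
  have := (h.hasDeriv _ (hmaps ht)).scomp t h1 hmaps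
  rw [one_smul] at this
  exact this

theorem IsFourierSolution.glue {k : ℝ} {hk : 3 / 2 < k} {T τ : ℝ} (hT : 0 ≤ T) (hτ : 0 ≤ τ)
    {A B : ℝ → L2C} (hA : IsFourierSolution k hk T A) (hB : IsFourierSolution k hk τ B)
    (h : B 0 = A T) :
    IsFourierSolution k hk (T + τ) fun t => if t ≤ T then A t else B (t - T) := by
  set D : ℝ → L2C := fun t => if t ≤ T then A t else B (t - T) with hD
  have hDA : EqOn D A (Icc 0 T) := fun t ht => if_pos ht.2
  have hDB : EqOn D (fun t => B (t - T)) (Icc T (T + τ)) := by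
    intro t ht
    rcases ht.1.eq_or_lt with h1 | h1
    · rw [← h1]
      simp only [hD, if_pos le_rfl, sub_self, h]
    · exact if_neg (not_le.2 h1)
  have hun : Icc 0 (T + τ) = Icc 0 T ∪ Icc T (T + τ) :=
    (Icc_union_Icc_eq_Icc hT (by linarith)).symm
  have hmaps : MapsTo (fun t => t - T) (Icc T (T + τ)) (Icc 0 τ) := fun t ht =>
    ⟨by linarith [ht.1], by linarith [ht.2]⟩
  refine ⟨?_, ?_, ?_⟩
  · intro t ht
    rw [hun] at ht
    rcases ht with ht | ht
    · rw [hDA ht]; exact hA.hermitian t ht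
    · rw [hDB ht]; exact hB.hermitian _ (hmaps ht)
  · rw [hun]
    refine (hA.continuousOn.congr hDA).union_of_isClosed ?_ isClosed_Icc isClosed_Icc
    exact (hB.continuousOn.comp (by fun_prop) hmaps).congr hDB
  · intro t ht
    rw [hun]
    refine HasDerivWithinAt.union ?_ ?_
    · by_cases h1 : t ∈ Icc 0 T
      · rw [hDA h1]
        exact (hA.hasDeriv t h1).congr (fun s hs => by rw [hDA hs]) (by rw [hDA h1])
      · exact hasDerivWithinAt_of_notMem h1
    · by_cases h1 : t ∈ Icc T (T + τ)
      · have h2 : HasDerivWithinAt (fun t => t - T) 1 (Icc T (T + τ)) t :=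
          ((hasDerivAt_id t).sub_const T).hasDerivWithinAt
        have h3 := (hB.hasDeriv _ (hmaps h1)).scomp t h2 hmaps
        rw [one_smul] at h3
        rw [hDB h1]
        exact h3.congr (fun s hs => by rw [hDB hs]; rfl) (by rw [hDB h1]; rfl)
      · exact hasDerivWithinAt_of_notMem h1

/-- The step τ is admissible at every time because A stays bounded by M. Finitely many short steps
cover [0, T], the required closeness being propagated backwards from the last step. -/
theorem dependence_of_le_nsmul {k M τ : ℝ} (hk : 3 / 2 < k) (hτ : 0 ≤ τ)
    (hsmall : 2 * energyConst k * (M + 1) * τ ≤ 1) (n : ℕ) :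
    ∀ T : ℝ, 0 ≤ T → T ≤ (n + 1) * τ → ∀ A, IsFourierSolution k hk T A →
      (∀ t ∈ Icc 0 T, ‖A t‖ ≤ M) → ∀ ε > 0, ∃ δ > 0, ∀ B₀ : L2C, reflect B₀ = B₀ →
        ‖B₀ - A 0‖ < δ → ∃ B, IsFourierSolution k hk T B ∧ B 0 = B₀ ∧
          ∀ t ∈ Icc 0 T, ‖B t - A t‖ < ε := by
  have hEC := energyConst_nonneg (k := k) (by linarith)
  have base : ∀ T : ℝ, 0 ≤ T → T ≤ τ → ∀ A, IsFourierSolution k hk T A →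
      (∀ t ∈ Icc 0 T, ‖A t‖ ≤ M) → ∀ ε > 0, ∃ δ > 0, ∀ B₀ : L2C, reflect B₀ = B₀ →
        ‖B₀ - A 0‖ < δ → ∃ B, IsFourierSolution k hk T B ∧ B 0 = B₀ ∧
          ∀ t ∈ Icc 0 T, ‖B t - A t‖ < ε := by
    intro T hT hTτ A hA hAM ε hε
    have h0 : (0 : ℝ) ∈ Icc 0 T := ⟨le_rfl, hT⟩
    have hM0 : 0 ≤ M := (norm_nonneg _).trans (hAM 0 h0)
    obtain ⟨δ, hδ, h⟩ := local_dependence hk hT (hA.hermitian 0 h0)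
      (le_trans (by have := hAM 0 h0; gcongr) hsmall) hε
    refine ⟨δ, hδ, fun B₀ hB₀ hd => ?_⟩
    obtain ⟨B, hB, hB0, hBA⟩ := h B₀ hB₀ hd
    exact ⟨B, hB, hB0, hBA A hA rfl⟩
  induction n with
  | zero => simpa using base
  | succ n ih =>
    intro T hT hTn A hA hAM ε hε
    rcases le_total T τ with hle | hle
    · exact base T hT hle A hA hAM ε hε
    have hT1 : 0 ≤ T - τ := by linarith
    have hsub : Icc 0 (T - τ) ⊆ Icc 0 T := Icc_subset_Icc_right (by linarith)
    have hmem : T - τ ∈ Icc 0 (T - τ) := ⟨hT1, le_rfl⟩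
    have hA2 := hA.shift hT1
    rw [sub_sub_cancel] at hA2
    -- The last interval [T - τ, T] comes first: its δ₁ is part of the accuracy then demanded on [0,
    -- T - τ].
    obtain ⟨δ₁, hδ₁, h1⟩ := base τ hτ le_rfl _ hA2
      (fun t ht => hAM _ ⟨by linarith [ht.1], by linarith [ht.2]⟩) ε hε
    obtain ⟨δ₂, hδ₂, h2⟩ := ih (T - τ) hT1 (by push_cast at hTn; linarith) A
      (hA.mono (by linarith)) (fun t ht => hAM t (hsub ht)) (min ε δ₁) (by positivity)
    refine ⟨δ₂, hδ₂, fun B₀ hB₀ hd => ?_⟩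
    obtain ⟨B, hB, hB0, hBA⟩ := h2 B₀ hB₀ hd
    obtain ⟨B', hB', hB'0, hBA'⟩ := h1 (B (T - τ)) (hB.hermitian _ hmem)
      (by rw [add_zero]; exact (hBA _ hmem).trans_le (min_le_right _ _))
    have hglue := hB.glue hT1 hτ hB' hB'0
    rw [sub_add_cancel] at hglue
    refine ⟨_, hglue, by simp only [if_pos hT1, hB0], fun t ht => ?_⟩
    by_cases h3 : t ≤ T - τ
    · simp only [if_pos h3]
      exact (hBA t ⟨ht.1, h3⟩).trans_le (min_le_left _ _)
    · simp only [if_neg h3]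
      have := hBA' (t - (T - τ)) ⟨by linarith, by linarith [ht.2]⟩
      rwa [add_sub_cancel] at this

/-! ### Maximal time, maximal solution and blowup rate -/

theorem inv_ofReal_le_of_forall {x : ℝ} (hx : 0 ≤ x) {Y : ℝ≥0∞}
    (h : ∀ τ : ℝ, 0 ≤ τ → x * τ ≤ 1 → ENNReal.ofReal τ ≤ Y) : (ENNReal.ofReal x)⁻¹ ≤ Y := by
  rcases hx.eq_or_lt with h0 | h0
  -- For x = 0 the inverse is ∞: zero data exist for all time.
  · have : Y = ∞ := by
      refine ENNReal.eq_top_of_forall_nnreal_le fun r => ?_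
      have := h r r.2 (by rw [← h0]; simp)
      rwa [ENNReal.ofReal_coe_nnreal] at this
    rw [this]; exact le_top
  · rw [← ENNReal.ofReal_inv_of_pos h0]
    exact h _ (by positivity) (mul_inv_cancel₀ h0.ne').le

/-- The times up to which there is a solution with given data. -/
def existenceTimes (k : ℝ) (hk : 3 / 2 < k) (A₀ : L2C) : Set ℝ :=
  {T | 0 ≤ T ∧ ∃ A, IsFourierSolution k hk T A ∧ A 0 = A₀}

/-- The maximal time of existence. -/
def maxTime (k : ℝ) (hk : 3 / 2 < k) (A₀ : L2C) : ℝ≥0∞ :=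
  ⨆ T ∈ existenceTimes k hk A₀, ENNReal.ofReal T

open Classical in
/-- The maximal solution. -/
def maxSolution (k : ℝ) (hk : 3 / 2 < k) (A₀ : L2C) (t : ℝ) : L2C :=
  if h : t ∈ existenceTimes k hk A₀ then h.2.choose t else 0

theorem existenceTimes_mono {k : ℝ} {hk : 3 / 2 < k} {A₀ : L2C} {T t : ℝ}
    (hT : T ∈ existenceTimes k hk A₀) (ht : t ∈ Icc 0 T) : t ∈ existenceTimes k hk A₀ := by
  obtain ⟨_, A, hA, hA0⟩ := hT
  exact ⟨ht.1, A, hA.mono ht.2, hA0⟩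

theorem ofReal_le_maxTime {k : ℝ} {hk : 3 / 2 < k} {A₀ : L2C} {T : ℝ}
    (hT : T ∈ existenceTimes k hk A₀) : ENNReal.ofReal T ≤ maxTime k hk A₀ :=
  le_iSup₂ (f := fun T (_ : T ∈ existenceTimes k hk A₀) => ENNReal.ofReal T) T hT

/-- Uniqueness makes the choices in `maxSolution`, made separately at each t, fit together into one
curve. -/
theorem IsFourierSolution.eqOn_maxSolution {k : ℝ} {hk : 3 / 2 < k} {A₀ : L2C} {T : ℝ}
    {A : ℝ → L2C} (hA : IsFourierSolution k hk T A) (hA0 : A 0 = A₀) :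
    EqOn A (maxSolution k hk A₀) (Icc 0 T) := by
  intro t ht
  have hmem : t ∈ existenceTimes k hk A₀ := ⟨ht.1, A, hA.mono ht.2, hA0⟩
  rw [maxSolution, dif_pos hmem]
  have hs := hmem.2.choose_spec
  exact (hA.mono ht.2).eqOn hs.1 (hA0.trans hs.2.symm) ⟨ht.1, le_rfl⟩

theorem add_mem_existenceTimes {k : ℝ} {hk : 3 / 2 < k} {T τ : ℝ} {A : ℝ → L2C} (hT : 0 ≤ T)
    (hτ : 0 ≤ τ) (hA : IsFourierSolution k hk T A)
    (hsmall : 2 * energyConst k * ‖A T‖ * τ ≤ 1) : T + τ ∈ existenceTimes k hk (A 0) := by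
  obtain ⟨B, hB, hB0, -⟩ := exists_fourierSolution hk hτ (hA.hermitian T ⟨hT, le_rfl⟩) hsmall
  exact ⟨by positivity, _, hA.glue hT hτ hB hB0, by simp [hT]⟩

/-- The supremum is not attained: a solution on a closed interval can be restarted at its endpoint,
so it always extends further. -/
theorem ofReal_lt_maxTime_iff {k : ℝ} {hk : 3 / 2 < k} {A₀ : L2C} {T : ℝ} (hT : 0 ≤ T) :
    ENNReal.ofReal T < maxTime k hk A₀ ↔ T ∈ existenceTimes k hk A₀ := by
  constructor
  · intro h
    obtain ⟨T', h'⟩ := lt_iSup_iff.1 h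
    obtain ⟨hT', hlt⟩ := lt_iSup_iff.1 h'
    exact existenceTimes_mono hT' ⟨hT, (ENNReal.ofReal_lt_ofReal_iff_of_nonneg hT).1 hlt |>.le⟩
  · rintro ⟨_, A, hA, rfl⟩
    have hEC := energyConst_nonneg (k := k) (by linarith)
    -- The summand 1 makes the time step positive and finite even when A T = 0.
    have hpos : 0 < 2 * energyConst k * ‖A T‖ + 1 := by positivity
    have h1 := add_mem_existenceTimes (τ := (2 * energyConst k * ‖A T‖ + 1)⁻¹) hT
      (by positivity) hA (by rw [← div_eq_mul_inv, div_le_one hpos]; linarith)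
    refine lt_of_lt_of_le ?_ (ofReal_le_maxTime h1)
    rw [ENNReal.ofReal_lt_ofReal_iff_of_nonneg hT]
    have : 0 < (2 * energyConst k * ‖A T‖ + 1)⁻¹ := by positivity
    linarith

theorem isFourierSolution_maxSolution {k : ℝ} {hk : 3 / 2 < k} {A₀ : L2C} {T : ℝ} (hT : 0 ≤ T)
    (h : ENNReal.ofReal T < maxTime k hk A₀) :
    IsFourierSolution k hk T (maxSolution k hk A₀) ∧ maxSolution k hk A₀ 0 = A₀ := by
  obtain ⟨_, A, hA, hA0⟩ := (ofReal_lt_maxTime_iff hT).1 h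
  have he := hA.eqOn_maxSolution hA0
  refine ⟨⟨fun t ht => ?_, hA.continuousOn.congr he.symm, fun t ht => ?_⟩, ?_⟩
  · rw [← he ht]; exact hA.hermitian t ht
  · rw [← he ht]
    exact (hA.hasDeriv t ht).congr (fun s hs => by rw [he hs]) (by rw [he ht])
  · rw [← he ⟨le_rfl, hT⟩, hA0]

theorem maxTime_lower_bound {k C : ℝ} (hk : 3 / 2 < k) (hC : energyConst k ≤ C) {A₀ : L2C}
    (hA₀ : reflect A₀ = A₀) : (ENNReal.ofReal (2 * C * ‖A₀‖))⁻¹ ≤ maxTime k hk A₀ := by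
  have hEC := energyConst_nonneg (k := k) (by linarith)
  have hC0 := hEC.trans hC
  refine inv_ofReal_le_of_forall (by positivity) fun τ hτ h => ?_
  obtain ⟨A, hA, hA0, -⟩ := exists_fourierSolution hk hτ hA₀ (le_trans (by gcongr) h)
  exact ofReal_le_maxTime ⟨hτ, A, hA, hA0⟩

theorem maxTime_pos {k : ℝ} (hk : 3 / 2 < k) {A₀ : L2C} (hA₀ : reflect A₀ = A₀) :
    0 < maxTime k hk A₀ :=
  lt_of_lt_of_le (ENNReal.inv_pos.2 ENNReal.ofReal_ne_top) (maxTime_lower_bound hk le_rfl hA₀)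

theorem norm_maxSolution_le {k C : ℝ} (hk : 3 / 2 < k) (hC : energyConst k ≤ C) {A₀ : L2C}
    (hA₀ : reflect A₀ = A₀) {t : ℝ} (ht : 0 ≤ t) (h : 2 * C * ‖A₀‖ * t ≤ 1) :
    ‖maxSolution k hk A₀ t‖ ≤ 2 * ‖A₀‖ := by
  obtain ⟨A, hA, hA0, hb⟩ := exists_fourierSolution hk ht hA₀ (le_trans (by gcongr) h)
  have hmem : t ∈ Icc 0 t := ⟨ht, le_rfl⟩
  rw [← hA.eqOn_maxSolution hA0 hmem]
  exact (hb t hmem).1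

/-- Restarting at time t prolongs the solution by the local existence time of its current value. -/
theorem blowup_rate {k C : ℝ} {hk : 3 / 2 < k} (hC : energyConst k ≤ C) {A₀ : L2C} {t : ℝ}
    (ht : 0 ≤ t) (h : ENNReal.ofReal t < maxTime k hk A₀) :
    (ENNReal.ofReal (2 * C * ‖maxSolution k hk A₀ t‖))⁻¹ ≤
      maxTime k hk A₀ - ENNReal.ofReal t := by
  have hEC := energyConst_nonneg (k := k) (by linarith)
  have hC0 := hEC.trans hC
  obtain ⟨hS, hS0⟩ := isFourierSolution_maxSolution ht h
  refine inv_ofReal_le_of_forall (by positivity) fun τ hτ hτ1 => ?_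
  have h1 := add_mem_existenceTimes ht hτ hS (le_trans (by gcongr) hτ1)
  rw [hS0] at h1
  have h2 := ofReal_le_maxTime h1
  rw [ENNReal.ofReal_add ht hτ] at h2
  exact ENNReal.le_sub_of_add_le_left ENNReal.ofReal_ne_top h2

theorem global_dependence {k : ℝ} {hk : 3 / 2 < k} {A₀ : L2C} {T : ℝ} (hT : 0 ≤ T)
    (h : ENNReal.ofReal T < maxTime k hk A₀) {ε : ℝ} (hε : 0 < ε) :
    ∃ δ > 0, ∀ B₀ : L2C, reflect B₀ = B₀ → ‖B₀ - A₀‖ < δ →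
      ENNReal.ofReal T < maxTime k hk B₀ ∧
      ∀ t ∈ Icc 0 T, ‖maxSolution k hk B₀ t - maxSolution k hk A₀ t‖ < ε := by
  have hEC := energyConst_nonneg (k := k) (by linarith)
  obtain ⟨hS, hS0⟩ := isFourierSolution_maxSolution hT h
  obtain ⟨M, hM⟩ := isCompact_Icc.exists_bound_of_continuousOn hS.continuousOn
  have hM0 : 0 ≤ M := (norm_nonneg _).trans (hM 0 ⟨le_rfl, hT⟩)
  set τ := (2 * energyConst k * (M + 1) + 1)⁻¹ with hτ
  have hpos : 0 < 2 * energyConst k * (M + 1) + 1 := by positivity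
  have hτ0 : 0 < τ := by positivity
  obtain ⟨n, hn⟩ := exists_nat_ge (T / τ)
  rw [div_le_iff₀ hτ0] at hn
  obtain ⟨δ, hδ, hdep⟩ := dependence_of_le_nsmul hk hτ0.le
    (by rw [hτ, ← div_eq_mul_inv, div_le_one hpos]; linarith) n T hT (by linarith) _ hS hM ε hε
  refine ⟨δ, hδ, fun B₀ hB₀ hd => ?_⟩
  obtain ⟨B, hB, hB0, hBA⟩ := hdep B₀ hB₀ (by rwa [hS0])
  refine ⟨(ofReal_lt_maxTime_iff hT).2 ⟨hT, B, hB, hB0⟩, fun t ht => ?_⟩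
  rw [← hB.eqOn_maxSolution hB0 ht]
  exact hBA t ht

/-! ### Fourier transforms of square integrable functions -/

theorem eq_of_forall_integral_eq {A B : L2C}
    (h : ∀ φ : 𝓢(ℝ, ℂ), ∫ x, φ x * A x = ∫ x, φ x * B x) : A = B := by
  apply toTemperedDistribution_injective
  ext φ
  simpa using h φ

theorem integral_mul_fourierInv (φ : 𝓢(ℝ, ℂ)) (A : L2C) :
    ∫ x, φ x * (𝓕⁻ A : L2C) x = ∫ x, (𝓕⁻ φ) x * A x := by
  have h := congrArg (fun w : 𝓢'(ℝ, ℂ) => w φ) (Lp.fourierInv_toTemperedDistribution_eq A)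
  simpa [TemperedDistribution.fourierInv_apply] using h.symm

/-- Integration against a Schwartz function. -/
def pair (φ : 𝓢(ℝ, ℂ)) : L2C →L[ℝ] ℂ :=
  ((ContinuousLinearMap.mul ℂ ℂ).lpPairing volume 2 2 (φ.toLp 2)).restrictScalars ℝ

theorem pair_apply (φ : 𝓢(ℝ, ℂ)) (A : L2C) : pair φ A = ∫ x, φ x * A x := by
  have : pair φ A = (ContinuousLinearMap.mul ℂ ℂ).lpPairing volume 2 2 (φ.toLp 2) A := rfl
  rw [this, ContinuousLinearMap.lpPairing_eq_integral]
  refine integral_congr_ae ?_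
  filter_upwards [φ.coeFn_toLp 2 volume] with x hx
  simp [hx]

/-- Both sides have the same integral against every smooth compactly supported function, by moving
the transform onto the test function. This connects the L² transform with the integral formula
needed for the convolution theorem. -/
theorem fourierInv_ae_eq (G : L2C) (hG : Integrable G) :
    ((𝓕⁻ G : L2C) : ℝ → ℂ) =ᵐ[volume] 𝓕⁻ (G : ℝ → ℂ) := by
  have hcont : Continuous (𝓕⁻ (G : ℝ → ℂ)) :=
    VectorFourier.fourierIntegral_continuous Real.continuous_fourierChar
      (by exact (continuous_inner (𝕜 := ℝ) (E := ℝ)).neg) hG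
  refine ae_eq_of_integral_contDiff_smul_eq ((Lp.memLp _).locallyIntegrable (by norm_num))
    hcont.locallyIntegrable fun g hg hgc => ?_
  have hg₁ : HasCompactSupport (Complex.ofRealCLM ∘ g) := hgc.comp_left rfl
  have hg₂ : ContDiff ℝ ((⊤ : ℕ∞) : WithTop ℕ∞) (Complex.ofRealCLM ∘ g) :=
    Complex.ofRealCLM.contDiff.comp hg
  set φ : 𝓢(ℝ, ℂ) := hg₁.toSchwartzMap hg₂ with hφ
  have e : ∀ f : ℝ → ℂ, ∫ x, g x • f x = ∫ x, φ x * f x := fun f => by simp [hφ]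
  rw [e, e, integral_mul_fourierInv]
  have := VectorFourier.integral_fourierIntegral_smul_eq_flip (L := -innerₗ ℝ) (μ := volume)
    (ν := volume) (f := φ) (g := (G : ℝ → ℂ)) Real.continuous_fourierChar
    (by exact (continuous_inner (𝕜 := ℝ) (E := ℝ)).neg) φ.integrable hG
  simp only [smul_eq_mul] at this
  rw [SchwartzMap.fourierInv_coe]
  refine this.trans ?_
  have hflip : (-innerₗ ℝ).flip = -innerₗ ℝ := by
    ext
    simp
  rw [hflip]
  rfl

/-- Complex conjugation. -/
def conjL2 : L2C →L[ℝ] L2C := (Complex.conjCLE : ℂ →L[ℝ] ℂ).compLpL 2 volume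

theorem coeFn_conjL2 (A : L2C) : (conjL2 A : ℝ → ℂ) =ᵐ[volume] fun x => conj (A x) :=
  ContinuousLinearMap.coeFn_compLp _ A

/-- The integral formula gives this for Schwartz functions; density and continuity give the rest. -/
theorem fourier_conjL2 (A : L2C) : 𝓕 (conjL2 A) = reflect (𝓕 A) := by
  apply DenseRange.induction_on (p := fun A : L2C => 𝓕 (conjL2 A) = reflect (𝓕 A))
    (SchwartzMap.denseRange_toLpCLM (p := 2) ENNReal.ofNat_ne_top) A
  · apply isClosed_eq
    · exact (fourierCLM ℂ L2C).continuous.comp conjL2.continuous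
    · exact reflect.continuous.comp (fourierCLM ℂ L2C).continuous
  intro φ
  set ψ : 𝓢(ℝ, ℂ) := SchwartzMap.postcompCLM (Complex.conjCLE : ℂ →L[ℝ] ℂ) φ with hψ
  have h1 : conjL2 (φ.toLp 2) = ψ.toLp 2 := by
    apply Lp.ext
    filter_upwards [coeFn_conjL2 (φ.toLp 2), φ.coeFn_toLp 2 volume, ψ.coeFn_toLp 2 volume]
      with x h1 h2 h3
    rw [h1, h2, h3]
    rfl
  change 𝓕 (conjL2 (φ.toLp 2)) = reflect (𝓕 (φ.toLp 2))
  rw [h1, SchwartzMap.toLp_fourier_eq, SchwartzMap.toLp_fourier_eq]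
  apply Lp.ext
  filter_upwards [coeFn_reflect ((𝓕 φ).toLp 2), (𝓕 ψ).coeFn_toLp 2 volume,
    (quasiMeasurePreserving_neg volume).ae ((𝓕 φ).coeFn_toLp 2 volume)] with ξ h1 h2 h3
  rw [h1, h2, h3, SchwartzMap.fourier_coe, SchwartzMap.fourier_coe, Real.fourier_eq,
    Real.fourier_eq, ← integral_conj]
  refine integral_congr_ae (Filter.Eventually.of_forall fun x => ?_)
  simp [hψ, Circle.smul_def, ← Circle.coe_inv_eq_conj, ← AddChar.map_neg_eq_inv]

theorem reflect_fourier_complexify (f : L2R) :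
    reflect (𝓕 (complexify f) : L2C) = 𝓕 (complexify f) := by
  rw [← fourier_conjL2]
  congr 1
  apply Lp.ext
  filter_upwards [coeFn_conjL2 (complexify f), complexify_coeFn f] with x h1 h2
  rw [h1, h2, Complex.conj_ofReal]

/-- The inverse transform of a Hermitian function is fixed by conjugation, hence equals its real
part. -/
theorem exists_complexify_eq {G : L2C} (hG : reflect G = G) :
    ∃ f : L2R, complexify f = (𝓕⁻ G : L2C) := by
  have h : conjL2 (𝓕⁻ G) = (𝓕⁻ G : L2C) := by
    rw [← (fourierInv_fourier_eq (conjL2 (𝓕⁻ G : L2C)) : (𝓕⁻ (𝓕 _ : L2C) : L2C) = _),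
      fourier_conjL2, fourier_fourierInv_eq, hG]
  refine ⟨Complex.reCLM.compLpL 2 volume (𝓕⁻ G : L2C), ?_⟩
  apply Lp.ext
  have h1 := coeFn_conjL2 (𝓕⁻ G : L2C)
  rw [h] at h1
  filter_upwards [h1, complexify_coeFn (Complex.reCLM.compLpL 2 volume (𝓕⁻ G : L2C)),
    ContinuousLinearMap.coeFn_compLp Complex.reCLM (𝓕⁻ G : L2C)] with x h1 h2 h3
  refine h2.trans ?_
  refine (congrArg _ h3).trans ?_
  exact Complex.conj_eq_iff_re.1 h1.symm

/-! ### Sobolev spaces on the Fourier side -/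

theorem wt_eq_besselSymbol (s : ℝ) :
    wt s = fun ξ : ℝ => (((1 + ‖ξ‖ ^ 2) ^ (s / 2) : ℝ) : ℂ) := by
  funext ξ
  rw [wt, jb, Real.sqrt_eq_rpow, ← Real.rpow_mul (by positivity), Real.norm_eq_abs, sq_abs,
    show 1 / 2 * s = s / 2 by ring]

/-- The relation is stated with the inverse weight, which is bounded for s ≥ 0, so that only bounded
multipliers on L² occur. -/
theorem besselPotential_eq_iff {s : ℝ} (hs : 0 ≤ s) (g b : L2C) :
    TemperedDistribution.besselPotential ℝ ℂ s (g : 𝓢'(ℝ, ℂ)) = (b : 𝓢'(ℝ, ℂ)) ↔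
      (𝓕 g : L2C) = mulOp (wt (-s)) (𝓕 b : L2C) := by
  have hinj : Function.Injective (fun w : 𝓢'(ℝ, ℂ) => 𝓕 w) := fun v w h => by
    have := congrArg (fun w : 𝓢'(ℝ, ℂ) => 𝓕⁻ w) h
    simpa using this
  have hmul : ((mulOp (wt (-s)) (𝓕 b : L2C) : L2C) : 𝓢'(ℝ, ℂ)) =
      𝓕 (TemperedDistribution.besselPotential ℝ ℂ (-s) (b : 𝓢'(ℝ, ℂ))) := by
    rw [TemperedDistribution.fourier_besselPotential_eq_smulLeftCLM_fourier_apply,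
      Lp.fourier_toTemperedDistribution_eq, mulOp_apply (memLp_wt_neg hs),
      Lp.toTemperedDistribution_smul_eq (by rw [wt_eq_besselSymbol]; fun_prop),
      wt_eq_besselSymbol]
  rw [← TemperedDistribution.besselPotential_neg_apply_eq_iff, ← hinj.eq_iff, ← hmul, Lp.fourier_toTemperedDistribution_eq]
  exact ⟨fun h => (toTemperedDistribution_injective h).symm, fun h => by rw [h]⟩

/-- The weighted Fourier transform `(1 + ξ²)^{s/2} 𝓕 f` of an element of `H^s`. -/
def sobFourier (s : ℝ) : RealSobolev s →ₗᵢ[ℝ] L2C where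
  toFun f := 𝓕 f.bessel
  map_add' f g := by rw [map_add]; exact FourierTransform.fourier_add _ _
  map_smul' c f := by
    rw [map_smul]
    exact FourierTransform.fourier_smul (c : ℂ) (f.bessel)
  norm_map' f := Lp.norm_fourier_eq f.bessel

theorem fourier_complexify_toL2 {s : ℝ} (hs : 0 ≤ s) (f : RealSobolev s) :
    (𝓕 (complexify f.toL2) : L2C) = mulOp (wt (-s)) (sobFourier s f) :=
  (besselPotential_eq_iff hs _ _).1 f.bessel_spec

theorem wt_neg_arg (s ξ : ℝ) : wt s (-ξ) = conj (wt s ξ) := by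
  rw [wt, wt, jb_neg, Complex.conj_ofReal]

theorem reflect_sobFourier {s : ℝ} (hs : 0 ≤ s) (f : RealSobolev s) :
    reflect (sobFourier s f) = sobFourier s f := by
  refine eq_of_mulOp_eq (memLp_wt_neg hs) (wt_ne_zero _) ?_
  rw [← reflect_mulOp (memLp_wt_neg hs) (wt_neg_arg _), ← fourier_complexify_toL2 hs,
    reflect_fourier_complexify]

theorem exists_sobFourier_eq {s : ℝ} (hs : 0 ≤ s) {A : L2C} (hA : reflect A = A) :
    ∃ f, sobFourier s f = A := by
  have h : reflect (mulOp (wt (-s)) A) = mulOp (wt (-s)) A := by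
    rw [reflect_mulOp (memLp_wt_neg hs) (wt_neg_arg _), hA]
  obtain ⟨f, hf⟩ := exists_complexify_eq h
  have hF : (𝓕 (complexify f) : L2C) = mulOp (wt (-s)) A := by
    rw [hf, fourier_fourierInv_eq]
  have hb : TemperedDistribution.besselPotential ℝ ℂ s (complexify f : 𝓢'(ℝ, ℂ)) =
      ((𝓕⁻ A : L2C) : 𝓢'(ℝ, ℂ)) := by
    rw [besselPotential_eq_iff hs, hF, fourier_fourierInv_eq]
  let g : RealSobolev s := (⟨f, _, hb⟩ : sobolevSubmodule s)
  refine ⟨g, eq_of_mulOp_eq (memLp_wt_neg hs) (wt_ne_zero _) ?_⟩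
  rw [← fourier_complexify_toL2 hs, ← hF]
  rfl

theorem reflect_reflect (A : L2C) : reflect (reflect A) = A := by
  apply Lp.ext
  filter_upwards [coeFn_reflect (reflect A),
    (quasiMeasurePreserving_neg volume).ae (coeFn_reflect A)] with ξ h1 h2
  rw [h1, h2, Complex.conj_conj, neg_neg]

/-- Taking Hermitian parts extends the inverse of `sobFourier` to a linear map defined on all of L².
-/
theorem reflect_hermitianPart (A : L2C) :
    reflect ((2⁻¹ : ℝ) • (A + reflect A)) = (2⁻¹ : ℝ) • (A + reflect A) := by
  rw [map_smul, map_add, reflect_reflect, add_comm]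

theorem exists_sobFourier_eq_hermitianPart {s : ℝ} (hs : 0 ≤ s) (A : L2C) :
    ∃ f, sobFourier s f = (2⁻¹ : ℝ) • (A + reflect A) :=
  exists_sobFourier_eq hs (reflect_hermitianPart A)

/-- The element of `H^s` whose weighted Fourier transform is the hermitian part of a given
function. -/
def ofSobFourier (s : ℝ) (hs : 0 ≤ s) : L2C →L[ℝ] RealSobolev s :=
  LinearMap.mkContinuous
    { toFun := fun A => (exists_sobFourier_eq_hermitianPart hs A).choose
      map_add' := fun A B => by
        apply (sobFourier s).injective
        rw [(exists_sobFourier_eq_hermitianPart hs (A + B)).choose_spec, map_add (sobFourier s),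
          (exists_sobFourier_eq_hermitianPart hs A).choose_spec,
          (exists_sobFourier_eq_hermitianPart hs B).choose_spec, map_add, ← smul_add]
        congr 1
        abel
      map_smul' := fun c A => by
        apply (sobFourier s).injective
        rw [RingHom.id_apply, (exists_sobFourier_eq_hermitianPart hs (c • A)).choose_spec,
          map_smul (sobFourier s),
          (exists_sobFourier_eq_hermitianPart hs A).choose_spec, map_smul, ← smul_add,
          smul_comm] } 1
    fun A => by
      rw [← (sobFourier s).norm_map]
      simp only [LinearMap.coe_mk, AddHom.coe_mk]
      rw [(exists_sobFourier_eq_hermitianPart hs A).choose_spec, norm_smul]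
      have h := norm_add_le A (reflect A)
      rw [norm_reflect] at h
      norm_num
      linarith

theorem sobFourier_ofSobFourier {s : ℝ} (hs : 0 ≤ s) {A : L2C} (hA : reflect A = A) :
    sobFourier s (ofSobFourier s hs A) = A := by
  refine (exists_sobFourier_eq_hermitianPart hs A).choose_spec.trans ?_
  rw [hA, ← two_smul ℝ, smul_smul]
  norm_num

theorem ofSobFourier_sobFourier {s : ℝ} (hs : 0 ≤ s) (f : RealSobolev s) :
    ofSobFourier s hs (sobFourier s f) = f :=
  (sobFourier s).injective (sobFourier_ofSobFourier hs (reflect_sobFourier hs f))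

/-! ### The terms of the equation on the Fourier side -/

theorem memLp_derivSymbol_mul_wt {s : ℝ} (hs : 1 ≤ s) :
    MemLp (fun ξ => derivSymbol ξ * wt (-s) ξ) ∞ (volume : Measure ℝ) := by
  refine memLp_top_of_le (measurable_derivSymbol.mul (measurable_wt _)) (C := 2 * Real.pi) ?_
  intro ξ
  have h1 : jb ξ ^ (-s) ≤ jb ξ ^ (-1 : ℝ) :=
    Real.rpow_le_rpow_of_exponent_le (one_le_jb ξ) (by linarith)
  rw [norm_mul, norm_derivSymbol, norm_wt, mul_assoc]
  have h2 : |ξ| * jb ξ ^ (-s) ≤ 1 := by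
    calc |ξ| * jb ξ ^ (-s) ≤ jb ξ * jb ξ ^ (-1 : ℝ) := by
          have := jb_pos ξ
          gcongr
          exact abs_le_jb ξ
      _ = 1 := by rw [Real.rpow_neg_one, mul_inv_cancel₀ (jb_pos ξ).ne']
  have := mul_le_mul_of_nonneg_left h2 (by positivity : 0 ≤ 2 * Real.pi)
  linarith

theorem derivSymbol_neg_arg (ξ : ℝ) : derivSymbol (-ξ) = conj (derivSymbol ξ) := by
  simp [derivSymbol, map_ofNat]

theorem derivCLM_eq_lineDerivOp (w : 𝓢'(ℝ, ℂ)) :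
    TemperedDistribution.derivCLM ℂ w = LineDeriv.lineDerivOp (1 : ℝ) w := by
  ext φ
  rw [TemperedDistribution.derivCLM_apply_apply, TemperedDistribution.lineDerivOp_apply_apply]
  congr 2

theorem isWeakDeriv_iff {f g : L2R} {s : ℝ} (hs : 1 ≤ s) {A : L2C}
    (hf : (𝓕 (complexify f) : L2C) = mulOp (wt (-s)) A) :
    IsWeakDeriv f g ↔
      (𝓕 (complexify g) : L2C) = mulOp (fun ξ => derivSymbol ξ * wt (-s) ξ) A := by
  have hinj : Function.Injective (fun w : 𝓢'(ℝ, ℂ) => 𝓕 w) := fun v w h => by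
    have := congrArg (fun w : 𝓢'(ℝ, ℂ) => 𝓕⁻ w) h
    simpa using this
  have hmul : ((mulOp (fun ξ => derivSymbol ξ * wt (-s) ξ) A : L2C) : 𝓢'(ℝ, ℂ)) =
      𝓕 (TemperedDistribution.derivCLM ℂ (complexify f : 𝓢'(ℝ, ℂ))) := by
    rw [derivCLM_eq_lineDerivOp, TemperedDistribution.fourier_lineDerivOp_eq,
      Lp.fourier_toTemperedDistribution_eq, hf]
    ext φ
    have ht : (fun ξ : ℝ => ((inner ℝ ξ (1 : ℝ) : ℝ) : ℂ)).HasTemperateGrowth := by fun_prop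
    change _ = (2 * Real.pi * Complex.I) • (TemperedDistribution.smulLeftCLM ℂ
      (fun ξ : ℝ => ((inner ℝ ξ (1 : ℝ) : ℝ) : ℂ)) _ φ)
    rw [TemperedDistribution.smulLeftCLM_apply_apply, Lp.toTemperedDistribution_apply,
      Lp.toTemperedDistribution_apply, ← integral_smul]
    refine integral_congr_ae ?_
    filter_upwards [coeFn_mulOp (memLp_derivSymbol_mul_wt hs) A,
      coeFn_mulOp (memLp_wt_neg (s := s) (by linarith)) A] with ξ h1 h2
    rw [h1, h2, SchwartzMap.smulLeftCLM_apply_apply ht]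
    simp only [derivSymbol, smul_eq_mul, RCLike.inner_apply, conj_trivial, one_mul]
    ring
  unfold IsWeakDeriv
  rw [← hinj.eq_iff, ← hmul, Lp.fourier_toTemperedDistribution_eq]
  exact ⟨fun h => (toTemperedDistribution_injective h).symm, fun h => by rw [h]⟩

theorem hilbertTransform_eq (G : L2C) :
    hilbertTransform G = (𝓕⁻ (mulOp hilbertSymbol (𝓕 G : L2C)) : L2C) := by
  rw [hilbertTransform, mulOp_apply memLp_hilbertSymbol]

theorem integrable_of_lintegral_enorm_le {f : ℝ → ℂ} (hf : Measurable f) {C : ℝ}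
    (h : ∫⁻ x, ‖f x‖ₑ ≤ ENNReal.ofReal C) : Integrable f :=
  ⟨hf.aestronglyMeasurable, h.trans_lt ENNReal.ofReal_lt_top⟩

theorem fourierInv_apply_eq_fourier_neg (f : ℝ → ℂ) (x : ℝ) : 𝓕⁻ f x = 𝓕 f (-x) :=
  Real.fourierInv_eq_fourier_neg f x

theorem cv_eq_convolution (f g : ℝ → ℂ) :
    cv f g = convolution g f (ContinuousLinearMap.mul ℂ ℂ) volume := by
  funext ξ
  simp only [cv, convolution, ContinuousLinearMap.mul_apply']
  exact integral_congr_ae (Filter.Eventually.of_forall fun η => mul_comm _ _)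

theorem fourierInv_cv {f g : ℝ → ℂ} (hf : Integrable f) (hg : Integrable g) (x : ℝ) :
    𝓕⁻ (cv f g) x = 𝓕⁻ f x * 𝓕⁻ g x := by
  rw [fourierInv_apply_eq_fourier_neg, fourierInv_apply_eq_fourier_neg,
    fourierInv_apply_eq_fourier_neg, cv_eq_convolution,
    Real.fourier_mul_convolution_eq hg hf, mul_comm]

theorem integrable_cv_of_integrable {f g : ℝ → ℂ} (hf : Integrable f) (hg : Integrable g) :
    Integrable (cv f g) := by
  rw [cv_eq_convolution]
  exact hg.integrable_convolution _ hf

/-- For k > 3/2 both û and the transform of ∂ₓu are integrable, so the convolution theorem applies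
pointwise and identifies the transport term with the actual product u ∂ₓu. -/
theorem fourierInv_transport_ae_eq {k : ℝ} (hk : 3 / 2 < k) {A : L2C} {f g : L2R}
    (hf : (𝓕 (complexify f) : L2C) = mulOp (wt (-k)) A)
    (hg : (𝓕 (complexify g) : L2C) = mulOp (fun ξ => derivSymbol ξ * wt (-k) ξ) A) :
    ((𝓕⁻ (mulOp (wt (-(k - 1))) (transportCLM k hk A A)) : L2C) : ℝ → ℂ) =ᵐ[volume]
      fun x => ((f x * g x : ℝ) : ℂ) := by
  have i1 : Integrable (unweight k A) :=
    integrable_of_lintegral_enorm_le (measurable_unweight k A) (lintegral_unweight_le hk A)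
  have i2 : Integrable (fun ξ => derivSymbol ξ * unweight k A ξ) :=
    integrable_of_lintegral_enorm_le (by fun_prop) (lintegral_deriv_unweight_le hk A)
  have e1 : ((𝓕 (complexify f) : L2C) : ℝ → ℂ) =ᵐ[volume] unweight k A := by
    rw [hf]; exact coeFn_mulOp (memLp_wt_neg (by linarith)) A
  have e2 : ((𝓕 (complexify g) : L2C) : ℝ → ℂ) =ᵐ[volume]
      fun ξ => derivSymbol ξ * unweight k A ξ := by
    rw [hg]
    filter_upwards [coeFn_mulOp (memLp_derivSymbol_mul_wt (s := k) (by linarith)) A] with ξ h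
    rw [h, mul_assoc]; rfl
  have e3 : ((mulOp (wt (-(k - 1))) (transportCLM k hk A A) : L2C) : ℝ → ℂ) =ᵐ[volume]
      transport k A A := by
    filter_upwards [coeFn_mulOp (memLp_wt_neg (s := k - 1) (by linarith)) (transportCLM k hk A A),
      coeFn_transportCLM hk A A] with ξ h1 h2
    rw [h1, h2, weightedTransport]
    change wt _ ξ * (wt _ ξ * _) = _
    rw [← mul_assoc, wt_mul_wt, neg_add_cancel, wt_zero, one_mul]
  have hcongr : ∀ {F G : ℝ → ℂ}, F =ᵐ[volume] G → 𝓕⁻ F = 𝓕⁻ G := by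
    intro F G h
    funext x
    rw [Real.fourierInv_eq, Real.fourierInv_eq]
    refine integral_congr_ae ?_
    filter_upwards [h] with v hv
    rw [hv]
  have h1 := fourierInv_ae_eq (𝓕 (complexify f) : L2C) (i1.congr e1.symm)
  have h2 := fourierInv_ae_eq (𝓕 (complexify g) : L2C) (i2.congr e2.symm)
  have h3 := fourierInv_ae_eq (mulOp (wt (-(k - 1))) (transportCLM k hk A A))
    ((integrable_cv_of_integrable i1 i2).congr e3.symm)
  rw [hcongr e1, fourierInv_fourier_eq] at h1
  rw [hcongr e2, fourierInv_fourier_eq] at h2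
  rw [hcongr e3] at h3
  filter_upwards [h1, h2, h3, complexify_coeFn f, complexify_coeFn g] with x a b c d e
  rw [c, transport, fourierInv_cv i1 i2, ← a, ← b, d, e]
  push_cast
  rfl

/-! ### The equation in the sense of distributions -/

/-- Integration of the inverse Fourier transform against a Schwartz function. -/
def testFourierInv (φ : 𝓢(ℝ, ℂ)) : L2C →L[ℝ] ℂ :=
  (pair φ).comp ((fourierInvCLM ℂ L2C).restrictScalars ℝ)

theorem testFourierInv_apply (φ : 𝓢(ℝ, ℂ)) (G : L2C) :
    testFourierInv φ G = ∫ x, φ x * (𝓕⁻ G : L2C) x :=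
  pair_apply φ _

theorem eq_of_forall_testFourierInv_eq {A B : L2C}
    (h : ∀ φ, testFourierInv φ A = testFourierInv φ B) : A = B := by
  have h1 : (𝓕⁻ A : L2C) = 𝓕⁻ B := eq_of_forall_integral_eq fun φ => by
    rw [← testFourierInv_apply, ← testFourierInv_apply, h]
  have h2 := congrArg (fun G : L2C => (𝓕 G : L2C)) h1
  simpa using h2

theorem testFourierInv_lowOp {s : ℝ} (hs : 0 ≤ s) (f : RealSobolev s) (φ : 𝓢(ℝ, ℂ)) :
    testFourierInv φ (mulOp (wt (-s)) (sobFourier s f)) = ∫ x, φ x * (f.toL2 x : ℂ) := by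
  rw [testFourierInv_apply, ← fourier_complexify_toL2 hs, fourierInv_fourier_eq]
  refine integral_congr_ae ?_
  filter_upwards [complexify_coeFn f.toL2] with x h
  rw [h]

theorem exists_isWeakDeriv {s : ℝ} (hs : 1 ≤ s) (f : RealSobolev s) :
    ∃ g, IsWeakDeriv f.toL2 g := by
  have hs0 : 0 ≤ s := by linarith
  have h : reflect (mulOp (fun ξ => derivSymbol ξ * wt (-s) ξ) (sobFourier s f)) =
      mulOp (fun ξ => derivSymbol ξ * wt (-s) ξ) (sobFourier s f) := by
    rw [reflect_mulOp (memLp_derivSymbol_mul_wt hs), reflect_sobFourier hs0]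
    intro ξ
    rw [map_mul, derivSymbol_neg_arg, wt_neg_arg]
  obtain ⟨g, hg⟩ := exists_complexify_eq h
  refine ⟨g, (isWeakDeriv_iff hs (fourier_complexify_toL2 hs0 f)).2 ?_⟩
  rw [hg, fourier_fourierInv_eq]

theorem testFourierInv_rhs {k : ℝ} (hk : 3 / 2 < k) (f : RealSobolev k) {g : L2R}
    (hg : IsWeakDeriv f.toL2 g) (φ : 𝓢(ℝ, ℂ)) :
    testFourierInv φ (rhs k hk (sobFourier k f)) =
      (∫ x, φ x * hilbertTransform (complexify f.toL2) x) -
        ∫ x, φ x * ((f.toL2 x * g x : ℝ) : ℂ) := by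
  have hk0 : 0 ≤ k := by linarith
  have hf := fourier_complexify_toL2 hk0 f
  rw [rhs, map_sub, testFourierInv_apply, testFourierInv_apply, ← hf, ← hilbertTransform_eq]
  congr 1
  refine integral_congr_ae ?_
  filter_upwards [fourierInv_transport_ae_eq hk hf
    ((isWeakDeriv_iff (by linarith) hf).1 hg)] with x h
  rw [h]

/-- Every element of H^k has a weak derivative in L², and the tested right-hand side has the same
value whichever weak derivative is named. So the existential may be traded for the Fourier form. -/
theorem equation_iff {k : ℝ} (hk : 3 / 2 < k) (u : ℝ → RealSobolev k) (t : ℝ) :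
    (∃ ux : L2R, IsWeakDeriv (u t).toL2 ux ∧ ∀ φ : 𝓢(ℝ, ℂ),
      HasDerivAt (fun τ => ∫ x, φ x * ((u τ).toL2 x : ℂ))
        ((∫ x, φ x * hilbertTransform (complexify (u t).toL2) x) -
          ∫ x, φ x * (((u t).toL2 x * ux x : ℝ) : ℂ)) t) ↔
    ∀ φ : 𝓢(ℝ, ℂ), HasDerivAt
      (fun τ => testFourierInv φ (mulOp (wt (-k)) (sobFourier k (u τ))))
      (testFourierInv φ (rhs k hk (sobFourier k (u t)))) t := by
  have hk0 : 0 ≤ k := by linarith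
  constructor
  · rintro ⟨ux, hux, h⟩ φ
    simp only [testFourierInv_lowOp hk0, testFourierInv_rhs hk (u t) hux]
    exact h φ
  · intro h
    obtain ⟨ux, hux⟩ := exists_isWeakDeriv (by linarith) (u t)
    refine ⟨ux, hux, fun φ => ?_⟩
    have := h φ
    simpa only [testFourierInv_lowOp hk0, testFourierInv_rhs hk (u t) hux] using this

theorem real_eq_of_hasDerivAt_zero {f : ℝ → ℝ} {T : ℝ} (hf : ContinuousOn f (Icc 0 T))
    (hd : ∀ t ∈ Ioo 0 T, HasDerivAt f 0 t) {t : ℝ} (ht : t ∈ Icc 0 T) : f t = f 0 := by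
  rcases ht.1.eq_or_lt with h | h
  · rw [← h]
  · obtain ⟨c, -, hc⟩ := exists_hasDerivAt_eq_slope f (fun _ => 0) h
      (hf.mono (Icc_subset_Icc_right ht.2)) fun x hx => hd x ⟨hx.1, hx.2.trans_le ht.2⟩
    rw [eq_comm, div_eq_zero_iff] at hc
    rcases hc with hc | hc <;> linarith

theorem eq_of_hasDerivAt_zero {f : ℝ → ℂ} {T : ℝ} (hf : ContinuousOn f (Icc 0 T))
    (hd : ∀ t ∈ Ioo 0 T, HasDerivAt f 0 t) {t : ℝ} (ht : t ∈ Icc 0 T) : f t = f 0 := by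
  apply Complex.ext
  · exact real_eq_of_hasDerivAt_zero (f := fun t => (f t).re)
      (Complex.continuous_re.comp_continuousOn hf)
      (fun s hs => Complex.reCLM.hasFDerivAt.comp_hasDerivAt s (hd s hs)) ht
  · exact real_eq_of_hasDerivAt_zero (f := fun t => (f t).im)
      (Complex.continuous_im.comp_continuousOn hf)
      (fun s hs => Complex.imCLM.hasFDerivAt.comp_hasDerivAt s (hd s hs)) ht

/-- A weak solution is a strong one in L²: the right-hand side is a continuous curve, so its
primitive is differentiable in norm, and the weak equation forces the solution to equal this
primitive. Continuity extends the identity from interior times to the endpoints. -/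
theorem IsSolutionOn.isFourierSolution {k : ℝ} (hk : 3 / 2 < k) {T : ℝ}
    {u₀ : RealSobolev k} {u : ℝ → RealSobolev k} (h : IsSolutionOn u₀ (Icc 0 T) u) :
    IsFourierSolution k hk T fun t => sobFourier k (u t) := by
  have hk0 : 0 ≤ k := by linarith
  have hA : ContinuousOn (fun t => sobFourier k (u t)) (Icc 0 T) :=
    (sobFourier k).continuous.comp_continuousOn h.continuousOn
  have hg := (continuous_rhs hk).comp_continuousOn hA
  set b : ℝ → L2C := fun t => mulOp (wt (-k)) (sobFourier k (u 0)) +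
    ∫ s in (0 : ℝ)..t, rhs k hk (sobFourier k (u s)) with hb
  have hbd : ∀ t ∈ Icc 0 T, HasDerivWithinAt b (rhs k hk (sobFourier k (u t))) (Icc 0 T) t :=
    fun t ht => hasDerivWithinAt_integral hg _ ht
  have hbc : ContinuousOn b (Icc 0 T) := fun t ht => (hbd t ht).continuousWithinAt
  have hac : ContinuousOn (fun t => mulOp (wt (-k)) (sobFourier k (u t))) (Icc 0 T) :=
    (mulOp (wt (-k))).continuous.comp_continuousOn hA
  have hab : EqOn (fun t => mulOp (wt (-k)) (sobFourier k (u t))) b (Icc 0 T) := by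
    intro t ht
    refine eq_of_forall_testFourierInv_eq fun φ => ?_
    have h1 := eq_of_hasDerivAt_zero (f := fun t => testFourierInv φ
        (mulOp (wt (-k)) (sobFourier k (u t))) - testFourierInv φ (b t)) (T := T)
      (((testFourierInv φ).continuous.comp_continuousOn hac).sub
        ((testFourierInv φ).continuous.comp_continuousOn hbc))
      (fun s hs => ?_) ht
    · have h0 : b 0 = mulOp (wt (-k)) (sobFourier k (u 0)) := by simp [hb]
      simp only [h0, sub_self] at h1
      exact sub_eq_zero.1 h1
    · have e1 := (equation_iff hk u s).1 (h.equation s (by rwa [interior_Icc])) φ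
      have e2 := (testFourierInv φ).hasFDerivAt.comp_hasDerivAt s
        ((hbd s (Ioo_subset_Icc_self hs)).hasDerivAt (Icc_mem_nhds hs.1 hs.2))
      have := e1.sub e2
      rwa [sub_self] at this
  exact ⟨fun t _ => reflect_sobFourier hk0 _, hA,
    fun t ht => (hbd t ht).congr hab (hab ht)⟩

theorem IsFourierSolution.equation {k : ℝ} {hk : 3 / 2 < k} {T : ℝ} {u : ℝ → RealSobolev k}
    (h : IsFourierSolution k hk T fun t => sobFourier k (u t)) {t : ℝ} (ht : t ∈ Ioo 0 T) :
    ∃ ux : L2R, IsWeakDeriv (u t).toL2 ux ∧ ∀ φ : 𝓢(ℝ, ℂ),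
      HasDerivAt (fun τ => ∫ x, φ x * ((u τ).toL2 x : ℂ))
        ((∫ x, φ x * hilbertTransform (complexify (u t).toL2) x) -
          ∫ x, φ x * (((u t).toL2 x * ux x : ℝ) : ℂ)) t :=
  (equation_iff hk u t).2 fun φ => (testFourierInv φ).hasFDerivAt.comp_hasDerivAt t
    ((h.hasDeriv t (Ioo_subset_Icc_self ht)).hasDerivAt (Icc_mem_nhds ht.1 ht.2))

/-! ### Differentiability in time -/

/-- The right-hand side of the equation as an element of `H^{k-1}`. -/
def lowerRhs (k : ℝ) (hk : 3 / 2 < k) (A : L2C) : L2C :=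
  mulOp hilbertSymbol (mulOp (wt (-1)) A) - transportCLM k hk A A

theorem mulOp_wt_mulOp_wt {s r : ℝ} (hs : 0 ≤ s) (hr : 0 ≤ r) (A : L2C) :
    mulOp (wt (-s)) (mulOp (wt (-r)) A) = mulOp (wt (-(s + r))) A :=
  mulOp_mulOp (memLp_wt_neg hs) (memLp_wt_neg hr) (fun ξ => by rw [wt_mul_wt, neg_add]) A

theorem lowOp_lowerRhs {k : ℝ} (hk : 3 / 2 < k) (A : L2C) :
    mulOp (wt (-(k - 1))) (lowerRhs k hk A) = rhs k hk A := by
  rw [lowerRhs, map_sub, mulOp_comm (memLp_wt_neg (by linarith)) memLp_hilbertSymbol,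
    mulOp_wt_mulOp_wt (by linarith) (by linarith), sub_add_cancel, rhs]

theorem continuous_lowerRhs {k : ℝ} (hk : 3 / 2 < k) : Continuous (lowerRhs k hk) := by
  unfold lowerRhs
  have h : Continuous fun A : L2C => transportCLM k hk A A :=
    (transportCLM k hk).continuous.clm_apply continuous_id
  fun_prop

/-- The time derivative is known in L² and must be found in H^(k-1). The candidate is the primitive
of the right-hand side taken in H^(k-1); its difference from the curve has zero derivative after a
bounded injective multiplier, hence is constant. -/
theorem IsFourierSolution.hasDerivWithinAt_lower {k : ℝ} {hk : 3 / 2 < k} {T : ℝ} {A : ℝ → L2C}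
    (h : IsFourierSolution k hk T A) {t : ℝ} (ht : t ∈ Icc 0 T) :
    HasDerivWithinAt (fun t => mulOp (wt (-1)) (A t)) (lowerRhs k hk (A t)) (Icc 0 T) t := by
  set b : ℝ → L2C := fun t => mulOp (wt (-1)) (A 0) +
    ∫ s in (0 : ℝ)..t, lowerRhs k hk (A s) with hb
  have hbd : ∀ t ∈ Icc 0 T, HasDerivWithinAt b (lowerRhs k hk (A t)) (Icc 0 T) t :=
    fun t ht => hasDerivWithinAt_integral
      ((continuous_lowerRhs hk).comp_continuousOn h.continuousOn) _ ht
  have hdiff : ∀ s ∈ Icc 0 T, HasDerivWithinAt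
      (fun t => mulOp (wt (-(k - 1))) (mulOp (wt (-1)) (A t) - b t)) 0 (Icc 0 T) s := by
    intro s hs
    have h1 := ((mulOp (wt (-(k - 1)))).restrictScalars ℝ).hasFDerivAt.comp_hasDerivWithinAt s
      (hbd s hs)
    have h2 := (h.hasDeriv s hs).sub h1
    simp only [ContinuousLinearMap.coe_restrictScalars'] at h2
    rw [lowOp_lowerRhs, sub_self] at h2
    refine h2.congr (fun r _ => ?_) ?_ <;>
    · rw [map_sub, mulOp_wt_mulOp_wt (by linarith) (by linarith), sub_add_cancel]
      rfl
  have heq : EqOn (fun t => mulOp (wt (-1)) (A t)) b (Icc 0 T) := by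
    intro s hs
    rcases hs.1.eq_or_lt with h0 | h0
    · simp [hb, ← h0]
    have hT : 0 < T := h0.trans_le hs.2
    have hc := constant_of_derivWithin_zero (fun r hr => (hdiff r hr).differentiableWithinAt)
      (fun r hr => (hdiff r (Ico_subset_Icc_self hr)).derivWithin
        (uniqueDiffOn_Icc hT r (Ico_subset_Icc_self hr))) s hs
    have hb0 : b 0 = mulOp (wt (-1)) (A 0) := by simp [hb]
    rw [hb0, sub_self] at hc
    exact sub_eq_zero.1 (eq_of_mulOp_eq (memLp_wt_neg (by linarith)) (wt_ne_zero _) hc)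
  exact (hbd t ht).congr heq (heq ht)

/-! ### The time interval of existence -/

theorem exists_gt_of_mem_timeInterval {M : ℝ≥0∞} {t : ℝ} (ht : t ∈ timeInterval M) :
    ∃ T, t < T ∧ ENNReal.ofReal T < M := by
  obtain ⟨r, h1, h2⟩ := exists_between ht.2
  have hr : r ≠ ∞ := h2.ne_top
  refine ⟨r.toReal, ?_, by rwa [ENNReal.ofReal_toReal hr]⟩
  rw [← ENNReal.ofReal_toReal hr, ENNReal.ofReal_lt_ofReal_iff_of_nonneg ht.1] at h1
  exact h1

theorem Icc_subset_timeInterval {M : ℝ≥0∞} {T : ℝ} (hT : ENNReal.ofReal T < M) :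
    Icc 0 T ⊆ timeInterval M := fun _ ht =>
  ⟨ht.1, (ENNReal.ofReal_le_ofReal ht.2).trans_lt hT⟩

theorem Icc_mem_nhdsWithin_timeInterval {M : ℝ≥0∞} {t T : ℝ} (htT : t < T) :
    Icc 0 T ∈ nhdsWithin t (timeInterval M) := by
  filter_upwards [self_mem_nhdsWithin, mem_nhdsWithin_of_mem_nhds (Iio_mem_nhds htT)] with s h1 h2
  exact ⟨h1.1, le_of_lt h2⟩

theorem pos_of_mem_interior_timeInterval {M : ℝ≥0∞} {t : ℝ}
    (ht : t ∈ interior (timeInterval M)) : 0 < t := by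
  have h : timeInterval M ⊆ Ici 0 := fun s hs => hs.1
  have := interior_mono h ht
  rwa [interior_Ici] at this

theorem IsFourierSolution.congr {k : ℝ} {hk : 3 / 2 < k} {T : ℝ} {A B : ℝ → L2C}
    (h : IsFourierSolution k hk T A) (hAB : EqOn B A (Icc 0 T)) : IsFourierSolution k hk T B := by
  refine ⟨fun t ht => ?_, h.continuousOn.congr hAB, fun t ht => ?_⟩
  · rw [hAB ht]; exact h.hermitian t ht
  · rw [hAB ht]
    exact (h.hasDeriv t ht).congr (fun s hs => by rw [hAB hs]) (by rw [hAB ht])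

theorem isC1Into_of_isFourierSolution {k : ℝ} {hk : 3 / 2 < k} {M : ℝ≥0∞}
    {u : ℝ → RealSobolev k} (h : ∀ T : ℝ, 0 ≤ T → ENNReal.ofReal T < M →
      IsFourierSolution k hk T fun t => sobFourier k (u t)) :
    IsC1Into (k - 1) (timeInterval M) u := by
  have hk0 : 0 ≤ k := by linarith
  have hk1 : 0 ≤ k - 1 := by linarith
  refine ⟨fun t => ofSobFourier (k - 1) hk1 (mulOp (wt (-1)) (sobFourier k (u t))), ?_, ?_⟩
  · intro t _
    have hr : reflect (mulOp (wt (-1)) (sobFourier k (u t))) =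
        mulOp (wt (-1)) (sobFourier k (u t)) := by
      rw [reflect_mulOp (memLp_wt_neg (by linarith)) (wt_neg_arg _), reflect_sobFourier hk0]
    apply complexify_injective
    have h1 := fourier_complexify_toL2 hk1
      (ofSobFourier (k - 1) hk1 (mulOp (wt (-1)) (sobFourier k (u t))))
    rw [sobFourier_ofSobFourier hk1 hr, mulOp_wt_mulOp_wt hk1 zero_le_one, sub_add_cancel,
      ← fourier_complexify_toL2 hk0] at h1
    have h2 := congrArg (fun G : L2C => (𝓕⁻ G : L2C)) h1
    simpa using h2
  · refine (ofSobFourier (k - 1) hk1).contDiff.comp_contDiffOn ?_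
    -- Every point of the half-open interval lies strictly before some T < M, and near that point
    -- [0, T] is a neighbourhood within the interval.
    have hloc : ∀ t ∈ timeInterval M, UniqueDiffWithinAt ℝ (timeInterval M) t ∧
        HasDerivWithinAt (fun t => mulOp (wt (-1)) (sobFourier k (u t)))
          (lowerRhs k hk (sobFourier k (u t))) (timeInterval M) t ∧
        ContinuousWithinAt (fun t => lowerRhs k hk (sobFourier k (u t))) (timeInterval M) t := by
      intro t ht
      obtain ⟨T, htT, hT⟩ := exists_gt_of_mem_timeInterval ht
      have hmem : t ∈ Icc 0 T := ⟨ht.1, htT.le⟩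
      have hsol := h T (ht.1.trans htT.le) hT
      have hnhds := Icc_mem_nhdsWithin_timeInterval (M := M) htT
      exact ⟨(uniqueDiffOn_Icc (ht.1.trans_lt htT) t hmem).mono (Icc_subset_timeInterval hT),
        (hsol.hasDerivWithinAt_lower hmem).mono_of_mem_nhdsWithin hnhds,
        (((continuous_lowerRhs hk).comp_continuousOn hsol.continuousOn) t
          hmem).mono_of_mem_nhdsWithin hnhds⟩
    rw [contDiffOn_one_iff_derivWithin fun t ht => (hloc t ht).1]
    refine ⟨fun t ht => (hloc t ht).2.1.differentiableWithinAt, ?_⟩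
    exact ContinuousOn.congr (fun t ht => (hloc t ht).2.2)
      fun t ht => (hloc t ht).2.1.derivWithin (hloc t ht).1

end BurgersHilbert

end

/-! ### Transfer from the Fourier side to the Sobolev spaces -/

open BurgersHilbert in
theorem theoremA1 (k : ℝ) (hk : 3 / 2 < k) :
    -- a constant depending only on `k`, the maximal time of existence, and the solution map
    ∃ C : ℝ, 0 < C ∧
    ∃ (Tmax : BurgersHilbert.RealSobolev k → ℝ≥0∞)
      (S : BurgersHilbert.RealSobolev k → ℝ → BurgersHilbert.RealSobolev k),
    ∀ u₀ : BurgersHilbert.RealSobolev k,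
      -- existence
      0 < Tmax u₀ ∧
      BurgersHilbert.IsSolutionOn u₀ (BurgersHilbert.timeInterval (Tmax u₀)) (S u₀) ∧
      BurgersHilbert.IsC1Into (k - 1) (BurgersHilbert.timeInterval (Tmax u₀)) (S u₀) ∧
      -- uniqueness and maximality
      (∀ T : ℝ, 0 ≤ T → ∀ v : ℝ → BurgersHilbert.RealSobolev k,
        BurgersHilbert.IsSolutionOn u₀ (Set.Icc 0 T) v →
          ENNReal.ofReal T < Tmax u₀ ∧ Set.EqOn v (S u₀) (Set.Icc 0 T)) ∧
      -- lower bound for the time of existence, and bound of the solution up to that time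
      (ENNReal.ofReal (2 * C * ‖u₀‖))⁻¹ ≤ Tmax u₀ ∧
      (∀ t ∈ BurgersHilbert.timeInterval (Tmax u₀), 2 * C * ‖u₀‖ * t ≤ 1 →
        ‖S u₀ t‖ ≤ 2 * ‖u₀‖) ∧
      -- minimal blowup rate
      (∀ t ∈ BurgersHilbert.timeInterval (Tmax u₀),
        (ENNReal.ofReal (2 * C * ‖S u₀ t‖))⁻¹ ≤ Tmax u₀ - ENNReal.ofReal t) ∧
      -- continuous dependence on the initial data
      (∀ T ∈ BurgersHilbert.timeInterval (Tmax u₀), ∀ ε : ℝ, 0 < ε →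
        ∃ δ : ℝ, 0 < δ ∧ ∀ v₀ : BurgersHilbert.RealSobolev k, ‖v₀ - u₀‖ < δ →
          ENNReal.ofReal T < Tmax v₀ ∧
          ∀ t ∈ Set.Icc 0 T, ‖S v₀ t - S u₀ t‖ < ε) := by
  have hk0 : 0 ≤ k := by linarith
  have hk1 : 0 ≤ k - 1 := by linarith
  have hC0 := energyConst_nonneg hk0
  have hC : energyConst k ≤ energyConst k + 1 := by linarith
  -- Adding 1 makes the constant strictly positive; the estimates hold for every constant at least
  -- `energyConst k`.
  refine ⟨energyConst k + 1, by linarith, fun u₀ => maxTime k hk (sobFourier k u₀),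
    fun u₀ t => ofSobFourier k hk0 (maxSolution k hk (sobFourier k u₀) t), fun u₀ => ?_⟩
  have hr : ∀ v : RealSobolev k, reflect (sobFourier k v) = sobFourier k v :=
    reflect_sobFourier hk0
  -- Before the maximal time the solution is Hermitian, so passing through the Hermitian part loses
  -- nothing.
  have hS : ∀ (v : RealSobolev k) (t : ℝ), t ∈ timeInterval (maxTime k hk (sobFourier k v)) →
      sobFourier k (ofSobFourier k hk0 (maxSolution k hk (sobFourier k v) t)) =
        maxSolution k hk (sobFourier k v) t := fun v t ht =>
    sobFourier_ofSobFourier hk0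
      ((isFourierSolution_maxSolution ht.1 ht.2).1.hermitian t ⟨ht.1, le_rfl⟩)
  have hsol : ∀ (v : RealSobolev k) (T : ℝ), 0 ≤ T →
      ENNReal.ofReal T < maxTime k hk (sobFourier k v) →
      IsFourierSolution k hk T fun t =>
        sobFourier k (ofSobFourier k hk0 (maxSolution k hk (sobFourier k v) t)) :=
    fun v T hT hlt => (isFourierSolution_maxSolution hT hlt).1.congr
      fun t ht => hS v t (Icc_subset_timeInterval hlt ht)
  refine ⟨maxTime_pos hk (hr u₀), ⟨?_, ?_, ?_⟩, ?_, ?_, ?_, ?_, ?_, ?_⟩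
  · have h := (isFourierSolution_maxSolution (k := k) le_rfl
      (by rw [ENNReal.ofReal_zero]; exact maxTime_pos hk (hr u₀))).2
    simp only [h, ofSobFourier_sobFourier]
  · intro t ht
    obtain ⟨T, htT, hT⟩ := exists_gt_of_mem_timeInterval ht
    have h := (isFourierSolution_maxSolution (ht.1.trans htT.le) hT).1.continuousOn
    exact (((ofSobFourier k hk0).continuous.comp_continuousOn h) t
      ⟨ht.1, htT.le⟩).mono_of_mem_nhdsWithin (Icc_mem_nhdsWithin_timeInterval htT)
  · intro t ht
    obtain ⟨T, htT, hT⟩ := exists_gt_of_mem_timeInterval (interior_subset ht)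
    have ht0 := pos_of_mem_interior_timeInterval ht
    exact (hsol u₀ T (ht0.le.trans htT.le) hT).equation ⟨ht0, htT⟩
  · exact isC1Into_of_isFourierSolution fun T hT hlt => hsol u₀ T hT hlt
  · intro T hT v hv
    have h := hv.isFourierSolution hk
    have h0 : sobFourier k (v 0) = sobFourier k u₀ := by rw [hv.initial]
    refine ⟨(ofReal_lt_maxTime_iff hT).2 ⟨hT, _, h, h0⟩, fun t ht => ?_⟩
    simp only
    rw [← h.eqOn_maxSolution h0 ht, ofSobFourier_sobFourier]
  · rw [← (sobFourier k).norm_map]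
    exact maxTime_lower_bound hk hC (hr u₀)
  · intro t ht h
    simp only
    rw [← (sobFourier k).norm_map u₀] at h ⊢
    rw [← (sobFourier k).norm_map, hS u₀ t ht]
    exact norm_maxSolution_le hk hC (hr u₀) ht.1 h
  · intro t ht
    simp only
    rw [← (sobFourier k).norm_map, hS u₀ t ht]
    exact blowup_rate hC ht.1 ht.2
  · intro T hT ε hε
    obtain ⟨δ, hδ, h⟩ := global_dependence hT.1 hT.2 hε
    refine ⟨δ, hδ, fun v₀ hv => ?_⟩
    obtain ⟨h1, h2⟩ := h (sobFourier k v₀) (hr v₀)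
      (by rwa [← map_sub, (sobFourier k).norm_map])
    refine ⟨h1, fun t ht => ?_⟩
    simp only
    rw [← (sobFourier k).norm_map, map_sub, hS v₀ t (Icc_subset_timeInterval h1 ht),
      hS u₀ t (Icc_subset_timeInterval hT.2 ht)]
    exact h2 t ht
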